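/- An ample groupoid is a topological groupoid $\mathcal G$ (not necessarily Hausdorff) whose unit space $\mathcal G^0$ is locally compact, Hausdorff and totally disconnected and whose source map $s\colon\mathcal G\to\mathcal G^0$ is a local homeomorphism; $r$ denotes the range map. For a unital ring $R$ and $Y\in\{\mathcal G,\mathcal G^0\}$ let $RY$ be the $R$-submodule of $R^Y$ spanned by the characteristic functions of the open subsets of $Y$ that are compact Hausdorff. Then $R\mathcal G$ is a ring (in general without identity) under the convolution $(f*h)(g)=\sum_{r(a)=r(g)}f(a)h(a^{-1}g)$, and $R\mathcal G^0$ is a right $R\mathcal G$-module via $(hf)(x)=\sum_{s(g)=x}h(r(g))f(g)$. A left $R\mathcal G$-module $M$ is unitary if $R\mathcal G\cdot M=M$, and similarly on the right; $\mathrm{Tor}^{R\mathcal G}_n$ is formed in the categories of unitary modules, and a unitary right $R\mathcal G$-module $F$ is flat if $F\otimes_{R\mathcal G}-$ is exact on unitary left $R\mathcal G$-modules. For a unitary left $\mathbb Z\mathcal G$-module $M$ put $H_n(\mathcal G,M)=\mathrm{Tor}_n^{\mathbb Z\mathcal G}(\mathbb Z\mathcal G^0,M)$; a unitary left $R\mathcal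 G$-module is regarded as a $\mathbb Z\mathcal G$-module via the canonical homomorphism $\mathbb Z\mathcal G\to R\mathcal G$. The $R$-homological dimension of $\mathcal G$ is the supremum in $\{0,1,2,\dots,\infty\}$ of the integers $n\ge 0$ such that $H_n(\mathcal G,M)\ne 0$ for some unitary left $R\mathcal G$-module $M$ (it is $0$ if there is no such $n$). Let $R$ be a unital ring and $\mathcal G$ an ample groupoid. Then: 1. for every unitary left $R\mathcal G$-module $M$ and every $n\ge 0$ there is an isomorphism of abelian groups $H_n(\mathcal G,M)\cong\mathrm{Tor}_n^{R\mathcal G}(R\mathcal G^0,M)$; 2. the $R$-homological dimension of $\mathcal G$ equals the shortest length of a resolution of the right $R\mathcal G$-module $R\mathcal G^0$ by flat unitary right $R\mathcal G$-modules ($\infty$ if there is no such resolution of finite length); 3. the $R$-homological dimension of $\mathcal G$ is $0$ if and only if $R\mathcal G^0$ is a flat right $R\mathcal G$-module. -/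

import Mathlib

open CategoryTheory
open scoped TensorProduct

set_option linter.unusedSectionVars false

universe u v

/-! ### Modules over rings without identity -/

section NonUnital

/-- The ring `ℤ ⊕ A` obtained from a (not necessarily unital) ring `A` by adjoining an identity. -/
def AdjoinOne (A : Type u) [NonUnitalRing A] : Type u := Unitization ℤ A

namespace AdjoinOne

variable {A : Type u} [NonUnitalRing A]

noncomputable instance : Ring (AdjoinOne A) := inferInstanceAs (Ring (Unitization ℤ A))

/-- The inclusion of `A` in `ℤ ⊕ A`. -/
noncomputable def of : A →ₙ+* AdjoinOne A where
  toFun a := (Unitization.inr a : Unitization ℤ A)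
  map_mul' := Unitization.inr_mul ℤ
  map_zero' := Unitization.inr_zero ℤ
  map_add' := Unitization.inr_add ℤ

/-- The unital extension to `ℤ ⊕ A` of a ring homomorphism from `A` to a unital ring. -/
noncomputable def lift {C : Type*} [Ring C] (φ : A →ₙ+* C) : AdjoinOne A →+* C :=
  (Unitization.lift (R := ℤ) (A := A) (C := C)
    { φ with map_smul' := fun n a => map_zsmul φ n a }).toRingHom

@[simp]
theorem lift_of {C : Type*} [Ring C] (φ : A →ₙ+* C) (a : A) : lift φ (of a) = φ a := by
  change Unitization.lift (R := ℤ) _ (Unitization.inr a : Unitization ℤ A) = _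
  simp

theorem exists_mul_of (x : AdjoinOne A) (a : A) : ∃ b : A, x * of a = of b := by
  refine ⟨(show Unitization ℤ A from x).toProd.1 • a + (show Unitization ℤ A from x).toProd.2 * a,
    Unitization.ext ?_ ?_⟩
  · exact (Unitization.fst_mul (R := ℤ) x (Unitization.inr a)).trans (mul_zero _)
  · refine (Unitization.snd_mul (R := ℤ) x (Unitization.inr a)).trans ?_
    change _ + (0 : ℤ) • _ + _ = _
    rw [zero_smul, add_zero]
    rfl

end AdjoinOne

/-- A left module over a (not necessarily unital) ring `A` is the same thing as a unital module
over `ℤ ⊕ A`; it is *unitary* if `A • M = M`, where `A • M` is the additive subgroup generated by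
the products `a • m`. Right modules are modules over `Aᵐᵒᵖ`. -/
def isUnitary (A : Type u) [NonUnitalRing A] : ObjectProperty (ModuleCat.{u} (AdjoinOne A)) :=
  fun M => ∀ m : M, m ∈ AddSubgroup.closure
    {x : M | ∃ (a : A) (m' : M), x = AdjoinOne.of a • m'}

/-- The category of unitary left `A`-modules; `UnitaryMod Aᵐᵒᵖ` is the category of unitary right
`A`-modules. -/
abbrev UnitaryMod (A : Type u) [NonUnitalRing A] := (isUnitary A).FullSubcategory

/-- A ring has local units if every finite subset is fixed on both sides by an idempotent. -/
class HasLocalUnits (A : Type u) [NonUnitalRing A] : Prop where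
  exists_unit : ∀ t : Finset A, ∃ e : A, e * e = e ∧ ∀ a ∈ t, e * a = a ∧ a * e = a

instance HasLocalUnits.mulOpposite (A : Type u) [NonUnitalRing A] [HasLocalUnits A] :
    HasLocalUnits Aᵐᵒᵖ where
  exists_unit t := by
    classical
    obtain ⟨e, he, h⟩ := HasLocalUnits.exists_unit (t.image MulOpposite.unop)
    refine ⟨MulOpposite.op e, by rw [← MulOpposite.op_mul, he], fun a ha => ?_⟩
    have := h a.unop (Finset.mem_image_of_mem _ ha)
    exact ⟨MulOpposite.unop_injective (by simpa using this.2),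
      MulOpposite.unop_injective (by simpa using this.1)⟩

theorem isUnitary.exists_finset {A : Type u} [NonUnitalRing A]
    {M : ModuleCat.{u} (AdjoinOne A)} (hM : isUnitary A M) (m : M) :
    ∃ t : Finset A, ∀ e : A, (∀ a ∈ t, e * a = a ∧ a * e = a) → AdjoinOne.of e • m = m := by
  classical
  induction hM m using AddSubgroup.closure_induction with
  | mem x hx =>
    obtain ⟨a, m', rfl⟩ := hx
    refine ⟨{a}, fun e he => ?_⟩
    rw [← mul_smul, ← map_mul, (he a (by simp)).1]
  | zero => exact ⟨∅, fun e _ => smul_zero _⟩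
  | add x y _ _ hx hy =>
    obtain ⟨t, ht⟩ := hx
    obtain ⟨t', ht'⟩ := hy
    refine ⟨t ∪ t', fun e he => ?_⟩
    rw [smul_add, ht e fun a ha => he a (Finset.mem_union_left _ ha),
      ht' e fun a ha => he a (Finset.mem_union_right _ ha)]
  | neg x _ hx =>
    obtain ⟨t, ht⟩ := hx
    exact ⟨t, fun e he => by rw [smul_neg, ht e he]⟩

theorem isUnitary.exists_unit {A : Type u} [NonUnitalRing A] [HasLocalUnits A]
    {M : ModuleCat.{u} (AdjoinOne A)} (hM : isUnitary A M) (m : M) :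
    ∃ e : A, e * e = e ∧ AdjoinOne.of e • m = m := by
  obtain ⟨t, ht⟩ := hM.exists_finset m
  obtain ⟨e, he, h⟩ := HasLocalUnits.exists_unit t
  exact ⟨e, he, ht e h⟩

theorem isUnitary.of_exists {A : Type u} [NonUnitalRing A] {M : ModuleCat.{u} (AdjoinOne A)}
    (h : ∀ m : M, ∃ e : A, AdjoinOne.of e • m = m) : isUnitary A M := fun m => by
  obtain ⟨e, he⟩ := h m
  exact AddSubgroup.subset_closure ⟨e, m, he.symm⟩

variable (A : Type u) [NonUnitalRing A] [HasLocalUnits A]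

instance isUnitary.closedUnderSubobjects : (isUnitary A).IsClosedUnderSubobjects where
  prop_of_mono {M N} f _ hN := isUnitary.of_exists fun m => by
    obtain ⟨e, -, he⟩ := hN.exists_unit (f.hom m)
    refine ⟨e, (ModuleCat.mono_iff_injective f).1 inferInstance ?_⟩
    simpa using he

instance isUnitary.closedUnderQuotients : (isUnitary A).IsClosedUnderQuotients where
  prop_of_epi {M N} f _ hM := isUnitary.of_exists fun n => by
    obtain ⟨m, rfl⟩ := (ModuleCat.epi_iff_surjective f).1 inferInstance n
    obtain ⟨e, -, he⟩ := hM.exists_unit m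
    exact ⟨e, by rw [← map_smul, he]⟩

instance isUnitary.containsZero : (isUnitary A).ContainsZero where
  exists_zero := ⟨ModuleCat.of _ PUnit.{u + 1}, ModuleCat.isZero_of_subsingleton _,
    isUnitary.of_exists fun _ => ⟨0, Subsingleton.elim _ _⟩⟩

instance isUnitary.closedUnderFiniteProducts : (isUnitary A).IsClosedUnderFiniteProducts where
  isClosedUnderLimitsOfShape J _ := ⟨by
    classical
    rintro M ⟨p⟩
    refine isUnitary.of_exists fun m => ?_
    have := Fintype.ofFinite J
    choose t ht using fun j : J => (p.prop_diag_obj ⟨j⟩).exists_finset ((p.π.app ⟨j⟩).hom m)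
    obtain ⟨e, -, he⟩ := HasLocalUnits.exists_unit (Finset.univ.biUnion t)
    refine ⟨e, Limits.Concrete.isLimit_ext _ p.isLimit _ _ ?_⟩
    rintro ⟨j⟩
    refine (map_smul (p.π.app ⟨j⟩).hom _ _).trans (ht j e fun a ha => he a ?_)
    exact Finset.mem_biUnion.2 ⟨j, Finset.mem_univ _, ha⟩⟩

instance UnitaryMod.enoughProjectives : EnoughProjectives (UnitaryMod A) where
  presentation M := by
    let S := AdjoinOne A
    let I := {p : M.obj × A // p.2 * p.2 = p.2 ∧ AdjoinOne.of p.2 • p.1 = p.1}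
    let E : (I →₀ S) →ₗ[S] (I →₀ S) :=
      Finsupp.lsum ℕ fun i => LinearMap.toSpanSingleton S _ (Finsupp.single i (AdjoinOne.of i.1.2))
    let π : (I →₀ S) →ₗ[S] M.obj :=
      Finsupp.lsum ℕ fun i => LinearMap.toSpanSingleton S _ i.1.1
    have hE (i : I) (x : S) : E (Finsupp.single i x) =
        Finsupp.single i (x * AdjoinOne.of i.1.2) := by
      simp [E]
    have hEE (x : I →₀ S) : E (E x) = E x := by
      refine LinearMap.congr_fun (f := E ∘ₗ E) (Finsupp.lhom_ext fun i x => ?_) x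
      rw [LinearMap.comp_apply, hE, hE, mul_assoc, ← map_mul, i.2.1]
    let P : ModuleCat.{u} S := ModuleCat.of S (LinearMap.range E)
    have hP : isUnitary A P := by
      rintro ⟨_, y, rfl⟩
      induction y using Finsupp.induction_linear with
      | zero =>
        convert AddSubgroup.zero_mem _
        exact Subtype.ext (map_zero E)
      | add y z hy hz =>
        convert AddSubgroup.add_mem _ hy hz
        exact Subtype.ext (map_add E y z)
      | single i x =>
        obtain ⟨b, hb⟩ := AdjoinOne.exists_mul_of x i.1.2
        refine AddSubgroup.subset_closure ⟨b, ⟨E (Finsupp.single i (AdjoinOne.of i.1.2)), _, rfl⟩,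
          Subtype.ext ?_⟩
        change E _ = AdjoinOne.of b • E _
        rw [hE, hE, Finsupp.smul_single, smul_eq_mul, ← map_mul, i.2.1, ← hb, mul_assoc, ← map_mul,
          i.2.1]
    have hproj : Module.Projective S (LinearMap.range E) :=
      Module.Projective.of_split (LinearMap.range E).subtype E.rangeRestrict (by
        ext ⟨x, y, rfl⟩ : 1
        exact Subtype.ext (hEE y))
    have hproj' : Projective P := P.projective_of_categoryTheory_projective
    have := ObjectProperty.preservesEpimorphisms_ι_of_isNormalMonoCategory (isUnitary A)
    have hproj'' : Projective (⟨P, hP⟩ : UnitaryMod A) := ⟨fun {X Y} f g hg => by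
      have hg' : Epi g.hom := (isUnitary A).ι.map_epi g
      exact ⟨ObjectProperty.homMk (Projective.factorThru f.hom g.hom),
        ObjectProperty.hom_ext _ (Projective.factorThru_comp f.hom g.hom)⟩⟩
    let q : (⟨P, hP⟩ : UnitaryMod A) ⟶ M :=
      ObjectProperty.homMk (ModuleCat.ofHom (π ∘ₗ (LinearMap.range E).subtype))
    refine ⟨{ p := ⟨P, hP⟩, f := q, epi := (isUnitary A).ι.epi_of_epi_map ?_ }⟩
    refine (ModuleCat.epi_iff_surjective q.hom).2 fun m => ?_
    obtain ⟨e, he, hm⟩ := M.property.exists_unit m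
    refine ⟨⟨E (Finsupp.single ⟨(m, e), he, hm⟩ 1), _, rfl⟩, ?_⟩
    change π (E _) = m
    rw [hE]
    simp [π, hm]

end NonUnital

/-! ### Tensor products, Tor and flatness over rings without identity -/

section Tor

variable (A : Type u) [NonUnitalRing A]

/-- The tensor product `N ⊗_A M` of a right `A`-module `N` and a left `A`-module `M`: the quotient
of `N ⊗_ℤ M` by the subgroup generated by the elements `na ⊗ m - n ⊗ am`. -/
def BalTensor (N M : Type u) [AddCommGroup N] [Module (AdjoinOne Aᵐᵒᵖ) N] [AddCommGroup M]
    [Module (AdjoinOne A) M] : Type u :=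
  (N ⊗[ℤ] M) ⧸ AddSubgroup.closure {z : N ⊗[ℤ] M | ∃ (n : N) (a : A) (m : M),
    z = (AdjoinOne.of (MulOpposite.op a) • n) ⊗ₜ[ℤ] m - n ⊗ₜ[ℤ] (AdjoinOne.of a • m)}

namespace BalTensor

section

variable (N M : Type u) [AddCommGroup N] [Module (AdjoinOne Aᵐᵒᵖ) N] [AddCommGroup M]
  [Module (AdjoinOne A) M]

noncomputable instance : AddCommGroup (BalTensor A N M) :=
  inferInstanceAs (AddCommGroup ((N ⊗[ℤ] M) ⧸ AddSubgroup.closure _))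

variable {N M}

/-- The element `n ⊗ m` of `N ⊗_A M`. -/
def tmul (n : N) (m : M) : BalTensor A N M :=
  QuotientAddGroup.mk (n ⊗ₜ[ℤ] m)

variable {A}

theorem hom_ext {B : Type*} [AddCommGroup B] {f g : BalTensor A N M →+ B}
    (h : ∀ n m, f (tmul A n m) = g (tmul A n m)) : f = g := by
  refine QuotientAddGroup.addMonoidHom_ext _ (AddMonoidHom.ext fun z => ?_)
  induction z with
  | zero => rw [map_zero, map_zero]
  | tmul n m => exact h n m
  | add x y hx hy => rw [map_add, map_add, hx, hy]

end

variable {A}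
variable {N N' M M' : Type u} [AddCommGroup N] [Module (AdjoinOne Aᵐᵒᵖ) N]
  [AddCommGroup N'] [Module (AdjoinOne Aᵐᵒᵖ) N'] [AddCommGroup M] [Module (AdjoinOne A) M]
  [AddCommGroup M'] [Module (AdjoinOne A) M']

/-- The homomorphism `g ⊗ f : N ⊗_A M → N' ⊗_A M'`. -/
noncomputable def map (g : N →ₗ[AdjoinOne Aᵐᵒᵖ] N') (f : M →ₗ[AdjoinOne A] M') :
    BalTensor A N M →+ BalTensor A N' M' :=
  QuotientAddGroup.map _ _
    (TensorProduct.map g.toAddMonoidHom.toIntLinearMap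
      f.toAddMonoidHom.toIntLinearMap).toAddMonoidHom (by
    rw [AddSubgroup.closure_le]
    rintro _ ⟨n, a, m, rfl⟩
    refine AddSubgroup.subset_closure ⟨g n, a, f m, ?_⟩
    simp)

@[simp]
theorem map_tmul (g : N →ₗ[AdjoinOne Aᵐᵒᵖ] N') (f : M →ₗ[AdjoinOne A] M') (n : N) (m : M) :
    map g f (tmul A n m) = tmul A (g n) (f m) := rfl

theorem tmul_add_left (n n' : N) (m : M) : tmul A (n + n') m = tmul A n m + tmul A n' m :=
  congrArg QuotientAddGroup.mk (TensorProduct.add_tmul n n' m)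

end BalTensor

variable {A}

/-- The functor `- ⊗_A M` from unitary right `A`-modules to abelian groups. -/
noncomputable def tensorFunctor (M : UnitaryMod A) : UnitaryMod Aᵐᵒᵖ ⥤ AddCommGrpCat.{u} where
  obj N := AddCommGrpCat.of (BalTensor A N.obj M.obj)
  map g := AddCommGrpCat.ofHom (BalTensor.map g.hom.hom LinearMap.id)
  map_id N := by
    refine AddCommGrpCat.hom_ext (BalTensor.hom_ext fun n m => rfl)
  map_comp f g := by
    refine AddCommGrpCat.hom_ext (BalTensor.hom_ext fun n m => rfl)

instance tensorFunctor.additive (M : UnitaryMod A) : (tensorFunctor M).Additive where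
  map_add {_ _ _ _} :=
    AddCommGrpCat.hom_ext (BalTensor.hom_ext fun _ _ => BalTensor.tmul_add_left _ _ _)

/-- `Tor_n^A(N, M)` for unitary modules over a ring `A` with local units: the value at `N` of the
`n`-th left derived functor of `- ⊗_A M` on the category of unitary right `A`-modules. -/
noncomputable def unitaryTor [HasLocalUnits A] (n : ℕ) (N : UnitaryMod Aᵐᵒᵖ) (M : UnitaryMod A) :
    AddCommGrpCat.{u} :=
  ((tensorFunctor M).leftDerived n).obj N

/-- A unitary right `A`-module `N` is flat if `N ⊗_A -` preserves injectivity of homomorphisms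
between unitary left `A`-modules. -/
def IsFlatUnitary (N : UnitaryMod Aᵐᵒᵖ) : Prop :=
  ∀ ⦃M M' : UnitaryMod A⦄ (f : M ⟶ M'), Function.Injective f.hom →
    Function.Injective (BalTensor.map (LinearMap.id : N.obj →ₗ[AdjoinOne Aᵐᵒᵖ] N.obj) f.hom.hom)

/-- There is a flat resolution `0 → F n → ⋯ → F 1 → F 0 → N → 0` of `N` by unitary right
`A`-modules. -/
def HasFlatResolution (N : UnitaryMod Aᵐᵒᵖ) (n : ℕ) : Prop :=
  ∃ (F : ℕ → UnitaryMod Aᵐᵒᵖ) (d : ∀ i, F (i + 1) ⟶ F i) (ε : F 0 ⟶ N),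
    (∀ i, IsFlatUnitary (F i)) ∧ (∀ i, n < i → Subsingleton (F i).obj) ∧
    Function.Surjective ε.hom ∧ Function.Exact (d 0).hom ε.hom ∧
    ∀ i, Function.Exact (d (i + 1)).hom (d i).hom

/-- The shortest length of a flat resolution of `N` by unitary right `A`-modules (`⊤` if there is
no flat resolution of finite length). -/
noncomputable def flatDimension (N : UnitaryMod Aᵐᵒᵖ) : ℕ∞ :=
  sInf {d : ℕ∞ | ∃ n : ℕ, d = n ∧ HasFlatResolution N n}

end Tor


/-! ### Ample groupoids and their algebras -/

/-- The `R`-module `RX` of functions on `X` spanned by the characteristic functions of the open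
subsets of `X` that are compact Hausdorff spaces. -/
noncomputable def compactOpenSpan (R : Type v) (X : Type u) [Ring R] [TopologicalSpace X] :
    Submodule R (X → R) :=
  Submodule.span R {f | ∃ U : Set X, IsOpen U ∧ IsCompact U ∧ T2Space U ∧
    f = U.indicator (fun _ => (1 : R))}

/-- An ample groupoid with arrow space `G` and unit space `X`, which is locally compact, Hausdorff
and totally disconnected: a topological groupoid whose source map is a local homeomorphism. The
product `mul a b` is defined if the source of `a` is the range of `b`. The space `G` need not be
Hausdorff. -/
structure AmpleGroupoid (X G : Type u) [TopologicalSpace X] [LocallyCompactSpace X] [T2Space X]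
    [TotallyDisconnectedSpace X] [TopologicalSpace G] where
  /-- the source map -/
  s : G → X
  /-- the range map -/
  r : G → X
  /-- the inclusion of the unit space -/
  unit : X → G
  /-- the inverse -/
  inv : G → G
  /-- the product of composable arrows -/
  mul : ∀ a b : G, s a = r b → G
  s_unit : ∀ x, s (unit x) = x
  r_unit : ∀ x, r (unit x) = x
  s_inv : ∀ a, s (inv a) = r a
  r_inv : ∀ a, r (inv a) = s a
  s_mul : ∀ a b h, s (mul a b h) = s b
  r_mul : ∀ a b h, r (mul a b h) = r a
  mul_assoc : ∀ a b c (hab : s a = r b) (hbc : s b = r c),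
    mul (mul a b hab) c ((s_mul a b hab).trans hbc) =
      mul a (mul b c hbc) (hab.trans (r_mul b c hbc).symm)
  unit_mul : ∀ a, mul (unit (r a)) a (s_unit (r a)) = a
  mul_unit : ∀ a, mul a (unit (s a)) (r_unit (s a)).symm = a
  inv_mul : ∀ a, mul (inv a) a (s_inv a) = unit (s a)
  mul_inv : ∀ a, mul a (inv a) (r_inv a).symm = unit (r a)
  continuous_r : Continuous r
  continuous_unit : Continuous unit
  continuous_inv : Continuous inv
  continuous_mul : Continuous fun p : {p : G × G // s p.1 = r p.2} => mul p.1.1 p.1.2 p.2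
  isLocalHomeomorph_s : IsLocalHomeomorph s

namespace AmpleGroupoid

variable {X G : Type u} [TopologicalSpace X] [LocallyCompactSpace X] [T2Space X]
  [TotallyDisconnectedSpace X] [TopologicalSpace G] (𝒢 : AmpleGroupoid X G)

/-- The convolution product `(f * h)(g) = ∑ f(a) h(a⁻¹ g)`, the sum being over all arrows `a` with
the same range as `g`. -/
noncomputable def conv {R : Type*} [Ring R] (f h : G → R) (g : G) : R :=
  ∑ᶠ a : {a : G // 𝒢.r a = 𝒢.r g},
    f a.1 * h (𝒢.mul (𝒢.inv a.1) g ((𝒢.s_inv a.1).trans a.2))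

/-- The right action `(h f)(x) = ∑ h(r g) f(g)` of functions on arrows on functions on units, the
sum being over all arrows `g` with source `x`. -/
noncomputable def act {R : Type*} [Ring R] (h : X → R) (f : G → R) (x : X) : R :=
  ∑ᶠ g : {g : G // 𝒢.s g = x}, h (𝒢.r g.1) * f g.1

/-- A compact bisection: a compact open set of arrows on which source and range are injective. -/
structure IsBisection (U : Set G) : Prop where
  isOpen : IsOpen U
  isCompact : IsCompact U
  injOn_s : Set.InjOn 𝒢.s U
  injOn_r : Set.InjOn 𝒢.r U

theorem continuous_s : Continuous 𝒢.s := 𝒢.isLocalHomeomorph_s.continuous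

theorem inv_inv (a : G) : 𝒢.inv (𝒢.inv a) = a := by
  have e : ∀ b c (hb : b = c) (h : 𝒢.s b = 𝒢.r a) (h' : 𝒢.s c = 𝒢.r a),
      𝒢.mul b a h = 𝒢.mul c a h' := by rintro b _ rfl _ _; rfl
  have e' : ∀ b c (hb : b = c) (h : 𝒢.s (𝒢.inv (𝒢.inv a)) = 𝒢.r b)
      (h' : 𝒢.s (𝒢.inv (𝒢.inv a)) = 𝒢.r c),
      𝒢.mul (𝒢.inv (𝒢.inv a)) b h = 𝒢.mul (𝒢.inv (𝒢.inv a)) c h' := by rintro b _ rfl _ _; rfl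
  have h1 := 𝒢.mul_assoc (𝒢.inv (𝒢.inv a)) (𝒢.inv a) a (𝒢.s_inv _) (𝒢.s_inv _)
  rw [e _ _ (𝒢.inv_mul (𝒢.inv a)) _ ((𝒢.s_unit _).trans (𝒢.s_inv a)),
    e _ (𝒢.unit (𝒢.r a)) (by rw [𝒢.s_inv]) _ (𝒢.s_unit _), 𝒢.unit_mul,
    e' _ _ (𝒢.inv_mul a) _ (by rw [𝒢.s_inv, 𝒢.r_inv, 𝒢.r_unit]),
    e' _ (𝒢.unit (𝒢.s (𝒢.inv (𝒢.inv a)))) (by rw [𝒢.s_inv, 𝒢.r_inv]) _ (𝒢.r_unit _).symm,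
    𝒢.mul_unit] at h1
  exact h1.symm

theorem inv_mul_cancel (a b : G) (h : 𝒢.s a = 𝒢.r b) (h' : 𝒢.s (𝒢.inv a) = 𝒢.r (𝒢.mul a b h)) :
    𝒢.mul (𝒢.inv a) (𝒢.mul a b h) h' = b := by
  have e : ∀ c d (hc : c = d) (h : 𝒢.s c = 𝒢.r b) (h' : 𝒢.s d = 𝒢.r b),
      𝒢.mul c b h = 𝒢.mul d b h' := by rintro c _ rfl _ _; rfl
  rw [← 𝒢.mul_assoc (𝒢.inv a) a b (𝒢.s_inv a) h,
    e _ _ (𝒢.inv_mul a) _ ((𝒢.s_unit _).trans h),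
    e _ (𝒢.unit (𝒢.r b)) (by rw [h]) _ (𝒢.s_unit _), 𝒢.unit_mul]

theorem mul_inv_cancel (a g : G) (h : 𝒢.s (𝒢.inv a) = 𝒢.r g)
    (h' : 𝒢.s a = 𝒢.r (𝒢.mul (𝒢.inv a) g h)) :
    𝒢.mul a (𝒢.mul (𝒢.inv a) g h) h' = g := by
  have e : ∀ c d (hc : c = d) (h : 𝒢.s c = 𝒢.r g) (h' : 𝒢.s d = 𝒢.r g),
      𝒢.mul c g h = 𝒢.mul d g h' := by rintro c _ rfl _ _; rfl
  rw [← 𝒢.mul_assoc a (𝒢.inv a) g (𝒢.r_inv a).symm h,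
    e _ _ (𝒢.mul_inv a) _ ((𝒢.s_unit _).trans ((𝒢.s_inv a).symm.trans h)),
    e _ (𝒢.unit (𝒢.r g)) (by rw [← h, 𝒢.s_inv]) _ (𝒢.s_unit _), 𝒢.unit_mul]

/-- The inverse as a homeomorphism of the arrow space. -/
def invHomeomorph : G ≃ₜ G where
  toFun := 𝒢.inv
  invFun := 𝒢.inv
  left_inv := 𝒢.inv_inv
  right_inv := 𝒢.inv_inv
  continuous_toFun := 𝒢.continuous_inv
  continuous_invFun := 𝒢.continuous_inv

theorem isLocalHomeomorph_r : IsLocalHomeomorph 𝒢.r := by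
  have : 𝒢.r = 𝒢.s ∘ 𝒢.invHomeomorph := funext fun a => (𝒢.s_inv a).symm
  rw [this]
  exact 𝒢.isLocalHomeomorph_s.comp 𝒢.invHomeomorph.isLocalHomeomorph

theorem isOpenMap_unit : IsOpenMap 𝒢.unit := by
  have h : IsLocalHomeomorph 𝒢.unit := by
    refine IsLocalHomeomorph.of_comp ?_ 𝒢.isLocalHomeomorph_s 𝒢.continuous_unit
    have : 𝒢.s ∘ 𝒢.unit = id := funext 𝒢.s_unit
    rw [this]
    exact (Homeomorph.refl X).isLocalHomeomorph
  exact h.isOpenMap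

/-! #### Products of bisections -/

/-- The set of all products of composable arrows from `U` and `V`. -/
def setMul (U V : Set G) : Set G :=
  {g | ∃ a ∈ U, ∃ b ∈ V, ∃ h, g = 𝒢.mul a b h}

theorem mem_setMul_of (U V : Set G) {a : G} (ha : a ∈ U) (g : G) (h : 𝒢.s (𝒢.inv a) = 𝒢.r g)
    (hV : 𝒢.mul (𝒢.inv a) g h ∈ V) : g ∈ 𝒢.setMul U V :=
  ⟨a, ha, _, hV, by rw [𝒢.r_mul, 𝒢.r_inv], (𝒢.mul_inv_cancel a g h _).symm⟩

variable {𝒢}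

theorem setMul_assoc (U V W : Set G) :
    𝒢.setMul (𝒢.setMul U V) W = 𝒢.setMul U (𝒢.setMul V W) := by
  ext g
  constructor
  · rintro ⟨_, ⟨a, ha, b, hb, h, rfl⟩, c, hc, h', rfl⟩
    have h'' : 𝒢.s b = 𝒢.r c := (𝒢.s_mul a b h).symm.trans h'
    exact ⟨a, ha, _, ⟨b, hb, c, hc, h'', rfl⟩, _, 𝒢.mul_assoc a b c h h''⟩
  · rintro ⟨a, ha, _, ⟨b, hb, c, hc, h, rfl⟩, h', rfl⟩
    have h'' : 𝒢.s a = 𝒢.r b := h'.trans (𝒢.r_mul b c h)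
    exact ⟨_, ⟨a, ha, b, hb, h'', rfl⟩, c, hc, _, (𝒢.mul_assoc a b c h'' h).symm⟩

theorem IsBisection.setMul {U V : Set G} (hU : 𝒢.IsBisection U) (hV : 𝒢.IsBisection V) :
    𝒢.IsBisection (𝒢.setMul U V) where
  isOpen := by
    have he : Topology.IsOpenEmbedding fun u : U => 𝒢.r u :=
      (𝒢.isLocalHomeomorph_r.comp
        hU.isOpen.isOpenEmbedding_subtypeVal.isLocalHomeomorph).isOpenEmbedding_of_injective
        fun a b h => Subtype.ext (hU.injOn_r a.2 b.2 h)
    let W : Set G := 𝒢.r ⁻¹' Set.range fun u : U => 𝒢.r u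
    have hW : IsOpen W := he.isOpen_range.preimage 𝒢.continuous_r
    let e := he.toIsEmbedding.toHomeomorph
    let σ : W → U := fun g => e.symm ⟨𝒢.r g, g.2⟩
    have hσ : Continuous σ := e.symm.continuous.comp
      ((𝒢.continuous_r.comp continuous_subtype_val).subtype_mk _)
    have hσr (g : W) : 𝒢.r (σ g) = 𝒢.r g := congrArg Subtype.val (e.apply_symm_apply ⟨𝒢.r g, g.2⟩)
    have hσs (g : W) : 𝒢.s (𝒢.inv (σ g)) = 𝒢.r g := (𝒢.s_inv _).trans (hσr g)
    have hF : Continuous fun g : W => 𝒢.mul (𝒢.inv (σ g)) g (hσs g) :=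
      𝒢.continuous_mul.comp (((𝒢.continuous_inv.comp (continuous_subtype_val.comp hσ)).prodMk
        continuous_subtype_val).subtype_mk hσs)
    convert hW.isOpenMap_subtype_val _ (hV.isOpen.preimage hF) using 1
    ext g
    constructor
    · rintro ⟨a, ha, b, hb, h, rfl⟩
      let g : W := ⟨𝒢.mul a b h, ⟨⟨a, ha⟩, (𝒢.r_mul a b h).symm⟩⟩
      refine ⟨g, ?_, rfl⟩
      have hg : a = (σ g : G) :=
        hU.injOn_r ha (σ g).2 ((𝒢.r_mul a b h).symm.trans (hσr g).symm)
      have key : ∀ c (hc : a = c) h', 𝒢.mul (𝒢.inv c) (𝒢.mul a b h) h' ∈ V := by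
        rintro _ rfl h'
        rwa [𝒢.inv_mul_cancel]
      exact key _ hg _
    · rintro ⟨g, hg, rfl⟩
      exact 𝒢.mem_setMul_of U V (σ g).2 g (hσs g) hg
  isCompact := by
    have hcl : IsClosed {p : G × G | 𝒢.s p.1 = 𝒢.r p.2} :=
      isClosed_eq (𝒢.continuous_s.comp continuous_fst) (𝒢.continuous_r.comp continuous_snd)
    have hc := hcl.isClosedEmbedding_subtypeVal.isCompact_preimage (hU.isCompact.prod hV.isCompact)
    convert hc.image 𝒢.continuous_mul using 1
    ext g
    constructor
    · rintro ⟨a, ha, b, hb, h, rfl⟩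
      exact ⟨⟨(a, b), h⟩, ⟨ha, hb⟩, rfl⟩
    · rintro ⟨⟨⟨a, b⟩, h⟩, ⟨ha, hb⟩, rfl⟩
      exact ⟨a, ha, b, hb, h, rfl⟩
  injOn_s := by
    rintro _ ⟨a, ha, b, hb, h, rfl⟩ _ ⟨a', ha', b', hb', h', rfl⟩ e
    rw [𝒢.s_mul, 𝒢.s_mul] at e
    obtain rfl := hV.injOn_s hb hb' e
    obtain rfl := hU.injOn_s ha ha' (h.trans h'.symm)
    rfl
  injOn_r := by
    rintro _ ⟨a, ha, b, hb, h, rfl⟩ _ ⟨a', ha', b', hb', h', rfl⟩ e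
    rw [𝒢.r_mul, 𝒢.r_mul] at e
    obtain rfl := hU.injOn_r ha ha' e
    obtain rfl := hV.injOn_r hb hb' (h.symm.trans h')
    rfl

theorem isBisection_unit {W : Set X} (hW : IsOpen W) (hW' : IsCompact W) :
    𝒢.IsBisection (𝒢.unit '' W) where
  isOpen := 𝒢.isOpenMap_unit W hW
  isCompact := hW'.image 𝒢.continuous_unit
  injOn_s := by
    rintro _ ⟨x, -, rfl⟩ _ ⟨y, -, rfl⟩ h
    rw [𝒢.s_unit, 𝒢.s_unit] at h
    rw [h]
  injOn_r := by
    rintro _ ⟨x, -, rfl⟩ _ ⟨y, -, rfl⟩ h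
    rw [𝒢.r_unit, 𝒢.r_unit] at h
    rw [h]

theorem IsBisection.mono {U V : Set G} (hU : 𝒢.IsBisection U) (h : V ⊆ U) (hV : IsOpen V)
    (hV' : IsCompact V) : 𝒢.IsBisection V :=
  ⟨hV, hV', hU.injOn_s.mono h, hU.injOn_r.mono h⟩

theorem IsBisection.t2Space {U : Set G} (hU : 𝒢.IsBisection U) : T2Space U :=
  T2Space.of_injective_continuous (f := fun g : U => 𝒢.s g)
    (fun a b h => Subtype.ext (hU.injOn_s a.2 b.2 h)) (𝒢.continuous_s.comp continuous_subtype_val)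

theorem IsBisection.image_s {U : Set G} (hU : 𝒢.IsBisection U) {W : Set X} (hW : IsOpen W)
    (hW' : IsCompact W) : IsOpen (𝒢.s '' (U ∩ 𝒢.r ⁻¹' W)) ∧ IsCompact (𝒢.s '' (U ∩ 𝒢.r ⁻¹' W)) :=
  ⟨𝒢.isLocalHomeomorph_s.isOpenMap _ (hU.isOpen.inter (hW.preimage 𝒢.continuous_r)),
    (hU.isCompact.inter_right (hW'.isClosed.preimage 𝒢.continuous_r)).image 𝒢.continuous_s⟩

/-- Every arrow of an open set has a neighbourhood in it that is a compact bisection. -/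
theorem exists_isBisection {U : Set G} (hU : IsOpen U) {g : G} (hg : g ∈ U) :
    ∃ V, 𝒢.IsBisection V ∧ g ∈ V ∧ V ⊆ U := by
  obtain ⟨e, heg, he⟩ := 𝒢.isLocalHomeomorph_s g
  obtain ⟨e', heg', he'⟩ := 𝒢.isLocalHomeomorph_r g
  have hs : Set.InjOn 𝒢.s e.source := he ▸ e.injOn
  have hr : Set.InjOn 𝒢.r e'.source := he' ▸ e'.injOn
  let O := U ∩ e.source ∩ e'.source
  have hO : IsOpen O := (hU.inter e.open_source).inter e'.open_source
  have hgO : 𝒢.s g ∈ 𝒢.s '' O := ⟨g, ⟨⟨hg, heg⟩, heg'⟩, rfl⟩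
  obtain ⟨C, hC, hgC, hCO⟩ := exists_compact_subset (𝒢.isLocalHomeomorph_s.isOpenMap O hO) hgO
  obtain ⟨K, hK, hgK, hKC⟩ := (loc_compact_Haus_tot_disc_of_zero_dim (H := X)).mem_nhds_iff.1
    (isOpen_interior.mem_nhds hgC)
  have hKC' : K ⊆ C := hKC.trans interior_subset
  have hKc : IsCompact K := hC.of_isClosed_subset hK.1 hKC'
  have hV : O ∩ 𝒢.s ⁻¹' K = e.symm '' K := by
    ext a
    constructor
    · rintro ⟨ha, haK⟩
      refine ⟨𝒢.s a, haK, ?_⟩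
      rw [he]
      exact e.left_inv ha.1.2
    · rintro ⟨x, hx, rfl⟩
      obtain ⟨a, ha, rfl⟩ := hCO (hKC' hx)
      have : e.symm (𝒢.s a) = a := by
        rw [he]
        exact e.left_inv ha.1.2
      rw [this]
      exact ⟨ha, hx⟩
  have hKt : K ⊆ e.target := fun x hx => by
    obtain ⟨a, ha, rfl⟩ := hCO (hKC' hx)
    rw [he]
    exact e.map_source ha.1.2
  refine ⟨O ∩ 𝒢.s ⁻¹' K, ⟨hO.inter (hK.2.preimage 𝒢.continuous_s), ?_, ?_, ?_⟩,
    ⟨⟨⟨hg, heg⟩, heg'⟩, hgK⟩, fun a ha => ha.1.1.1⟩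
  · rw [hV]
    exact hKc.image_of_continuousOn (e.continuousOn_symm.mono hKt)
  · exact hs.mono fun a ha => ha.1.1.2
  · exact hr.mono fun a ha => ha.1.2

/-! #### The groupoid algebra -/

variable {R : Type v} [Ring R]

theorem isCompact_inter_and_isOpen_diff {U K V : Set G} (hU : IsOpen U) (hT : T2Space U)
    (hKU : K ⊆ U) (hVU : V ⊆ U) (hK : IsOpen K) (hK' : IsCompact K) (hV' : IsCompact V) :
    IsCompact (K ∩ V) ∧ IsOpen (K \ V) := by
  have key {L : Set G} (hL : L ⊆ U) : IsCompact L ↔ IsCompact ((↑) ⁻¹' L : Set U) := by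
    rw [Topology.IsEmbedding.subtypeVal.isCompact_iff, Subtype.image_preimage_coe,
      Set.inter_eq_right.2 hL]
  rw [key hKU] at hK'
  rw [key hVU] at hV'
  refine ⟨(key (Set.inter_subset_left.trans hKU)).2 (hK'.inter hV'), ?_⟩
  have := hU.isOpenMap_subtype_val _ (hV'.isClosed.isOpen_compl.inter
    (hK.preimage continuous_subtype_val))
  convert this using 1
  ext g
  constructor
  · rintro ⟨hg, hgV⟩
    exact ⟨⟨g, hKU hg⟩, ⟨hgV, hg⟩, rfl⟩
  · rintro ⟨g, ⟨hgV, hg⟩, rfl⟩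
    exact ⟨hg, hgV⟩

/-- The algebra `RG` is spanned by the characteristic functions of compact bisections. -/
theorem mem_compactOpenSpan_iff (f : G → R) : f ∈ compactOpenSpan R G ↔
    f ∈ AddSubgroup.closure {f : G → R | ∃ (c : R) (U : Set G),
      𝒢.IsBisection U ∧ f = U.indicator fun _ => c} := by
  classical
  constructor
  · intro hf
    suffices h : ∀ c : R, c • f ∈ AddSubgroup.closure {f : G → R | ∃ (c : R) (U : Set G),
        𝒢.IsBisection U ∧ f = U.indicator fun _ => c} by
      simpa using h 1
    induction hf using Submodule.span_induction with
    | mem f hf =>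
      obtain ⟨U, hU, hU', hT, rfl⟩ := hf
      intro c
      have hc : c • U.indicator (fun _ => (1 : R)) = U.indicator fun _ => c := by
        ext g
        by_cases hg : g ∈ U <;> simp [hg]
      rw [hc]
      have ind : ∀ F : Finset (Set G), (∀ V ∈ F, 𝒢.IsBisection V ∧ V ⊆ U) → ∀ K ⊆ U, IsOpen K →
          IsCompact K → K ⊆ ⋃ V ∈ F, V → K.indicator (fun _ => c) ∈
            AddSubgroup.closure {f : G → R | ∃ (c : R) (U : Set G),
              𝒢.IsBisection U ∧ f = U.indicator fun _ => c} := by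
        intro F
        induction F using Finset.induction_on with
        | empty =>
          intro _ K _ _ _ hK
          have : K = ∅ := by simpa using hK
          rw [this, Set.indicator_empty]
          exact AddSubgroup.zero_mem _
        | insert V F _ ih =>
          intro hF K hKU hK hK' hKF
          obtain ⟨hV, hVU⟩ := hF V (Finset.mem_insert_self V F)
          obtain ⟨h1, h2⟩ := isCompact_inter_and_isOpen_diff hU hT hKU hVU hK hK' hV.isCompact
          have : K.indicator (fun _ => c) =
              (K ∩ V).indicator (fun _ => c) + (K \ V).indicator fun _ => c := by
            ext g
            by_cases hg : g ∈ K <;> by_cases hg' : g ∈ V <;> simp [hg, hg']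
          rw [this]
          refine AddSubgroup.add_mem _ (AddSubgroup.subset_closure
            ⟨c, K ∩ V, hV.mono Set.inter_subset_right (hK.inter hV.isOpen) h1, rfl⟩) ?_
          refine ih (fun W hW => hF W (Finset.mem_insert_of_mem hW)) _
            (Set.sdiff_subset.trans hKU) h2 (hK'.diff hV.isOpen) ?_
          rintro g ⟨hg, hgV⟩
          have := hKF hg
          rw [Finset.set_biUnion_insert] at this
          exact this.resolve_left hgV
      choose! N hN using fun g (hg : g ∈ U) => exists_isBisection (𝒢 := 𝒢) hU hg
      obtain ⟨t, ht, htU⟩ := hU'.elim_nhds_subcover N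
        fun g hg => (hN g hg).1.isOpen.mem_nhds (hN g hg).2.1
      refine ind (t.image N) (fun V hV => ?_) U subset_rfl hU hU' ?_
      · obtain ⟨g, hg, rfl⟩ := Finset.mem_image.1 hV
        exact ⟨(hN g (ht g hg)).1, (hN g (ht g hg)).2.2⟩
      · rwa [Finset.set_biUnion_finset_image]
    | zero => exact fun c => by simp
    | add f f' _ _ h h' => exact fun c => by rw [smul_add]; exact AddSubgroup.add_mem _ (h c) (h' c)
    | smul a f _ h => exact fun c => by rw [smul_smul]; exact h (c * a)
  · intro hf
    refine (AddSubgroup.closure_le (compactOpenSpan R G).toAddSubgroup).2 ?_ hf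
    rintro _ ⟨c, U, hU, rfl⟩
    have hc : U.indicator (fun _ => c) = c • U.indicator fun _ => (1 : R) := by
      ext g
      by_cases hg : g ∈ U <;> simp [hg]
    rw [hc]
    exact Submodule.smul_mem _ c
      (Submodule.subset_span ⟨U, hU.isOpen, hU.isCompact, hU.t2Space, rfl⟩)

/-- The functions on the unit space are spanned by characteristic functions of compact open
sets. -/
theorem mem_compactOpenSpan_unit_iff (f : X → R) : f ∈ compactOpenSpan R X ↔
    f ∈ AddSubgroup.closure {f : X → R | ∃ (c : R) (W : Set X),
      IsOpen W ∧ IsCompact W ∧ f = W.indicator fun _ => c} := by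
  have hc (c : R) (U : Set X) :
      c • U.indicator (fun _ => (1 : R)) = U.indicator fun _ => c := by
    ext g
    by_cases hg : g ∈ U <;> simp [hg]
  constructor
  · intro hf
    suffices h : ∀ c : R, c • f ∈ AddSubgroup.closure {f : X → R | ∃ (c : R) (W : Set X),
        IsOpen W ∧ IsCompact W ∧ f = W.indicator fun _ => c} by
      simpa using h 1
    induction hf using Submodule.span_induction with
    | mem f hf =>
      obtain ⟨U, hU, hU', -, rfl⟩ := hf
      exact fun c => AddSubgroup.subset_closure ⟨c, U, hU, hU', hc c U⟩
    | zero => exact fun c => by simp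
    | add f f' _ _ h h' => exact fun c => by rw [smul_add]; exact AddSubgroup.add_mem _ (h c) (h' c)
    | smul a f _ h => exact fun c => by rw [smul_smul]; exact h (c * a)
  · intro hf
    refine (AddSubgroup.closure_le (compactOpenSpan R X).toAddSubgroup).2 ?_ hf
    rintro _ ⟨c, U, hU, hU', rfl⟩
    rw [← hc]
    exact Submodule.smul_mem _ c (Submodule.subset_span ⟨U, hU, hU', inferInstance, rfl⟩)

theorem span_induction {p : (G → R) → Prop}
    (ind : ∀ (c : R) (U : Set G), 𝒢.IsBisection U → p (U.indicator fun _ => c))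
    (add : ∀ f f', f ∈ compactOpenSpan R G → f' ∈ compactOpenSpan R G → p f → p f' → p (f + f'))
    {f : G → R} (hf : f ∈ compactOpenSpan R G) : p f := by
  have hf' := (mem_compactOpenSpan_iff (𝒢 := 𝒢) f).1 hf
  rw [← AddSubgroup.mem_toAddSubmonoid, AddSubgroup.closure_toAddSubmonoid] at hf'
  have h0 : 𝒢.IsBisection ∅ := ⟨isOpen_empty, isCompact_empty, Set.injOn_empty _, Set.injOn_empty _⟩
  refine (AddSubmonoid.closure_induction
    (motive := fun f _ => f ∈ compactOpenSpan R G ∧ p f) ?_ ?_ ?_ hf').2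
  · rintro f hf
    obtain ⟨c, U, hU, rfl⟩ : ∃ (c : R) (U : Set G), 𝒢.IsBisection U ∧ f = U.indicator fun _ => c := by
      rcases hf with hf | ⟨c, U, hU, hf⟩
      · exact hf
      · refine ⟨-c, U, hU, ?_⟩
        rw [← neg_neg f, hf]
        ext g
        by_cases hg : g ∈ U <;> simp [hg]
    exact ⟨(mem_compactOpenSpan_iff (𝒢 := 𝒢) _).2 (AddSubgroup.subset_closure ⟨c, U, hU, rfl⟩),
      ind c U hU⟩
  · refine ⟨Submodule.zero_mem _, ?_⟩
    have := ind 0 ∅ h0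
    rwa [Set.indicator_empty] at this
  · rintro f f' _ _ ⟨h1, h2⟩ ⟨h3, h4⟩
    exact ⟨Submodule.add_mem _ h1 h3, add _ _ h1 h3 h2 h4⟩

theorem span_unit_induction {p : (X → R) → Prop}
    (ind : ∀ (c : R) (W : Set X), IsOpen W → IsCompact W → p (W.indicator fun _ => c))
    (add : ∀ f f', f ∈ compactOpenSpan R X → f' ∈ compactOpenSpan R X → p f → p f' → p (f + f'))
    {f : X → R} (hf : f ∈ compactOpenSpan R X) : p f := by
  have hf' := (mem_compactOpenSpan_unit_iff f).1 hf
  rw [← AddSubgroup.mem_toAddSubmonoid, AddSubgroup.closure_toAddSubmonoid] at hf'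
  refine (AddSubmonoid.closure_induction
    (motive := fun f _ => f ∈ compactOpenSpan R X ∧ p f) ?_ ?_ ?_ hf').2
  · rintro f hf
    obtain ⟨c, U, hU, hU', rfl⟩ : ∃ (c : R) (U : Set X), IsOpen U ∧ IsCompact U ∧
        f = U.indicator fun _ => c := by
      rcases hf with hf | ⟨c, U, hU, hU', hf⟩
      · exact hf
      · refine ⟨-c, U, hU, hU', ?_⟩
        rw [← neg_neg f, hf]
        ext g
        by_cases hg : g ∈ U <;> simp [hg]
    exact ⟨(mem_compactOpenSpan_unit_iff _).2 (AddSubgroup.subset_closure ⟨c, U, hU, hU', rfl⟩),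
      ind c U hU hU'⟩
  · refine ⟨Submodule.zero_mem _, ?_⟩
    have := ind 0 ∅ isOpen_empty isCompact_empty
    rwa [Set.indicator_empty] at this
  · rintro f f' _ _ ⟨h1, h2⟩ ⟨h3, h4⟩
    exact ⟨Submodule.add_mem _ h1 h3, add _ _ h1 h3 h2 h4⟩

theorem indicator_mem {U : Set G} (hU : 𝒢.IsBisection U) (c : R) :
    U.indicator (fun _ => c) ∈ compactOpenSpan R G :=
  (mem_compactOpenSpan_iff (𝒢 := 𝒢) _).2 (AddSubgroup.subset_closure ⟨c, U, hU, rfl⟩)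

theorem indicator_unit_mem {W : Set X} (hW : IsOpen W) (hW' : IsCompact W) (c : R) :
    W.indicator (fun _ => c) ∈ compactOpenSpan R X :=
  (mem_compactOpenSpan_unit_iff _).2 (AddSubgroup.subset_closure ⟨c, W, hW, hW', rfl⟩)

theorem finite_fiber {f : G → R} (hf : f ∈ compactOpenSpan R G) :
    ∀ x, {a | 𝒢.r a = x ∧ f a ≠ 0}.Finite ∧ {a | 𝒢.s a = x ∧ f a ≠ 0}.Finite := by
  refine span_induction (𝒢 := 𝒢) (p := fun f => ∀ x,
    {a | 𝒢.r a = x ∧ f a ≠ 0}.Finite ∧ {a | 𝒢.s a = x ∧ f a ≠ 0}.Finite) (fun c U hU x => ?_) (fun f f' _ _ h h' x => ?_) hf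
  · constructor <;> refine Set.Subsingleton.finite ?_
    · rintro a ⟨rfl, ha⟩ b ⟨hb, hb'⟩
      exact hU.injOn_r (Set.mem_of_indicator_ne_zero ha) (Set.mem_of_indicator_ne_zero hb') hb.symm
    · rintro a ⟨rfl, ha⟩ b ⟨hb, hb'⟩
      exact hU.injOn_s (Set.mem_of_indicator_ne_zero ha) (Set.mem_of_indicator_ne_zero hb') hb.symm
  · constructor
    · refine ((h x).1.union (h' x).1).subset ?_
      rintro a ⟨hx, ha⟩
      by_cases h0 : f a = 0
      · exact Or.inr ⟨hx, fun h => ha (by simp [h0, h])⟩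
      · exact Or.inl ⟨hx, h0⟩
    · refine ((h x).2.union (h' x).2).subset ?_
      rintro a ⟨hx, ha⟩
      by_cases h0 : f a = 0
      · exact Or.inr ⟨hx, fun h => ha (by simp [h0, h])⟩
      · exact Or.inl ⟨hx, h0⟩

theorem finite_support_conv {f : G → R} (hf : f ∈ compactOpenSpan R G) (h : G → R) (g : G) :
    (Function.support fun a : {a : G // 𝒢.r a = 𝒢.r g} =>
      f a.1 * h (𝒢.mul (𝒢.inv a.1) g ((𝒢.s_inv a.1).trans a.2))).Finite := by
  refine ((finite_fiber (𝒢 := 𝒢) hf (𝒢.r g)).1.preimage Subtype.val_injective.injOn).subset ?_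
  exact fun a ha => ⟨a.2, left_ne_zero_of_mul ha⟩

theorem finite_support_act {f : G → R} (hf : f ∈ compactOpenSpan R G) (h : X → R) (x : X) :
    (Function.support fun g : {g : G // 𝒢.s g = x} => h (𝒢.r g.1) * f g.1).Finite := by
  refine ((finite_fiber (𝒢 := 𝒢) hf x).2.preimage Subtype.val_injective.injOn).subset ?_
  exact fun a ha => ⟨a.2, right_ne_zero_of_mul ha⟩

theorem conv_add_left {f f' : G → R} (hf : f ∈ compactOpenSpan R G)
    (hf' : f' ∈ compactOpenSpan R G) (h : G → R) :
    𝒢.conv (f + f') h = 𝒢.conv f h + 𝒢.conv f' h := by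
  funext g
  simp only [conv, Pi.add_apply, add_mul]
  exact finsum_add_distrib (finite_support_conv hf h g) (finite_support_conv hf' h g)

theorem conv_add_right {f : G → R} (hf : f ∈ compactOpenSpan R G) (h h' : G → R) :
    𝒢.conv f (h + h') = 𝒢.conv f h + 𝒢.conv f h' := by
  funext g
  simp only [conv, Pi.add_apply, mul_add]
  exact finsum_add_distrib (finite_support_conv hf h g) (finite_support_conv hf h' g)

theorem act_add_left {f : G → R} (hf : f ∈ compactOpenSpan R G) (h h' : X → R) :
    𝒢.act (h + h') f = 𝒢.act h f + 𝒢.act h' f := by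
  funext g
  simp only [act, Pi.add_apply, add_mul]
  exact finsum_add_distrib (finite_support_act hf h g) (finite_support_act hf h' g)

theorem act_add_right {f f' : G → R} (hf : f ∈ compactOpenSpan R G)
    (hf' : f' ∈ compactOpenSpan R G) (h : X → R) :
    𝒢.act h (f + f') = 𝒢.act h f + 𝒢.act h f' := by
  funext g
  simp only [act, Pi.add_apply, mul_add]
  exact finsum_add_distrib (finite_support_act hf h g) (finite_support_act hf' h g)

theorem conv_indicator {U V : Set G} (hU : 𝒢.IsBisection U) (c d : R) :
    𝒢.conv (U.indicator fun _ => c) (V.indicator fun _ => d) =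
      (𝒢.setMul U V).indicator fun _ => c * d := by
  classical
  funext g
  rw [conv]
  by_cases hg : g ∈ 𝒢.setMul U V
  · rw [Set.indicator_of_mem hg]
    obtain ⟨a, ha, b, hb, h, rfl⟩ := hg
    rw [finsum_eq_single _ (⟨a, (𝒢.r_mul a b h).symm⟩ : {c : G // 𝒢.r c = 𝒢.r (𝒢.mul a b h)}),
      𝒢.inv_mul_cancel, Set.indicator_of_mem ha, Set.indicator_of_mem hb]
    rintro ⟨a', ha'⟩ hne
    rw [Set.indicator_of_notMem, zero_mul]
    exact fun h' => hne (Subtype.ext (hU.injOn_r h' ha (ha'.trans (𝒢.r_mul a b h))))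
  · rw [Set.indicator_of_notMem hg, ← finsum_zero (α := {c : G // 𝒢.r c = 𝒢.r g})]
    refine finsum_congr fun a => ?_
    by_cases ha : a.1 ∈ U
    · rw [Set.indicator_of_notMem (s := V), mul_zero]
      exact fun h => hg (𝒢.mem_setMul_of U V ha g _ h)
    · rw [Set.indicator_of_notMem ha, zero_mul]

theorem act_indicator {V : Set G} (hV : 𝒢.IsBisection V) (W : Set X) (c d : R) :
    𝒢.act (W.indicator fun _ => c) (V.indicator fun _ => d) =
      (𝒢.s '' (V ∩ 𝒢.r ⁻¹' W)).indicator fun _ => c * d := by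
  classical
  funext x
  rw [act]
  by_cases hx : x ∈ 𝒢.s '' (V ∩ 𝒢.r ⁻¹' W)
  · rw [Set.indicator_of_mem hx]
    obtain ⟨g, ⟨hg, hgW⟩, rfl⟩ := hx
    rw [finsum_eq_single _ (⟨g, rfl⟩ : {h : G // 𝒢.s h = 𝒢.s g}),
      Set.indicator_of_mem hg, Set.indicator_of_mem (s := W) hgW]
    rintro ⟨g', hg'⟩ hne
    rw [Set.indicator_of_notMem (s := V), mul_zero]
    exact fun h' => hne (Subtype.ext (hV.injOn_s h' hg hg'))
  · rw [Set.indicator_of_notMem hx, ← finsum_zero (α := {h : G // 𝒢.s h = x})]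
    refine finsum_congr fun g => ?_
    by_cases hg : g.1 ∈ V
    · rw [Set.indicator_of_notMem (s := W), zero_mul]
      exact fun h => hx ⟨g, ⟨hg, h⟩, g.2⟩
    · rw [Set.indicator_of_notMem hg, mul_zero]

theorem conv_mem {f h : G → R} (hf : f ∈ compactOpenSpan R G) (hh : h ∈ compactOpenSpan R G) :
    𝒢.conv f h ∈ compactOpenSpan R G := by
  refine span_induction (𝒢 := 𝒢) (p := fun f => 𝒢.conv f h ∈ compactOpenSpan R G
    ) (fun c U hU => ?_) (fun f f' m m' h1 h2 => ?_) hf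
  · refine span_induction (𝒢 := 𝒢) (p := fun h =>
      𝒢.conv (U.indicator fun _ => c) h ∈ compactOpenSpan R G) (fun d V hV => ?_) (fun f f' _ _ h1 h2 => ?_) hh
    · rw [conv_indicator hU]
      exact indicator_mem (hU.setMul hV) _
    · rw [conv_add_right (indicator_mem hU c)]
      exact Submodule.add_mem _ h1 h2
  · rw [conv_add_left m m']
    exact Submodule.add_mem _ h1 h2

theorem act_mem {h : X → R} {f : G → R} (hh : h ∈ compactOpenSpan R X)
    (hf : f ∈ compactOpenSpan R G) : 𝒢.act h f ∈ compactOpenSpan R X := by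
  refine span_induction (𝒢 := 𝒢) (p := fun f => 𝒢.act h f ∈ compactOpenSpan R X
    ) (fun d V hV => ?_) (fun f f' m m' h1 h2 => ?_) hf
  · refine span_unit_induction (p := fun h =>
      𝒢.act h (V.indicator fun _ => d) ∈ compactOpenSpan R X) (fun c W hW hW' => ?_) (fun f f' _ _ h1 h2 => ?_) hh
    · rw [act_indicator hV]
      exact indicator_unit_mem (hV.image_s hW hW').1 (hV.image_s hW hW').2 _
    · rw [act_add_left (indicator_mem hV d)]
      exact Submodule.add_mem _ h1 h2
  · rw [act_add_right m m']
    exact Submodule.add_mem _ h1 h2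

theorem conv_assoc {f g h : G → R} (hf : f ∈ compactOpenSpan R G) (hg : g ∈ compactOpenSpan R G)
    (hh : h ∈ compactOpenSpan R G) :
    𝒢.conv (𝒢.conv f g) h = 𝒢.conv f (𝒢.conv g h) := by
  refine span_induction (𝒢 := 𝒢) (p := fun f =>
    𝒢.conv (𝒢.conv f g) h = 𝒢.conv f (𝒢.conv g h)) (fun c U hU => ?_) (fun f f' m m' h1 h2 => ?_) hf
  · refine span_induction (𝒢 := 𝒢) (p := fun g =>
      𝒢.conv (𝒢.conv (U.indicator fun _ => c) g) h = 𝒢.conv (U.indicator fun _ => c) (𝒢.conv g h)) (fun d V hV => ?_) (fun f f' m m' h1 h2 => ?_) hg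
    · refine span_induction (𝒢 := 𝒢) (p := fun h =>
        𝒢.conv (𝒢.conv (U.indicator fun _ => c) (V.indicator fun _ => d)) h =
          𝒢.conv (U.indicator fun _ => c) (𝒢.conv (V.indicator fun _ => d) h)) (fun e W hW => ?_) (fun f f' m m' h1 h2 => ?_) hh
      · rw [conv_indicator hU, conv_indicator (hU.setMul hV), conv_indicator hV,
          conv_indicator hU, setMul_assoc, _root_.mul_assoc]
      · rw [conv_add_right (conv_mem (indicator_mem hU c) (indicator_mem hV d)),
          conv_add_right (indicator_mem hV d), conv_add_right (indicator_mem hU c), h1, h2]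
    · rw [conv_add_right (indicator_mem hU c), conv_add_left (conv_mem (indicator_mem hU c) m)
        (conv_mem (indicator_mem hU c) m'), conv_add_left m m', conv_add_right (indicator_mem hU c),
        h1, h2]
  · rw [conv_add_left m m', conv_add_left (conv_mem m hg) (conv_mem m' hg), conv_add_left m m',
      h1, h2]

theorem act_act {h : X → R} {f f' : G → R} (hh : h ∈ compactOpenSpan R X)
    (hf : f ∈ compactOpenSpan R G) (hf' : f' ∈ compactOpenSpan R G) :
    𝒢.act (𝒢.act h f) f' = 𝒢.act h (𝒢.conv f f') := by
  refine span_induction (𝒢 := 𝒢) (p := fun f =>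
    𝒢.act (𝒢.act h f) f' = 𝒢.act h (𝒢.conv f f')) (fun c U hU => ?_) (fun f f' m m' h1 h2 => ?_) hf
  · refine span_induction (𝒢 := 𝒢) (p := fun f' =>
      𝒢.act (𝒢.act h (U.indicator fun _ => c)) f' = 𝒢.act h (𝒢.conv (U.indicator fun _ => c) f')) (fun d V hV => ?_) (fun f f' m m' h1 h2 => ?_) hf'
    · refine span_unit_induction (p := fun h =>
        𝒢.act (𝒢.act h (U.indicator fun _ => c)) (V.indicator fun _ => d) = 𝒢.act h (𝒢.conv (U.indicator fun _ => c) (V.indicator fun _ => d))) (fun e W hW hW' => ?_) (fun f f' m m' h1 h2 => ?_) hh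
      · rw [conv_indicator hU, act_indicator hU, act_indicator hV,
          act_indicator (hU.setMul hV), _root_.mul_assoc]
        congr 1
        ext x
        constructor
        · rintro ⟨b, ⟨hb, a, ⟨ha, haW⟩, h⟩, rfl⟩
          refine ⟨_, ⟨⟨a, ha, b, hb, h, rfl⟩, ?_⟩, 𝒢.s_mul a b h⟩
          rw [Set.mem_preimage, 𝒢.r_mul]
          exact haW
        · rintro ⟨_, ⟨⟨a, ha, b, hb, h, rfl⟩, hW⟩, rfl⟩
          rw [Set.mem_preimage, 𝒢.r_mul] at hW
          exact ⟨b, ⟨hb, a, ⟨ha, hW⟩, h⟩, (𝒢.s_mul a b h).symm⟩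
      · rw [act_add_left (indicator_mem hU c), act_add_left (indicator_mem hV d),
          act_add_left (conv_mem (indicator_mem hU c) (indicator_mem hV d)), h1, h2]
    · rw [conv_add_right (indicator_mem hU c), act_add_right m m',
        act_add_right (conv_mem (indicator_mem hU c) m) (conv_mem (indicator_mem hU c) m'), h1, h2]
  · rw [conv_add_left m m', act_add_right m m',
      act_add_right (conv_mem m hf') (conv_mem m' hf'), act_add_left hf', h1, h2]

/-! #### The ring structure, local units and change of rings -/

/-- The groupoid algebra `RG`: the functions in the span of the characteristic functions of compact
open subsets of `G`, with convolution as product. -/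
def ConvAlgebra (_ : AmpleGroupoid X G) (R : Type v) [Ring R] : Type max u v := compactOpenSpan R G

namespace ConvAlgebra

noncomputable instance : AddCommGroup (𝒢.ConvAlgebra R) := inferInstanceAs (AddCommGroup (compactOpenSpan R G))

noncomputable instance : Mul (𝒢.ConvAlgebra R) := ⟨fun f h => ⟨𝒢.conv f.1 h.1, conv_mem f.2 h.2⟩⟩

theorem val_mul (f h : 𝒢.ConvAlgebra R) : (f * h).1 = 𝒢.conv f.1 h.1 := rfl

theorem val_add (f h : 𝒢.ConvAlgebra R) : (f + h).1 = f.1 + h.1 := rfl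

noncomputable instance : NonUnitalRing (𝒢.ConvAlgebra R) where
  left_distrib f h h' := Subtype.ext (conv_add_right f.2 h.1 h'.1)
  right_distrib f f' h := Subtype.ext (conv_add_left f.2 f'.2 h.1)
  zero_mul f := by
    refine Subtype.ext (funext fun g => ?_)
    change ∑ᶠ a : {a : G // 𝒢.r a = 𝒢.r g}, (0 : R) * _ = 0
    simp
  mul_zero f := by
    refine Subtype.ext (funext fun g => ?_)
    change ∑ᶠ a : {a : G // 𝒢.r a = 𝒢.r g}, _ * (0 : R) = 0
    simp
  mul_assoc f g h := Subtype.ext (conv_assoc f.2 g.2 h.2)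

/-- The characteristic function of a compact open set of units. -/
noncomputable def ofUnits {W : Set X} (hW : IsOpen W) (hW' : IsCompact W) : 𝒢.ConvAlgebra R :=
  ⟨(𝒢.unit '' W).indicator fun _ => 1, indicator_mem (isBisection_unit hW hW') 1⟩

theorem exists_ofUnits (f : 𝒢.ConvAlgebra R) : ∃ W : Set X, IsOpen W ∧ IsCompact W ∧
    ∀ (W' : Set X) (h : IsOpen W') (h' : IsCompact W'), W ⊆ W' →
      ofUnits h h' * f = f ∧ f * ofUnits h h' = f := by
  suffices key : ∃ W : Set X, IsOpen W ∧ IsCompact W ∧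
      ∀ (W' : Set X) (_ : IsOpen W') (_ : IsCompact W'), W ⊆ W' →
        𝒢.conv ((𝒢.unit '' W').indicator fun _ => 1) f.1 = f.1 ∧
        𝒢.conv f.1 ((𝒢.unit '' W').indicator fun _ => 1) = f.1 by
    obtain ⟨W, hW, hW', h⟩ := key
    exact ⟨W, hW, hW', fun W' h1 h2 h3 => ⟨Subtype.ext (h W' h1 h2 h3).1,
      Subtype.ext (h W' h1 h2 h3).2⟩⟩
  refine span_induction (𝒢 := 𝒢) (p := fun f => ∃ W : Set X, IsOpen W ∧ IsCompact W ∧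
      ∀ (W' : Set X) (_ : IsOpen W') (_ : IsCompact W'), W ⊆ W' →
        𝒢.conv ((𝒢.unit '' W').indicator fun _ => 1) f = f ∧
        𝒢.conv f ((𝒢.unit '' W').indicator fun _ => 1) = f)
    (fun c U hU => ?_) (fun f f' m m' h1 h2 => ?_) f.2
  · refine ⟨𝒢.r '' U ∪ 𝒢.s '' U, (𝒢.isLocalHomeomorph_r.isOpenMap _ hU.isOpen).union
      (𝒢.isLocalHomeomorph_s.isOpenMap _ hU.isOpen), (hU.isCompact.image 𝒢.continuous_r).union
      (hU.isCompact.image 𝒢.continuous_s), fun W h1 h2 h3 => ?_⟩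
    rw [conv_indicator (isBisection_unit h1 h2), conv_indicator hU, one_mul, mul_one]
    have e : ∀ b b' c (hb : b = b') (h : 𝒢.s b = 𝒢.r c) (h' : 𝒢.s b' = 𝒢.r c),
      𝒢.mul b c h = 𝒢.mul b' c h' := by rintro b _ c rfl _ _; rfl
    have e' : ∀ b c c' (hb : c = c') (h : 𝒢.s b = 𝒢.r c) (h' : 𝒢.s b = 𝒢.r c'),
      𝒢.mul b c h = 𝒢.mul b c' h' := by rintro b c _ rfl _ _; rfl
    constructor
    · congr 1
      ext g
      constructor
      · rintro ⟨_, ⟨x, hx, rfl⟩, b, hb, h, rfl⟩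
        rw [e _ (𝒢.unit (𝒢.r b)) b (by rw [← h, 𝒢.s_unit]) h (𝒢.s_unit _), 𝒢.unit_mul]
        exact hb
      · exact fun hg => ⟨_, ⟨𝒢.r g, h3 (Or.inl ⟨g, hg, rfl⟩), rfl⟩, g, hg, _, (𝒢.unit_mul g).symm⟩
    · congr 1
      ext g
      constructor
      · rintro ⟨b, hb, _, ⟨x, hx, rfl⟩, h, rfl⟩
        rw [e' b _ (𝒢.unit (𝒢.s b)) (by rw [h, 𝒢.r_unit]) h (𝒢.r_unit _).symm, 𝒢.mul_unit]
        exact hb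
      · exact fun hg => ⟨g, hg, _, ⟨𝒢.s g, h3 (Or.inr ⟨g, hg, rfl⟩), rfl⟩, _, (𝒢.mul_unit g).symm⟩
  · obtain ⟨W1, o1, c1, h1⟩ := h1
    obtain ⟨W2, o2, c2, h2⟩ := h2
    refine ⟨W1 ∪ W2, o1.union o2, c1.union c2, fun W o c h => ?_⟩
    obtain ⟨h3, h4⟩ := h1 W o c (Set.subset_union_left.trans h)
    obtain ⟨h5, h6⟩ := h2 W o c (Set.subset_union_right.trans h)
    rw [conv_add_right (indicator_mem (isBisection_unit o c) 1), conv_add_left m m', h3, h4, h5, h6]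
    exact ⟨rfl, rfl⟩

theorem exists_ofUnits_finset (t : Finset (𝒢.ConvAlgebra R)) :
    ∃ (W : Set X) (h : IsOpen W) (h' : IsCompact W),
      ∀ f ∈ t, ofUnits h h' * f = f ∧ f * ofUnits h h' = f := by
  choose W o c h using exists_ofUnits (𝒢 := 𝒢) (R := R)
  refine ⟨⋃ f ∈ t, W f, isOpen_biUnion fun f _ => o f, t.isCompact_biUnion fun f _ => c f,
    fun f hf => h f _ _ _ (Set.subset_biUnion_of_mem (u := W) hf)⟩

theorem ofUnits_mul_self {W : Set X} (h : IsOpen W) (h' : IsCompact W) :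
    (ofUnits h h' * ofUnits h h' : 𝒢.ConvAlgebra R) = ofUnits h h' := by
  refine Subtype.ext ?_
  rw [val_mul, ofUnits, conv_indicator (isBisection_unit h h'), one_mul]
  congr 1
  ext g
  constructor
  · rintro ⟨_, ⟨x, hx, rfl⟩, _, ⟨y, hy, rfl⟩, h, rfl⟩
    rw [𝒢.s_unit, 𝒢.r_unit] at h
    subst h
    have e : ∀ a (ha : a = 𝒢.unit x) h, 𝒢.mul (𝒢.unit x) a h = 𝒢.unit x := by
      intro a ha h
      have h2 : a = 𝒢.unit (𝒢.s (𝒢.unit x)) := by rw [𝒢.s_unit, ha]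
      subst h2
      exact 𝒢.mul_unit _
    exact ⟨x, hx, (e _ rfl _).symm⟩
  · rintro ⟨x, hx, rfl⟩
    refine ⟨_, ⟨x, hx, rfl⟩, 𝒢.unit (𝒢.s (𝒢.unit x)), ⟨_, ?_, rfl⟩, _, (𝒢.mul_unit _).symm⟩
    rwa [𝒢.s_unit]

instance : HasLocalUnits (𝒢.ConvAlgebra R) where
  exists_unit t := by
    obtain ⟨W, h, h', H⟩ := exists_ofUnits_finset t
    exact ⟨ofUnits h h', ofUnits_mul_self h h', H⟩

variable (𝒢) (R)

/-- The canonical ring homomorphism `ℤG → RG`. -/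
noncomputable def ofInt : 𝒢.ConvAlgebra ℤ →ₙ+* 𝒢.ConvAlgebra R where
  toFun f := ⟨fun g => (f.1 g : R), by
    refine span_induction (𝒢 := 𝒢) (p := fun f : G → ℤ =>
      (fun g => (f g : R)) ∈ compactOpenSpan R G) (fun c U hU => ?_) (fun f f' _ _ h h' => ?_) f.2
    · convert indicator_mem hU (c : R) using 1
      ext g
      by_cases hg : g ∈ U <;> simp [hg]
    · convert Submodule.add_mem _ h h' using 1
      ext g
      simp⟩
  map_zero' := Subtype.ext (funext fun _ => Int.cast_zero)
  map_add' f h := Subtype.ext (funext fun _ => Int.cast_add _ _)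
  map_mul' f h := by
    refine Subtype.ext (funext fun g => ?_)
    change ((𝒢.conv f.1 h.1 g : ℤ) : R) = 𝒢.conv (fun g => (f.1 g : R)) (fun g => (h.1 g : R)) g
    refine ((Int.castAddHom R).map_finsum (finite_support_conv f.2 h.1 g)).trans ?_
    exact finsum_congr fun a => Int.cast_mul _ _

@[simp]
theorem ofInt_ofUnits {W : Set X} (h : IsOpen W) (h' : IsCompact W) :
    ofInt 𝒢 R (ofUnits h h') = ofUnits h h' := by
  refine Subtype.ext (funext fun g => ?_)
  change (((𝒢.unit '' W).indicator (fun _ => (1 : ℤ)) g : ℤ) : R) =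
    (𝒢.unit '' W).indicator (fun _ => (1 : R)) g
  by_cases hg : g ∈ 𝒢.unit '' W <;> simp only [hg, Set.indicator_of_mem, Set.indicator_of_notMem,
    not_false_eq_true, Int.cast_one, Int.cast_zero]

end ConvAlgebra

end AmpleGroupoid

/-! ### Homology of ample groupoids -/

namespace AmpleGroupoid

variable {X G : Type u} [TopologicalSpace X] [LocallyCompactSpace X] [T2Space X]
  [TotallyDisconnectedSpace X] [TopologicalSpace G] (𝒢 : AmpleGroupoid X G)

section

variable (R : Type v) [Ring R]

/-- The underlying abelian group of the trivial right `RG`-module `RG⁰`. -/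
def UnitFunctions (_ : AmpleGroupoid X G) (R : Type v) [Ring R] : Type max u v :=
  compactOpenSpan R X

noncomputable instance : AddCommGroup (𝒢.UnitFunctions R) := inferInstanceAs (AddCommGroup (compactOpenSpan R X))

/-- The right action of `RG` on `RG⁰`. -/
noncomputable def actHom : (𝒢.ConvAlgebra R)ᵐᵒᵖ →ₙ+* AddMonoid.End (𝒢.UnitFunctions R) where
  toFun f :=
    { toFun := fun h => ⟨𝒢.act h.1 f.unop.1, act_mem h.2 f.unop.2⟩
      map_zero' := by
        refine Subtype.ext (funext fun x => ?_)
        change ∑ᶠ g : {g : G // 𝒢.s g = x}, (0 : R) * _ = 0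
        simp
      map_add' := fun h h' => Subtype.ext (act_add_left f.unop.2 h.1 h'.1) }
  map_zero' := by
    refine AddMonoidHom.ext fun h => Subtype.ext (funext fun x => ?_)
    change ∑ᶠ g : {g : G // 𝒢.s g = x}, _ * (0 : R) = 0
    simp
  map_add' f f' := AddMonoidHom.ext fun h => Subtype.ext (act_add_right f.unop.2 f'.unop.2 h.1)
  map_mul' f f' := AddMonoidHom.ext fun h =>
    Subtype.ext (act_act h.2 f'.unop.2 f.unop.2).symm

noncomputable instance : Module (AdjoinOne (𝒢.ConvAlgebra R)ᵐᵒᵖ) (𝒢.UnitFunctions R) :=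
  Module.compHom _ (AdjoinOne.lift (𝒢.actHom R))

theorem of_smul_val (f : 𝒢.ConvAlgebra R) (h : 𝒢.UnitFunctions R) :
    (AdjoinOne.of (MulOpposite.op f) • h).1 = 𝒢.act h.1 f.1 := by
  change (AdjoinOne.lift (𝒢.actHom R) (AdjoinOne.of (MulOpposite.op f)) h).1 = _
  rw [AdjoinOne.lift_of]
  rfl

theorem exists_act_ofUnits (h : 𝒢.UnitFunctions R) : ∃ (W : Set X) (o : IsOpen W)
    (c : IsCompact W), 𝒢.act h.1 (ConvAlgebra.ofUnits (𝒢 := 𝒢) o c).1 = h.1 := by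
  obtain ⟨W, o, c, H⟩ : ∃ W : Set X, IsOpen W ∧ IsCompact W ∧ ∀ (W' : Set X), IsOpen W' →
      IsCompact W' → W ⊆ W' → 𝒢.act h.1 ((𝒢.unit '' W').indicator fun _ => 1) = h.1 := by
    refine span_unit_induction (p := fun h => ∃ W : Set X, IsOpen W ∧ IsCompact W ∧
      ∀ (W' : Set X), IsOpen W' → IsCompact W' → W ⊆ W' →
        𝒢.act h ((𝒢.unit '' W').indicator fun _ => 1) = h)
      (fun c W o k => ⟨W, o, k, fun W' o' k' hW => ?_⟩) (fun f f' _ _ h1 h2 => ?_) h.2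
    · rw [act_indicator (isBisection_unit o' k'), mul_one]
      congr 1
      ext x
      constructor
      · rintro ⟨_, ⟨⟨x, -, rfl⟩, hx⟩, rfl⟩
        rw [Set.mem_preimage, 𝒢.r_unit] at hx
        rwa [𝒢.s_unit]
      · exact fun hx => ⟨𝒢.unit x, ⟨⟨x, hW hx, rfl⟩, by rwa [Set.mem_preimage, 𝒢.r_unit]⟩,
          𝒢.s_unit x⟩
    · obtain ⟨W1, o1, c1, h1⟩ := h1
      obtain ⟨W2, o2, c2, h2⟩ := h2
      refine ⟨W1 ∪ W2, o1.union o2, c1.union c2, fun W o c h => ?_⟩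
      rw [act_add_left (indicator_mem (isBisection_unit o c) 1),
        h1 W o c (Set.subset_union_left.trans h), h2 W o c (Set.subset_union_right.trans h)]
  exact ⟨W, o, c, H W o c subset_rfl⟩

end

/-- The trivial right `RG`-module `RG⁰`. -/
noncomputable def trivialModule (R : Type v) [Ring R] :
    UnitaryMod.{max u v} (𝒢.ConvAlgebra R)ᵐᵒᵖ :=
  ⟨ModuleCat.of _ (𝒢.UnitFunctions R), isUnitary.of_exists fun h => by
    obtain ⟨W, o, c, H⟩ := 𝒢.exists_act_ofUnits R h
    exact ⟨MulOpposite.op (ConvAlgebra.ofUnits o c), Subtype.ext ((𝒢.of_smul_val R _ h).trans H)⟩⟩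

/-- A unitary left `RG`-module, regarded as a unitary left `ℤG`-module by restriction of scalars
along `ℤG → RG`. -/
noncomputable def restrictInt {R : Type u} [Ring R] (M : UnitaryMod (𝒢.ConvAlgebra R)) :
    UnitaryMod.{u} (𝒢.ConvAlgebra ℤ) :=
  ⟨(ModuleCat.restrictScalars (AdjoinOne.lift
      (AdjoinOne.of.comp (ConvAlgebra.ofInt 𝒢 R)))).obj M.obj, isUnitary.of_exists fun m => by
    obtain ⟨t, ht⟩ := M.property.exists_finset m
    obtain ⟨W, o, c, H⟩ := ConvAlgebra.exists_ofUnits_finset t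
    refine ⟨ConvAlgebra.ofUnits o c, ?_⟩
    refine (ModuleCat.restrictScalars.smul_def _ _ _).trans ?_
    rw [AdjoinOne.lift_of, NonUnitalRingHom.comp_apply, ConvAlgebra.ofInt_ofUnits]
    exact ht _ H⟩

/-- The homology `H_n(G, M) = Tor_n^{ℤG}(ℤG⁰, M)` of `G` with coefficients in a unitary left
`ℤG`-module `M`. -/
noncomputable def homology (n : ℕ) (M : UnitaryMod.{u} (𝒢.ConvAlgebra ℤ)) : AddCommGrpCat.{u} :=
  unitaryTor n (𝒢.trivialModule ℤ) M

/-- The `R`-homological dimension of `G`: the supremum of all `n` such that `H_n(G, M) ≠ 0` for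
some unitary left `RG`-module `M`. -/
noncomputable def homologicalDimension (R : Type u) [Ring R] : ℕ∞ :=
  sSup {d : ℕ∞ | ∃ n : ℕ, d = n ∧ ∃ M : UnitaryMod (𝒢.ConvAlgebra R),
    Nontrivial (𝒢.homology n (𝒢.restrictInt M))}

end AmpleGroupoid

/-! ### Abelian groups -/

/-! Part 1 is a change of rings along `ℤG → RG`. Take the canonical resolution of `M` by direct sums
of copies of `RG`, with syzygies `L j` and middle terms `Q j`. Dimension shifting should identify
the (n+1)-st Tor group of `N` and `M` with the kernel of `N ⊗ L (n + 1) → N ⊗ Q n`. Over `RG`, with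
`N = RG⁰`, this holds because the `Q j` are flat (`rMap_self_injective`: local units make `N ⊗ A →
N` injective). Over `ℤG`, with `N = ℤG⁰`, the restrictions of the `Q j` need not be flat, but a
weaker acyclicity suffices: tensoring with `Q j` must preserve short exact sequences `0 → K → F → N
→ 0` for all `N` in a class of right modules that contains `ℤG⁰` and the projectives and is closed
under submodules. The torsion-free groups are such a class. Indeed `ℤG ⊗ R ≅ RG`
(`tensorHom_injective`), so `N ⊗_{ℤG} RG` embeds naturally in `N ⊗ R` (`toTensor_injective`), and `-
⊗ R` preserves injectivity of `K → F` when `N` is flat over `ℤ`. This is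
`rMap_kerι_convAlgebra_injective`. The kernels over `ℤG` and over `RG` then agree by the natural
isomorphism `ℤG⁰ ⊗_{ℤG} L ≅ RG⁰ ⊗_{RG} L` (`intTensorEquiv`), which also settles degree zero. It
holds because both sides are the coinvariants of `L`: the class of `1_U m` depends only on `1_{s(U)}
m`. The injectivity of `ℤG ⊗ R → RG` is the delicate point, since `G` need not be Hausdorff and
compact bisections cannot be refined to disjoint ones. It is proved locally over the unit space:
near a source `x`, bisections through the same arrow over `x` coincide and those without an arrow
over `x` disappear, so the coefficients add up to values of the function. Compactness then
globalises. Parts 2 and 3 are the standard fact, transferred to rings with local units, that `N` has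
a flat resolution of length `n` if and only if the functor `Tor_{n+1}` of `N` vanishes
(`hasFlatResolution_iff_subsingleton_unitaryTor`), combined with part 1. -/

theorem AddMonoidHom.nonempty_addEquiv_of_ker_eq {D B C : Type*} [AddCommGroup D] [AddCommGroup B]
    [AddCommGroup C] {p : D →+ B} {q : D →+ C} (hp : Function.Surjective p)
    (hq : Function.Surjective q) (h : ∀ x, p x = 0 ↔ q x = 0) : Nonempty (B ≃+ C) := by
  have hk : p.ker = q.ker := AddSubgroup.ext h
  exact ⟨(QuotientAddGroup.quotientKerEquivOfSurjective p hp).symm.trans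
    ((QuotientAddGroup.quotientAddEquivOfEq hk).trans
      (QuotientAddGroup.quotientKerEquivOfSurjective q hq))⟩

/-- In a commutative diagram with rows `A₁ → A₂ → A₃ → 0`, `0 → B₁ → B₂ → B₃`, `C₁ → C₂` and columns
`A₁ → B₁ → C₁ → 0`, `A₂ → B₂ → C₂`, `A₃ → B₃`, all exact except for the last row and the last
column, the kernels of `A₃ → B₃` and `C₁ → C₂` agree if `A₂ → B₂` is injective. -/
theorem AddMonoidHom.nonempty_ker_addEquiv_ker {A₁ A₂ A₃ B₁ B₂ B₃ C₁ C₂ : Type*}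
    [AddCommGroup A₁] [AddCommGroup A₂] [AddCommGroup A₃] [AddCommGroup B₁] [AddCommGroup B₂]
    [AddCommGroup B₃] [AddCommGroup C₁] [AddCommGroup C₂]
    {a : A₁ →+ A₂} {a' : A₂ →+ A₃} {b : B₁ →+ B₂} {b' : B₂ →+ B₃} {c : C₁ →+ C₂}
    {f₁ : A₁ →+ B₁} {f₂ : A₂ →+ B₂} {f₃ : A₃ →+ B₃} {g₁ : B₁ →+ C₁} {g₂ : B₂ →+ C₂}
    (ha : Function.Exact a a') (ha' : Function.Surjective a') (hb : Function.Injective b)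
    (hb' : Function.Exact b b') (hf₁ : Function.Exact f₁ g₁) (hg₁ : Function.Surjective g₁)
    (hf₂ : Function.Injective f₂) (hg₂ : Function.Exact f₂ g₂)
    (h₁ : ∀ x, f₂ (a x) = b (f₁ x)) (h₂ : ∀ x, f₃ (a' x) = b' (f₂ x))
    (h₃ : ∀ x, g₂ (b x) = c (g₁ x)) : Nonempty (f₃.ker ≃+ c.ker) := by
  -- The fibre product of `A₂` and `B₁` over `B₂`. It maps onto both kernels, so only the kernels of
  -- the two projections have to be compared.
  let D : AddSubgroup (A₂ × B₁) :=
    (f₂.comp (AddMonoidHom.fst A₂ B₁) - b.comp (AddMonoidHom.snd A₂ B₁)).ker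
  have hD (z : D) : f₂ z.1.1 = b z.1.2 := sub_eq_zero.1 z.2
  let p : D →+ f₃.ker := ((a'.comp (AddMonoidHom.fst A₂ B₁)).comp D.subtype).codRestrict _
    fun z => by
      change f₃ (a' z.1.1) = 0
      rw [h₂, hD]
      exact (hb' _).2 ⟨_, rfl⟩
  let q : D →+ c.ker := ((g₁.comp (AddMonoidHom.snd A₂ B₁)).comp D.subtype).codRestrict _
    fun z => by
      change c (g₁ z.1.2) = 0
      rw [← h₃, ← hD]
      exact (hg₂ _).2 ⟨_, rfl⟩
  refine AddMonoidHom.nonempty_addEquiv_of_ker_eq (p := p) (q := q) ?_ ?_ ?_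
  · rintro ⟨x, hx⟩
    obtain ⟨x, rfl⟩ := ha' x
    have hx' : f₃ (a' x) = 0 := hx
    rw [h₂] at hx'
    obtain ⟨y, hy⟩ := (hb' _).1 hx'
    exact ⟨⟨(x, y), sub_eq_zero.2 hy.symm⟩, rfl⟩
  · rintro ⟨x, hx⟩
    obtain ⟨y, rfl⟩ := hg₁ x
    have hx' : c (g₁ y) = 0 := hx
    rw [← h₃] at hx'
    obtain ⟨x, hx⟩ := (hg₂ _).1 hx'
    exact ⟨⟨(x, y), sub_eq_zero.2 hx⟩, rfl⟩
  -- Either condition says that `z` is the pair `(a w, f₁ w)` for some `w` in `A₁`.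
  · intro z
    have e := hD z
    rw [Subtype.ext_iff, Subtype.ext_iff]
    change a' z.1.1 = 0 ↔ g₁ z.1.2 = 0
    rw [ha, hf₁]
    constructor
    · rintro ⟨w, hw⟩
      exact ⟨w, hb (by rw [← h₁, hw, e])⟩
    · rintro ⟨w, hw⟩
      exact ⟨w, hf₂ (by rw [h₁, hw, e])⟩

/-! ### Tensor products over rings without identity -/

namespace BalTensor

variable {A : Type u} [NonUnitalRing A]

section

variable {N M : Type u} [AddCommGroup N] [Module (AdjoinOne Aᵐᵒᵖ) N] [AddCommGroup M]
  [Module (AdjoinOne A) M]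

theorem tmul_add_right (n : N) (m m' : M) : tmul A n (m + m') = tmul A n m + tmul A n m' :=
  congrArg QuotientAddGroup.mk (TensorProduct.tmul_add n m m')

theorem zero_tmul (m : M) : tmul A (0 : N) m = 0 :=
  congrArg QuotientAddGroup.mk (TensorProduct.zero_tmul N m)

theorem tmul_zero (n : N) : tmul A n (0 : M) = 0 :=
  congrArg QuotientAddGroup.mk (TensorProduct.tmul_zero M n)

theorem smul_tmul (n : N) (a : A) (m : M) :
    tmul A (AdjoinOne.of (MulOpposite.op a) • n) m = tmul A n (AdjoinOne.of a • m) :=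
  (QuotientAddGroup.eq_iff_sub_mem).2 (AddSubgroup.subset_closure ⟨n, a, m, rfl⟩)

/-- Zero needs no separate case, being `0 ⊗ 0`, and negatives are absorbed in the first factor. -/
theorem induction {p : BalTensor A N M → Prop} (tmul : ∀ n m, p (tmul A n m))
    (add : ∀ x y, p x → p y → p (x + y)) (z : BalTensor A N M) : p z := by
  obtain ⟨z, rfl⟩ := QuotientAddGroup.mk_surjective z
  induction z with
  | zero =>
    have := tmul 0 0
    rwa [zero_tmul] at this
  | tmul n m => exact tmul n m
  | add x y hx hy => exact add _ _ hx hy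

/-- The homomorphism on `N ⊗_A M` induced by a balanced biadditive map. -/
noncomputable def lift {B : Type*} [AddCommGroup B] (β : N →+ M →+ B)
    (h : ∀ (n : N) (a : A) (m : M),
      β (AdjoinOne.of (MulOpposite.op a) • n) m = β n (AdjoinOne.of a • m)) :
    BalTensor A N M →+ B :=
  QuotientAddGroup.lift _ (TensorProduct.liftAddHom β fun r n m => by
    rw [map_zsmul, map_zsmul]; rfl) (by
    rw [AddSubgroup.closure_le]
    rintro _ ⟨n, a, m, rfl⟩
    refine AddMonoidHom.mem_ker.2 ?_
    rw [map_sub, TensorProduct.liftAddHom_tmul, TensorProduct.liftAddHom_tmul, h, sub_self])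

end

variable {N N' N'' M M' M'' : Type u} [AddCommGroup N] [Module (AdjoinOne Aᵐᵒᵖ) N]
  [AddCommGroup N'] [Module (AdjoinOne Aᵐᵒᵖ) N'] [AddCommGroup N''] [Module (AdjoinOne Aᵐᵒᵖ) N'']
  [AddCommGroup M] [Module (AdjoinOne A) M] [AddCommGroup M'] [Module (AdjoinOne A) M']
  [AddCommGroup M''] [Module (AdjoinOne A) M'']

/-- The homomorphism `g ⊗ M`. -/
noncomputable abbrev rMap (M : Type u) [AddCommGroup M] [Module (AdjoinOne A) M]
    (g : N →ₗ[AdjoinOne Aᵐᵒᵖ] N') : BalTensor A N M →+ BalTensor A N' M :=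
  map g LinearMap.id

/-- The homomorphism `N ⊗ f`. -/
noncomputable abbrev lMap (N : Type u) [AddCommGroup N] [Module (AdjoinOne Aᵐᵒᵖ) N]
    (f : M →ₗ[AdjoinOne A] M') : BalTensor A N M →+ BalTensor A N M' :=
  map LinearMap.id f

theorem rMap_lMap (g : N →ₗ[AdjoinOne Aᵐᵒᵖ] N') (f : M →ₗ[AdjoinOne A] M')
    (z : BalTensor A N M) : rMap M' g (lMap N f z) = lMap N' f (rMap M g z) := by
  induction z using induction with
  | tmul n m => rfl
  | add x y hx hy => simp only [map_add, hx, hy]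

theorem rMap_rMap (g : N →ₗ[AdjoinOne Aᵐᵒᵖ] N') (g' : N' →ₗ[AdjoinOne Aᵐᵒᵖ] N'')
    (z : BalTensor A N M) : rMap M g' (rMap M g z) = rMap M (g' ∘ₗ g) z := by
  induction z using induction with
  | tmul n m => rfl
  | add x y hx hy => simp only [map_add, hx, hy]

theorem lMap_lMap (f : M →ₗ[AdjoinOne A] M') (f' : M' →ₗ[AdjoinOne A] M'')
    (z : BalTensor A N M) : lMap N f' (lMap N f z) = lMap N (f' ∘ₗ f) z := by
  induction z using induction with
  | tmul n m => rfl
  | add x y hx hy => simp only [map_add, hx, hy]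

theorem rMap_id (z : BalTensor A N M) : rMap M (LinearMap.id : N →ₗ[AdjoinOne Aᵐᵒᵖ] N) z = z := by
  induction z using induction with
  | tmul n m => rfl
  | add x y hx hy => simp only [map_add, hx, hy]

theorem rMap_surjective {g : N →ₗ[AdjoinOne Aᵐᵒᵖ] N'} (hg : Function.Surjective g) :
    Function.Surjective (rMap M g) := fun z => by
  induction z using induction with
  | tmul n m =>
    obtain ⟨n, rfl⟩ := hg n
    exact ⟨tmul A n m, rfl⟩
  | add x y hx hy =>
    obtain ⟨x, rfl⟩ := hx
    obtain ⟨y, rfl⟩ := hy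
    exact ⟨x + y, map_add _ _ _⟩

theorem lMap_surjective {f : M →ₗ[AdjoinOne A] M'} (hf : Function.Surjective f) :
    Function.Surjective (lMap N f) := fun z => by
  induction z using induction with
  | tmul n m =>
    obtain ⟨m, rfl⟩ := hf m
    exact ⟨tmul A n m, rfl⟩
  | add x y hx hy =>
    obtain ⟨x, rfl⟩ := hx
    obtain ⟨y, rfl⟩ := hy
    exact ⟨x + y, map_add _ _ _⟩

/-- Right exactness over `ℤ` descends to the balanced tensor product because every balancing
relation in `N'' ⊗ M` lifts to one in `N' ⊗ M` along the surjection `g'`. A representative of an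
element of the kernel can thus be corrected by relations until it dies in `N'' ⊗_ℤ M`. -/
theorem rMap_exact {g : N →ₗ[AdjoinOne Aᵐᵒᵖ] N'} {g' : N' →ₗ[AdjoinOne Aᵐᵒᵖ] N''}
    (h : Function.Exact g g') (hg' : Function.Surjective g') :
    Function.Exact (rMap M g) (rMap M g') := by
  intro z
  constructor
  · intro hz
    obtain ⟨z, rfl⟩ := QuotientAddGroup.mk_surjective z
    let G := TensorProduct.map g.toAddMonoidHom.toIntLinearMap (LinearMap.id : M →ₗ[ℤ] M)
    let G' := TensorProduct.map g'.toAddMonoidHom.toIntLinearMap (LinearMap.id : M →ₗ[ℤ] M)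
    have hz' := (QuotientAddGroup.eq_zero_iff (G' z)).1 hz
    have key : ∃ c ∈ AddSubgroup.closure {z : N' ⊗[ℤ] M | ∃ (n : N') (a : A) (m : M),
        z = (AdjoinOne.of (MulOpposite.op a) • n) ⊗ₜ[ℤ] m - n ⊗ₜ[ℤ] (AdjoinOne.of a • m)},
        G' c = G' z := by
      refine AddSubgroup.mem_map.1 ((AddSubgroup.closure_le
        (AddSubgroup.map G'.toAddMonoidHom _)).2 ?_ hz')
      rintro _ ⟨n, a, m, rfl⟩
      obtain ⟨n, rfl⟩ := hg' n
      refine ⟨_, AddSubgroup.subset_closure ⟨n, a, m, rfl⟩, ?_⟩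
      simp [G']
    obtain ⟨c, hc, hcz⟩ := key
    have hex : Function.Exact G G' := rTensor_exact M
      (f := g.toAddMonoidHom.toIntLinearMap) (g := g'.toAddMonoidHom.toIntLinearMap) h hg'
    obtain ⟨w, hw⟩ := (hex (z - c)).1 (by rw [map_sub, hcz, sub_self])
    refine ⟨QuotientAddGroup.mk w, ?_⟩
    change QuotientAddGroup.mk (G w) = _
    rw [hw]
    refine (QuotientAddGroup.eq_iff_sub_mem).2 ?_
    rw [sub_sub_cancel_left]
    exact neg_mem hc
  · rintro ⟨w, rfl⟩
    rw [rMap_rMap]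
    induction w using induction with
    | tmul n m =>
      rw [map_tmul, LinearMap.comp_apply, (h _).2 ⟨n, rfl⟩, zero_tmul]
    | add x y hx hy => rw [map_add, hx, hy, add_zero]

theorem lMap_exact {f : M →ₗ[AdjoinOne A] M'} {f' : M' →ₗ[AdjoinOne A] M''}
    (h : Function.Exact f f') (hf' : Function.Surjective f') :
    Function.Exact (lMap N f) (lMap N f') := by
  intro z
  constructor
  · intro hz
    obtain ⟨z, rfl⟩ := QuotientAddGroup.mk_surjective z
    let G := TensorProduct.map (LinearMap.id : N →ₗ[ℤ] N) f.toAddMonoidHom.toIntLinearMap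
    let G' := TensorProduct.map (LinearMap.id : N →ₗ[ℤ] N) f'.toAddMonoidHom.toIntLinearMap
    have hz' := (QuotientAddGroup.eq_zero_iff (G' z)).1 hz
    have key : ∃ c ∈ AddSubgroup.closure {z : N ⊗[ℤ] M' | ∃ (n : N) (a : A) (m : M'),
        z = (AdjoinOne.of (MulOpposite.op a) • n) ⊗ₜ[ℤ] m - n ⊗ₜ[ℤ] (AdjoinOne.of a • m)},
        G' c = G' z := by
      refine AddSubgroup.mem_map.1 ((AddSubgroup.closure_le
        (AddSubgroup.map G'.toAddMonoidHom _)).2 ?_ hz')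
      rintro _ ⟨n, a, m, rfl⟩
      obtain ⟨m, rfl⟩ := hf' m
      refine ⟨_, AddSubgroup.subset_closure ⟨n, a, m, rfl⟩, ?_⟩
      simp [G']
    obtain ⟨c, hc, hcz⟩ := key
    have hex : Function.Exact G G' := lTensor_exact N
      (f := f.toAddMonoidHom.toIntLinearMap) (g := f'.toAddMonoidHom.toIntLinearMap) h hf'
    obtain ⟨w, hw⟩ := (hex (z - c)).1 (by rw [map_sub, hcz, sub_self])
    refine ⟨QuotientAddGroup.mk w, ?_⟩
    change QuotientAddGroup.mk (G w) = _
    rw [hw]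
    refine (QuotientAddGroup.eq_iff_sub_mem).2 ?_
    rw [sub_sub_cancel_left]
    exact neg_mem hc
  · rintro ⟨w, rfl⟩
    rw [lMap_lMap]
    induction w using induction with
    | tmul n m =>
      rw [map_tmul, LinearMap.comp_apply, (h _).2 ⟨m, rfl⟩, tmul_zero]
    | add x y hx hy => rw [map_add, hx, hy, add_zero]

/-- Dimension shifting: for short exact sequences `0 → K → F → N → 0` of right modules and
`0 → L → Q → M → 0` of left modules such that `L → Q` remains injective after tensoring with `F` and
`K → F` remains injective after tensoring with `Q`, the kernels of `K ⊗ M → F ⊗ M` and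
`N ⊗ L → N ⊗ Q` agree. -/
theorem nonempty_ker_rMap_addEquiv_ker_lMap {K F L Q : Type u}
    [AddCommGroup K] [Module (AdjoinOne Aᵐᵒᵖ) K] [AddCommGroup F] [Module (AdjoinOne Aᵐᵒᵖ) F]
    [AddCommGroup L] [Module (AdjoinOne A) L] [AddCommGroup Q] [Module (AdjoinOne A) Q]
    {k : K →ₗ[AdjoinOne Aᵐᵒᵖ] F} {p : F →ₗ[AdjoinOne Aᵐᵒᵖ] N}
    {l : L →ₗ[AdjoinOne A] Q} {q : Q →ₗ[AdjoinOne A] M}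
    (hkp : Function.Exact k p) (hp : Function.Surjective p) (hlq : Function.Exact l q)
    (hq : Function.Surjective q) (hF : Function.Injective (lMap F l))
    (hQ : Function.Injective (rMap Q k)) :
    Nonempty ((rMap M k).ker ≃+ (lMap N l).ker) :=
  -- The rows of the diagram are the tensor products of `K`, `F` and `N` with `L → Q → M`. Both
  -- kernels play the role of `Tor₁` of `N` and `M`.
  AddMonoidHom.nonempty_ker_addEquiv_ker (lMap_exact hlq hq) (lMap_surjective hq) hF
    (lMap_exact hlq hq) (rMap_exact hkp hp) (rMap_surjective hp) hQ (rMap_exact hkp hp)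
    (rMap_lMap k l) (rMap_lMap k q) (rMap_lMap p l)

/-- For a short exact sequence `0 → K → F → N → 0` of right modules and a short exact sequence
`0 → L → Q → M → 0` of left modules, `N ⊗ L → N ⊗ Q` is injective if `F ⊗ L → F ⊗ Q` and
`K ⊗ M → F ⊗ M` are injective. -/
theorem lMap_injective_of_rMap_injective {K F L Q : Type u}
    [AddCommGroup K] [Module (AdjoinOne Aᵐᵒᵖ) K] [AddCommGroup F] [Module (AdjoinOne Aᵐᵒᵖ) F]
    [AddCommGroup L] [Module (AdjoinOne A) L] [AddCommGroup Q] [Module (AdjoinOne A) Q]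
    {k : K →ₗ[AdjoinOne Aᵐᵒᵖ] F} {p : F →ₗ[AdjoinOne Aᵐᵒᵖ] N}
    {l : L →ₗ[AdjoinOne A] Q} {q : Q →ₗ[AdjoinOne A] M}
    (hkp : Function.Exact k p) (hp : Function.Surjective p) (hlq : Function.Exact l q)
    (hq : Function.Surjective q) (hF : Function.Injective (lMap F l))
    (hM : Function.Injective (rMap M k)) : Function.Injective (lMap N l) := by
  refine (injective_iff_map_eq_zero _).2 fun x hx => ?_
  obtain ⟨y, rfl⟩ := rMap_surjective hp x
  rw [← rMap_lMap] at hx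
  obtain ⟨z, hz⟩ := (rMap_exact hkp hp _).1 hx
  -- The element `z` comes from `K ⊗ L`: its image in `K ⊗ M` maps in `F ⊗ M` to the image of `y`
  -- under `F ⊗ L → F ⊗ Q → F ⊗ M`, which vanishes.
  have hz' : rMap M k (lMap K q z) = 0 := by
    rw [rMap_lMap, hz]
    exact (lMap_exact hlq hq _).2 ⟨y, rfl⟩
  obtain ⟨w, rfl⟩ := (lMap_exact hlq hq _).1 (hM (hz'.trans (map_zero _).symm))
  rw [rMap_lMap] at hz
  exact (rMap_exact hkp hp _).2 ⟨w, hF hz⟩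

end BalTensor

/-! ### Free modules over rings with local units -/

namespace AdjoinOne

variable {A : Type u} [NonUnitalRing A]

theorem exists_eq_intCast_add_of (x : AdjoinOne A) : ∃ (n : ℤ) (a : A), x = n + of a := by
  refine ⟨(show Unitization ℤ A from x).fst, (show Unitization ℤ A from x).snd, ?_⟩
  have h : (((show Unitization ℤ A from x).fst : ℤ) : AdjoinOne A) =
      (Unitization.inl (show Unitization ℤ A from x).fst : Unitization ℤ A) :=
    (map_intCast (Unitization.inlRingHom ℤ A) _).symm
  rw [h]
  exact (Unitization.inl_fst_add_inr_snd_eq (show Unitization ℤ A from x)).symm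

/-- An additive map that commutes with the action of `A` is linear over `ℤ ⊕ A`. -/
noncomputable def linearMapOfMapSMul {M M' : Type*} [AddCommGroup M] [Module (AdjoinOne A) M]
    [AddCommGroup M'] [Module (AdjoinOne A) M'] (f : M →+ M')
    (h : ∀ (a : A) (m : M), f (of a • m) = of a • f m) : M →ₗ[AdjoinOne A] M' where
  toFun := f
  map_add' := map_add f
  map_smul' x m := by
    obtain ⟨n, a, rfl⟩ := exists_eq_intCast_add_of x
    rw [RingHom.id_apply, add_smul, add_smul, map_add, h, Int.cast_smul_eq_zsmul,
      Int.cast_smul_eq_zsmul, map_zsmul]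

variable (A) in
/-- The ring `A` as a left module over itself. -/
noncomputable instance : Module (AdjoinOne A) A :=
  Module.compHom A (AdjoinOne.lift (C := AddMonoid.End A)
    { toFun := AddMonoidHom.mulLeft
      map_zero' := AddMonoidHom.ext zero_mul
      map_add' := fun a b => AddMonoidHom.ext (add_mul a b)
      map_mul' := fun a b => AddMonoidHom.ext (mul_assoc a b) })

@[simp]
theorem of_smul (a b : A) : of a • b = a * b := by
  change AdjoinOne.lift (C := AddMonoid.End A) _ (of a) b = _
  rw [lift_of]
  rfl

/-- The homomorphism `A → M` given by an element of `M`. -/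
noncomputable def toModule {M : Type*} [AddCommGroup M] [Module (AdjoinOne A) M] (m : M) :
    A →ₗ[AdjoinOne A] M :=
  linearMapOfMapSMul (((AddMonoidHom.flip (smulAddHom (AdjoinOne A) M)) m).comp
    (of : A →ₙ+* AdjoinOne A).toAddMonoidHom) fun a b => by
      change of (of a • b) • m = of a • of b • m
      rw [of_smul, map_mul, mul_smul]

@[simp]
theorem toModule_apply {M : Type*} [AddCommGroup M] [Module (AdjoinOne A) M] (m : M) (a : A) :
    toModule m a = of a • m := rfl

end AdjoinOne

namespace UnitaryMod

variable {A : Type u} [NonUnitalRing A] [HasLocalUnits A]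

/-- The finitely supported families of elements of `A`, as a left `A`-module. -/
noncomputable def freeModule (A : Type u) [NonUnitalRing A] [HasLocalUnits A] (I : Type u) :
    UnitaryMod A :=
  ⟨ModuleCat.of _ (I →₀ A), isUnitary.of_exists fun (x : I →₀ A) => by
    classical
    obtain ⟨e, -, he⟩ := HasLocalUnits.exists_unit (x.support.image x)
    refine ⟨e, Finsupp.ext fun i => ?_⟩
    rw [Finsupp.smul_apply, AdjoinOne.of_smul]
    by_cases hi : x i = 0
    · rw [hi, mul_zero]
    · exact (he _ (Finset.mem_image_of_mem x (Finsupp.mem_support_iff.2 hi))).1⟩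

/-- The canonical homomorphism from the `M`-indexed families of elements of `A` onto `M`. -/
noncomputable def freeCover (M : UnitaryMod A) : freeModule A M.obj ⟶ M :=
  ObjectProperty.homMk (ModuleCat.ofHom (Finsupp.lsum ℕ fun m : M.obj => AdjoinOne.toModule m))

theorem freeCover_surjective (M : UnitaryMod A) : Function.Surjective (freeCover M).hom := by
  intro m
  obtain ⟨e, -, he⟩ := M.property.exists_unit m
  refine ⟨Finsupp.single m e, ?_⟩
  change Finsupp.lsum ℕ (fun m : M.obj => AdjoinOne.toModule (A := A) m) (Finsupp.single m e) = m
  rw [Finsupp.lsum_single, AdjoinOne.toModule_apply, he]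

/-- The kernel of a homomorphism of unitary modules. -/
noncomputable def ker {M N : UnitaryMod A} (f : M ⟶ N) : UnitaryMod A :=
  ⟨ModuleCat.of _ (LinearMap.ker f.hom.hom), isUnitary.of_exists fun m => by
    obtain ⟨e, -, he⟩ := M.property.exists_unit m.1
    exact ⟨e, Subtype.ext he⟩⟩

/-- The inclusion of the kernel of a homomorphism of unitary modules. -/
noncomputable def kerι {M N : UnitaryMod A} (f : M ⟶ N) : ker f ⟶ M :=
  ObjectProperty.homMk (ModuleCat.ofHom (LinearMap.ker f.hom.hom).subtype)

theorem kerι_injective {M N : UnitaryMod A} (f : M ⟶ N) : Function.Injective (kerι f).hom :=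
  Subtype.val_injective

theorem kerι_exact {M N : UnitaryMod A} (f : M ⟶ N) : Function.Exact (kerι f).hom f.hom :=
  fun m => ⟨fun h => ⟨⟨m, h⟩, rfl⟩, by rintro ⟨m, rfl⟩; exact m.2⟩

/-- The homomorphism to the kernel of `g` given by a homomorphism `f` with `g f = 0`. -/
noncomputable def kerLift {L M N : UnitaryMod A} (f : L ⟶ M) (g : M ⟶ N)
    (h : ∀ x, g.hom (f.hom x) = 0) : L ⟶ ker g :=
  ObjectProperty.homMk (ModuleCat.ofHom (LinearMap.codRestrict _ f.hom.hom h))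

theorem kerLift_surjective {L M N : UnitaryMod A} {f : L ⟶ M} {g : M ⟶ N}
    (h : Function.Exact f.hom g.hom) :
    Function.Surjective (kerLift f g fun x => (h _).2 ⟨x, rfl⟩).hom := by
  rintro ⟨m, hm⟩
  obtain ⟨x, rfl⟩ := (h m).1 hm
  exact ⟨x, rfl⟩

/-- Quotients of unitary modules are unitary, so a categorical epimorphism has zero cokernel as a
homomorphism of modules. -/
theorem surjective_of_epi {M N : UnitaryMod A} (f : M ⟶ N) [Epi f] :
    Function.Surjective f.hom := by
  have := ObjectProperty.preservesEpimorphisms_ι_of_isNormalMonoCategory (isUnitary A)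
  have hf : Epi f.hom := (isUnitary A).ι.map_epi f
  exact (ModuleCat.epi_iff_surjective f.hom).1 hf

theorem epi_of_surjective {M N : UnitaryMod A} {f : M ⟶ N} (hf : Function.Surjective f.hom) :
    Epi f :=
  (isUnitary A).ι.epi_of_epi_map ((ModuleCat.epi_iff_surjective f.hom).2 hf)

/-- A projective unitary module is a direct summand of a free module. -/
theorem exists_section_freeCover (P : UnitaryMod A) [Projective P] :
    ∃ s : P ⟶ freeModule A P.obj, s ≫ freeCover P = 𝟙 P := by
  have := epi_of_surjective (freeCover_surjective P)
  exact ⟨Projective.factorThru (𝟙 P) (freeCover P), Projective.factorThru_comp _ _⟩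

theorem exact_of_shortComplex_exact {S : ShortComplex (UnitaryMod A)} (hS : S.Exact) :
    Function.Exact S.f.hom S.g.hom := by
  intro y
  constructor
  · intro hy
    -- The whole kernel of `S.g` serves as a generalised element. It lifts along `S.f` after an
    -- epimorphism, and epimorphisms are surjective on elements.
    obtain ⟨Z, π, hπ, x, hx⟩ := hS.exact_up_to_refinements (kerι S.g)
      (ObjectProperty.hom_ext _ (ModuleCat.hom_ext (LinearMap.ext fun z => z.2)))
    obtain ⟨z, hz⟩ := surjective_of_epi π ⟨y, hy⟩
    refine ⟨x.hom z, ?_⟩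
    have := congrArg (fun f => f.hom z) hx
    change (kerι S.g).hom (π.hom z) = S.f.hom (x.hom z) at this
    rw [← this, hz]
    rfl
  · rintro ⟨x, rfl⟩
    exact congrArg (fun f => f.hom x) S.zero

end UnitaryMod

/-! ### Flatness of free modules -/

namespace BalTensor

variable {A : Type u} [NonUnitalRing A]
  {N N' M M' : Type u} [AddCommGroup N] [Module (AdjoinOne Aᵐᵒᵖ) N]
  [AddCommGroup N'] [Module (AdjoinOne Aᵐᵒᵖ) N'] [AddCommGroup M] [Module (AdjoinOne A) M]
  [AddCommGroup M'] [Module (AdjoinOne A) M']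

/-- An element of the tensor product with a direct sum is the finite sum of its components. -/
theorem eq_zero_of_lMap_lapply {I : Type u} {z : BalTensor A N (I →₀ M)}
    (h : ∀ i, lMap N (Finsupp.lapply i) z = 0) : z = 0 := by
  classical
  suffices key : ∃ t : Finset I, z = ∑ i ∈ t, lMap N (Finsupp.lsingle i)
      (lMap N (Finsupp.lapply i) z) by
    obtain ⟨t, ht⟩ := key
    rw [ht]
    exact Finset.sum_eq_zero fun i _ => by rw [h, map_zero]
  -- Allowing every larger finite set lets the sets of two summands be merged by a union.
  suffices key : ∃ t : Finset I, ∀ t', t ⊆ t' → z = ∑ i ∈ t', lMap N (Finsupp.lsingle i)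
      (lMap N (Finsupp.lapply i) z) from key.imp fun t ht => ht t subset_rfl
  clear h
  induction z using induction with
  | tmul n m =>
    refine ⟨m.support, fun t' h => ?_⟩
    have hm : m = ∑ i ∈ t', Finsupp.single i (m i) := by
      conv_lhs => rw [← Finsupp.sum_single m]
      exact Finsupp.sum_of_support_subset m h _ fun i _ => Finsupp.single_zero i
    let T : (I →₀ M) →+ BalTensor A N (I →₀ M) :=
      { toFun := tmul A n, map_zero' := tmul_zero n, map_add' := tmul_add_right n }
    exact (congrArg T hm).trans (map_sum T _ _)
  | add x y hx hy =>
    obtain ⟨t, ht⟩ := hx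
    obtain ⟨t', ht'⟩ := hy
    refine ⟨t ∪ t', fun s hs => ?_⟩
    simp only [map_add, Finset.sum_add_distrib]
    rw [← ht s (Finset.union_subset_left hs), ← ht' s (Finset.union_subset_right hs)]

theorem eq_zero_of_rMap_lapply {I : Type u} {z : BalTensor A (I →₀ N) M}
    (h : ∀ i, rMap M (Finsupp.lapply i) z = 0) : z = 0 := by
  classical
  suffices key : ∃ t : Finset I, z = ∑ i ∈ t, rMap M (Finsupp.lsingle i)
      (rMap M (Finsupp.lapply i) z) by
    obtain ⟨t, ht⟩ := key
    rw [ht]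
    exact Finset.sum_eq_zero fun i _ => by rw [h, map_zero]
  suffices key : ∃ t : Finset I, ∀ t', t ⊆ t' → z = ∑ i ∈ t', rMap M (Finsupp.lsingle i)
      (rMap M (Finsupp.lapply i) z) from key.imp fun t ht => ht t subset_rfl
  clear h
  induction z using induction with
  | tmul n m =>
    refine ⟨n.support, fun t' h => ?_⟩
    have hn : n = ∑ i ∈ t', Finsupp.single i (n i) := by
      conv_lhs => rw [← Finsupp.sum_single n]
      exact Finsupp.sum_of_support_subset n h _ fun i _ => Finsupp.single_zero i
    let T : (I →₀ N) →+ BalTensor A (I →₀ N) M :=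
      { toFun := fun n => tmul A n m, map_zero' := zero_tmul m,
        map_add' := fun n n' => tmul_add_left n n' m }
    exact (congrArg T hn).trans (map_sum T _ _)
  | add x y hx hy =>
    obtain ⟨t, ht⟩ := hx
    obtain ⟨t', ht'⟩ := hy
    refine ⟨t ∪ t', fun s hs => ?_⟩
    simp only [map_add, Finset.sum_add_distrib]
    rw [← ht s (Finset.union_subset_left hs), ← ht' s (Finset.union_subset_right hs)]

theorem rMap_finsupp_injective {g : N →ₗ[AdjoinOne Aᵐᵒᵖ] N'} (h : Function.Injective (rMap M g))
    (I : Type u) : Function.Injective (rMap (I →₀ M) g) := by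
  refine (injective_iff_map_eq_zero _).2 fun z hz => eq_zero_of_lMap_lapply fun i => h ?_
  rw [rMap_lMap, hz, map_zero, map_zero]

theorem lMap_finsupp_injective {f : M →ₗ[AdjoinOne A] M'} (h : Function.Injective (lMap N f))
    (I : Type u) : Function.Injective (lMap (I →₀ N) f) := by
  refine (injective_iff_map_eq_zero _).2 fun z hz => eq_zero_of_rMap_lapply fun i => h ?_
  rw [← rMap_lMap, hz, map_zero, map_zero]

variable [HasLocalUnits A]

/-- The natural map `φ : N ⊗ A → N`, `n ⊗ a ↦ na`, is injective: if `e` is a local unit for the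
elements of `A` occurring in `z`, then `z = φ z ⊗ e`. So injectivity of `g` passes to `g ⊗ A`. The
modules `N` and `N'` need not be unitary. -/
theorem rMap_self_injective {g : N →ₗ[AdjoinOne Aᵐᵒᵖ] N'} (hg : Function.Injective g) :
    Function.Injective (rMap A g) := by
  classical
  let φ {N : Type u} [AddCommGroup N] [Module (AdjoinOne Aᵐᵒᵖ) N] : BalTensor A N A →+ N :=
    lift (AddMonoidHom.mk' (fun n => (AdjoinOne.toModule n).toAddMonoidHom.comp
        (MulOpposite.opAddEquiv : A ≃+ Aᵐᵒᵖ).toAddMonoidHom) fun n n' =>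
      AddMonoidHom.ext fun a => smul_add _ n n') fun n a b => by
        change AdjoinOne.of (MulOpposite.op b) • AdjoinOne.of (MulOpposite.op a) • n =
          AdjoinOne.of (MulOpposite.op (AdjoinOne.of a • b)) • n
        rw [← mul_smul, ← map_mul, ← MulOpposite.op_mul, AdjoinOne.of_smul]
  have hφ (z : BalTensor A N A) : φ (rMap A g z) = g (φ z) := by
    induction z using induction with
    | tmul n a => exact (map_smul g _ _).symm
    | add x y hx hy => simp only [map_add, hx, hy]
  have key (z : BalTensor A N A) : ∃ t : Finset A, ∀ e : A,
      (∀ a ∈ t, e * a = a ∧ a * e = a) → z = tmul A (φ z) e := by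
    induction z using induction with
    | tmul n a =>
      refine ⟨{a}, fun e he => ?_⟩
      change _ = tmul A (AdjoinOne.of (MulOpposite.op a) • n) e
      rw [smul_tmul, AdjoinOne.of_smul, (he a (by simp)).2]
    | add x y hx hy =>
      obtain ⟨t, ht⟩ := hx
      obtain ⟨t', ht'⟩ := hy
      refine ⟨t ∪ t', fun e he => ?_⟩
      rw [map_add, tmul_add_left, ← ht e fun a ha => he a (Finset.mem_union_left _ ha),
        ← ht' e fun a ha => he a (Finset.mem_union_right _ ha)]
  refine (injective_iff_map_eq_zero _).2 fun z hz => ?_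
  obtain ⟨t, ht⟩ := key z
  obtain ⟨e, -, he⟩ := HasLocalUnits.exists_unit t
  have h0 : φ z = 0 := hg (by rw [← hφ, hz, map_zero, map_zero])
  rw [ht e he, h0, zero_tmul]

/-- The mirror image of `rMap_self_injective`: here `z = e ⊗ φ z` with `φ : A ⊗ M → M` the action.
-/
theorem lMap_self_injective {f : M →ₗ[AdjoinOne A] M'} (hf : Function.Injective f) :
    Function.Injective (lMap Aᵐᵒᵖ f) := by
  classical
  let φ {M : Type u} [AddCommGroup M] [Module (AdjoinOne A) M] : BalTensor A Aᵐᵒᵖ M →+ M :=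
    lift (AddMonoidHom.mk' (fun b => smulAddHom (AdjoinOne A) M (AdjoinOne.of b.unop))
      fun b b' => by rw [MulOpposite.unop_add, map_add, map_add]) fun b a m => by
        change AdjoinOne.of (AdjoinOne.of (MulOpposite.op a) • b).unop • m =
          AdjoinOne.of b.unop • AdjoinOne.of a • m
        rw [← mul_smul, ← map_mul, AdjoinOne.of_smul, MulOpposite.unop_mul, MulOpposite.unop_op]
  have hφ (z : BalTensor A Aᵐᵒᵖ M) : φ (lMap Aᵐᵒᵖ f z) = f (φ z) := by
    induction z using induction with
    | tmul n a => exact (map_smul f _ _).symm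
    | add x y hx hy => simp only [map_add, hx, hy]
  have key (z : BalTensor A Aᵐᵒᵖ M) : ∃ t : Finset A, ∀ e : A,
      (∀ a ∈ t, e * a = a ∧ a * e = a) → z = tmul A (MulOpposite.op e) (φ z) := by
    induction z using induction with
    | tmul b m =>
      refine ⟨{b.unop}, fun e he => ?_⟩
      change _ = tmul A (MulOpposite.op e) (AdjoinOne.of b.unop • m)
      rw [← smul_tmul, AdjoinOne.of_smul, ← MulOpposite.op_mul, (he b.unop (by simp)).1,
        MulOpposite.op_unop]
    | add x y hx hy =>
      obtain ⟨t, ht⟩ := hx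
      obtain ⟨t', ht'⟩ := hy
      refine ⟨t ∪ t', fun e he => ?_⟩
      rw [map_add, tmul_add_right, ← ht e fun a ha => he a (Finset.mem_union_left _ ha),
        ← ht' e fun a ha => he a (Finset.mem_union_right _ ha)]
  refine (injective_iff_map_eq_zero _).2 fun z hz => ?_
  obtain ⟨t, ht⟩ := key z
  obtain ⟨e, -, he⟩ := HasLocalUnits.exists_unit t
  have h0 : φ z = 0 := hf (by rw [← hφ, hz, map_zero, map_zero])
  rw [ht e he, h0, tmul_zero]

end BalTensor

section

variable {A : Type u} [NonUnitalRing A] [HasLocalUnits A]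

/-- Without an identity, `A` need not be projective as a module over itself. Flatness, unlike
projectivity, is available for all `freeModule`s, and the dimension shifts use nothing more. -/
theorem isFlatUnitary_freeModule (I : Type u) :
    IsFlatUnitary (UnitaryMod.freeModule Aᵐᵒᵖ I) := fun _ _ _ hf =>
  BalTensor.lMap_finsupp_injective (BalTensor.lMap_self_injective hf) I

theorem IsFlatUnitary.of_retract {N F : UnitaryMod Aᵐᵒᵖ} (hF : IsFlatUnitary F) (s : N ⟶ F)
    (p : F ⟶ N) (h : s ≫ p = 𝟙 N) : IsFlatUnitary N := fun M M' f hf => by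
  have hsp : p.hom.hom ∘ₗ s.hom.hom = LinearMap.id :=
    congrArg (fun g => g.hom.hom) h
  refine (injective_iff_map_eq_zero (BalTensor.lMap N.obj f.hom.hom)).2 fun z hz => ?_
  have h1 : BalTensor.rMap M.obj s.hom.hom z = 0 := hF f hf (by
    rw [← BalTensor.rMap_lMap, hz, map_zero, map_zero])
  rw [← BalTensor.rMap_id z, ← hsp, ← BalTensor.rMap_rMap, h1, map_zero]

theorem IsFlatUnitary.of_projective (P : UnitaryMod Aᵐᵒᵖ) [Projective P] : IsFlatUnitary P := by
  obtain ⟨s, hs⟩ := P.exists_section_freeCover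
  exact (isFlatUnitary_freeModule _).of_retract s _ hs

end

/-! ### Dimension shifting for Tor -/

/-- Here `Y` is the cokernel of `S.f` and `q` is the map induced by `S.g`. For a resolution tensored
with a module, right exactness presents this cokernel as the tensor product with a syzygy. -/
theorem CategoryTheory.ShortComplex.nonempty_homology_addEquiv_ker
    (S : ShortComplex AddCommGrpCat.{u})
    {Y : Type u} [AddCommGroup Y] {p : S.X₂ →+ Y} {q : Y →+ S.X₃} (hp : Function.Surjective p)
    (hSp : Function.Exact S.f.hom p) (hq : ∀ x, q (p x) = S.g.hom x) :
    Nonempty (S.homology ≃+ q.ker) := by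
  let p' : S.g.hom.ker →+ q.ker := (p.comp S.g.hom.ker.subtype).codRestrict _ fun x =>
    (hq x.1).trans x.2
  have hp' : Function.Surjective p' := by
    rintro ⟨y, hy⟩
    obtain ⟨x, rfl⟩ := hp y
    exact ⟨⟨x, (hq x).symm.trans hy⟩, rfl⟩
  obtain ⟨e⟩ := AddMonoidHom.nonempty_addEquiv_of_ker_eq
    (QuotientAddGroup.mk'_surjective S.abToCycles.range) hp' fun x => by
      rw [QuotientAddGroup.mk'_apply, QuotientAddGroup.eq_zero_iff, Subtype.ext_iff]
      change _ ↔ p x.1 = 0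
      rw [hSp]
      exact ⟨fun ⟨w, hw⟩ => ⟨w, congrArg Subtype.val hw⟩, fun ⟨w, hw⟩ => ⟨w, Subtype.ext hw⟩⟩
  exact ⟨S.abHomologyIso.addCommGroupIsoToAddEquiv.trans e⟩

namespace UnitaryMod

/-- The sequence `⋯ → P 1 → P 0 → N → 0` is exact. -/
structure IsResolution {A : Type u} [NonUnitalRing A] {P : ℕ → UnitaryMod A}
    (d : ∀ i, P (i + 1) ⟶ P i) {N : UnitaryMod A} (ε : P 0 ⟶ N) : Prop where
  surjective : Function.Surjective ε.hom
  exact_zero : Function.Exact (d 0).hom ε.hom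
  exact_succ : ∀ i, Function.Exact (d (i + 1)).hom (d i).hom

/-- The tail of a resolution resolves the kernel of the augmentation, which drives the induction on
the degree of Tor. -/
theorem IsResolution.shift {A : Type u} [NonUnitalRing A] [HasLocalUnits A] {P : ℕ → UnitaryMod A}
    {d : ∀ i, P (i + 1) ⟶ P i} {N : UnitaryMod A} {ε : P 0 ⟶ N} (h : IsResolution d ε) :
    IsResolution (P := fun i => P (i + 1)) (fun i => d (i + 1))
      (kerLift (d 0) ε fun x => (h.exact_zero _).2 ⟨x, rfl⟩) where
  surjective := kerLift_surjective h.exact_zero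
  exact_zero x := by
    rw [← h.exact_succ 0 x]
    exact Subtype.ext_iff
  exact_succ i := h.exact_succ (i + 1)

theorem isResolution_of_projectiveResolution {A : Type u} [NonUnitalRing A] [HasLocalUnits A]
    {N : UnitaryMod A} (P : ProjectiveResolution N) :
    IsResolution (P := P.complex.X) (fun i => P.complex.d (i + 1) i) (N := N) (P.π.f 0) where
  surjective :=
    have : Epi (P.π.f 0) := inferInstance
    surjective_of_epi (P.π.f 0)
  exact_zero := exact_of_shortComplex_exact P.exact₀
  exact_succ i := exact_of_shortComplex_exact (P.exact_succ i)

/-- Short exact sequences `0 → L (j + 1) → Q j → L j → 0`. -/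
structure SyzygySequence (A : Type u) [NonUnitalRing A] where
  /-- the syzygies -/
  L : ℕ → UnitaryMod A
  /-- the middle terms -/
  Q : ℕ → UnitaryMod A
  /-- the inclusions -/
  ι : ∀ j, L (j + 1) ⟶ Q j
  /-- the projections -/
  π : ∀ j, Q j ⟶ L j
  injective : ∀ j, Function.Injective (ι j).hom
  exact : ∀ j, Function.Exact (ι j).hom (π j).hom
  surjective : ∀ j, Function.Surjective (π j).hom

variable {A : Type u} [NonUnitalRing A] [HasLocalUnits A]

/-- The kernel of the canonical homomorphism from a free module. -/
noncomputable def syzygy (M : UnitaryMod A) : UnitaryMod A := ker (freeCover M)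

/-- The syzygies of `M` in its canonical free resolution. -/
noncomputable def iteratedSyzygy (M : UnitaryMod A) : ℕ → UnitaryMod A
  | 0 => M
  | n + 1 => syzygy (iteratedSyzygy M n)

/-- The canonical free resolution of `M`. -/
noncomputable def freeSyzygySequence (M : UnitaryMod A) : SyzygySequence A where
  L := iteratedSyzygy M
  Q j := freeModule A (iteratedSyzygy M j).obj
  ι j := kerι (freeCover (iteratedSyzygy M j))
  π j := freeCover (iteratedSyzygy M j)
  injective _ := kerι_injective _
  exact _ := kerι_exact _
  surjective _ := freeCover_surjective _

/-- Homology of a flat resolution of `N` tensored with a left module, by dimension shifting. -/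
theorem IsResolution.nonempty_homology_addEquiv_ker (S : SyzygySequence A)
    (T : UnitaryMod Aᵐᵒᵖ → Prop)
    (hker : ∀ {F N : UnitaryMod Aᵐᵒᵖ} (f : F ⟶ N), T F → T (ker f))
    (hinj : ∀ {F N : UnitaryMod Aᵐᵒᵖ} (f : F ⟶ N), Function.Surjective f.hom → T N →
      ∀ j, Function.Injective (BalTensor.rMap (S.Q j).obj (kerι f).hom.hom)) (n : ℕ) :
    ∀ {N : UnitaryMod Aᵐᵒᵖ} {P : ℕ → UnitaryMod Aᵐᵒᵖ} {d : ∀ i, P (i + 1) ⟶ P i} {ε : P 0 ⟶ N}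
      (_ : IsResolution d ε) (w : d (n + 1) ≫ d n = 0), T N → (∀ i, T (P i)) →
      (∀ i, IsFlatUnitary (P i)) →
      Nonempty ((ShortComplex.mk ((tensorFunctor (S.L 0)).map (d (n + 1)))
        ((tensorFunctor (S.L 0)).map (d n)) (by rw [← Functor.map_comp, w, Functor.map_zero])
          ).homology ≃+ (BalTensor.lMap N.obj (S.ι n).hom.hom).ker) := by
  -- `T` is a class of right modules for which all the `Q j` are acyclic in the sense of `hinj`; in
  -- the applications it is everything or the torsion-free groups. The resolution is shortened from
  -- the right end, so that `N` is replaced by `ker ε`, while the index of the left syzygy goes up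
  -- by one.
  induction n with
  | zero =>
    intro N P d ε h w hN hP hF
    -- In degree one the cokernel of `d 1 ⊗ L 0` is `ker ε ⊗ L 0`, and the homology is the kernel of
    -- its map to `P 0 ⊗ L 0`.
    obtain ⟨e⟩ := ShortComplex.nonempty_homology_addEquiv_ker
      (ShortComplex.mk ((tensorFunctor (S.L 0)).map (d 1)) ((tensorFunctor (S.L 0)).map (d 0))
        (by rw [← Functor.map_comp, w, Functor.map_zero]))
      (p := BalTensor.rMap (S.L 0).obj
        (kerLift (d 0) ε fun x => (h.exact_zero _).2 ⟨x, rfl⟩).hom.hom)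
      (q := BalTensor.rMap (S.L 0).obj (kerι ε).hom.hom)
      (BalTensor.rMap_surjective h.shift.surjective)
      (BalTensor.rMap_exact h.shift.exact_zero h.shift.surjective)
      fun x => BalTensor.rMap_rMap _ _ x
    obtain ⟨e'⟩ := BalTensor.nonempty_ker_rMap_addEquiv_ker_lMap (kerι_exact ε) h.surjective
      (S.exact 0) (S.surjective 0) (hF 0 (S.ι 0) (S.injective 0)) (hinj ε h.surjective hN 0)
    exact ⟨e.trans e'⟩
  | succ n ih =>
    intro N P d ε h w hN hP hF
    obtain ⟨e⟩ := ih h.shift w (hker ε (hP 0)) (fun i => hP (i + 1)) fun i => hF (i + 1)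
    obtain ⟨e'⟩ := BalTensor.nonempty_ker_rMap_addEquiv_ker_lMap (kerι_exact ε) h.surjective
      (S.exact (n + 1)) (S.surjective (n + 1)) (hF 0 (S.ι (n + 1)) (S.injective (n + 1)))
      (hinj ε h.surjective hN (n + 1))
    -- The two maps out of `ker ε ⊗ L (n + 1)`, to `ker ε ⊗ Q n` and to `P 0 ⊗ L (n + 1)`, become
    -- equal after injections into `P 0 ⊗ Q n`, so they have the same kernel.
    have hk : (BalTensor.lMap (ker ε).obj (S.ι n).hom.hom).ker =
        (BalTensor.rMap (S.L (n + 1)).obj (kerι ε).hom.hom).ker := by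
      ext z
      rw [AddMonoidHom.mem_ker, AddMonoidHom.mem_ker]
      rw [← map_eq_zero_iff _ (hinj ε h.surjective hN n), BalTensor.rMap_lMap]
      exact map_eq_zero_iff _ (hF 0 (S.ι n) (S.injective n))
    exact ⟨e.trans ((AddEquiv.addSubgroupCongr hk).trans e')⟩

/-- Tor is defined by a projective resolution of the right module `N`, but this computes it from any
sequence of left modules with `T`-acyclic middle terms. That freedom permits the use of a resolution
over `RG` to compute Tor over `ℤG`. -/
theorem nonempty_unitaryTor_succ_addEquiv_ker (S : SyzygySequence A) (T : UnitaryMod Aᵐᵒᵖ → Prop)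
    (hker : ∀ {F N : UnitaryMod Aᵐᵒᵖ} (f : F ⟶ N), T F → T (ker f))
    (hproj : ∀ P : UnitaryMod Aᵐᵒᵖ, Projective P → T P)
    (hinj : ∀ {F N : UnitaryMod Aᵐᵒᵖ} (f : F ⟶ N), Function.Surjective f.hom → T N →
      ∀ j, Function.Injective (BalTensor.rMap (S.Q j).obj (kerι f).hom.hom)) (n : ℕ)
    {N : UnitaryMod Aᵐᵒᵖ} (hN : T N) :
    Nonempty (unitaryTor (n + 1) N (S.L 0) ≃+ (BalTensor.lMap N.obj (S.ι n).hom.hom).ker) := by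
  let P := projectiveResolution N
  obtain ⟨e⟩ := (isResolution_of_projectiveResolution P).nonempty_homology_addEquiv_ker S T hker
    hinj n (P.complex.d_comp_d _ _ _) hN (fun i => hproj _ (P.projective i))
    fun i => IsFlatUnitary.of_projective (P.complex.X i)
  exact ⟨((P.isoLeftDerivedObj (tensorFunctor (S.L 0)) (n + 1)).trans
    (HomologicalComplex.homologyIsoSc' _ (n + 2) (n + 1) n
      (by simp only [ChainComplex.prev]; rfl) (by simp))).addCommGroupIsoToAddEquiv.trans e⟩

theorem nonempty_unitaryTor_zero_addEquiv (N : UnitaryMod Aᵐᵒᵖ) (M : UnitaryMod A) :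
    Nonempty (unitaryTor 0 N M ≃+ BalTensor A N.obj M.obj) := by
  let P := projectiveResolution N
  let K := ((tensorFunctor M).mapHomologicalComplex _).obj P.complex
  have h := isResolution_of_projectiveResolution P
  -- In a chain complex the index after `0` is `0` again by convention, with zero differential. So
  -- `q = 0`, and its kernel is all of `N ⊗ M`.
  obtain ⟨e⟩ := ShortComplex.nonempty_homology_addEquiv_ker (K.sc' 1 0 0)
    (p := BalTensor.rMap M.obj (P.π.f 0).hom.hom) (q := 0)
    (BalTensor.rMap_surjective h.surjective) (BalTensor.rMap_exact h.exact_zero h.surjective)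
    fun x => (congrArg (fun f => f.hom x) (K.shape 0 0 (by simp))).symm
  exact ⟨((P.isoLeftDerivedObj (tensorFunctor M) 0).trans
    (K.homologyIsoSc' 1 0 0 (by simp) (by simp))).addCommGroupIsoToAddEquiv.trans
      (e.trans ((AddEquiv.addSubgroupCongr (show _ = ⊤ from AddSubgroup.ext fun _ =>
        iff_of_true rfl trivial)).trans AddSubgroup.topEquiv))⟩

end UnitaryMod

/-! ### Flat dimension and vanishing of Tor -/

theorem AddMonoidHom.injective_iff_subsingleton_ker {B C : Type*} [AddCommGroup B] [AddCommGroup C]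
    (f : B →+ C) : Function.Injective f ↔ Subsingleton f.ker := by
  rw [← f.ker_eq_bot_iff]
  exact ⟨fun h => h ▸ inferInstance, fun h => AddSubgroup.ext fun x =>
    ⟨fun hx => congrArg Subtype.val (h.elim ⟨x, hx⟩ 0), fun hx => (AddSubgroup.mem_bot.1 hx) ▸
      zero_mem _⟩⟩

section

open UnitaryMod

variable {A : Type u} [NonUnitalRing A] [HasLocalUnits A]

theorem rMap_freeModule_kerι_injective {F N : UnitaryMod Aᵐᵒᵖ} (f : F ⟶ N) (I : Type u) :
    Function.Injective (BalTensor.rMap (freeModule A I).obj (kerι f).hom.hom) :=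
  BalTensor.rMap_finsupp_injective (BalTensor.rMap_self_injective (kerι_injective f)) I

/-- Left modules of the form `freeModule` are flat, so every right module may be admitted to the
class `T`. -/
theorem subsingleton_unitaryTor_succ_iff (n : ℕ) (N : UnitaryMod Aᵐᵒᵖ) (M : UnitaryMod A) :
    Subsingleton (unitaryTor (n + 1) N M) ↔ Function.Injective
      (BalTensor.lMap N.obj (kerι (freeCover (iteratedSyzygy M n))).hom.hom) := by
  obtain ⟨e⟩ := nonempty_unitaryTor_succ_addEquiv_ker (freeSyzygySequence M) (fun _ => True)
    (fun _ _ => trivial) (fun _ _ => trivial)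
    (fun f _ _ _ => rMap_freeModule_kerι_injective f _) n (N := N) trivial
  rw [AddMonoidHom.injective_iff_subsingleton_ker]
  exact e.toEquiv.subsingleton_congr

/-- Both sides say that `Tor₁` of `N` and `M` vanishes, computed from a flat cover of `N` and from
the free cover of `M`. -/
theorem rMap_kerι_injective_iff {F N : UnitaryMod Aᵐᵒᵖ} (hF : IsFlatUnitary F) {f : F ⟶ N}
    (hf : Function.Surjective f.hom) (M : UnitaryMod A) :
    Function.Injective (BalTensor.rMap M.obj (kerι f).hom.hom) ↔
      Function.Injective (BalTensor.lMap N.obj (kerι (freeCover M)).hom.hom) := by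
  obtain ⟨e⟩ := BalTensor.nonempty_ker_rMap_addEquiv_ker_lMap (kerι_exact f) hf
    (kerι_exact (freeCover M)) (freeCover_surjective M)
    (hF (kerι (freeCover M)) (kerι_injective _)) (rMap_freeModule_kerι_injective f _)
  rw [AddMonoidHom.injective_iff_subsingleton_ker, AddMonoidHom.injective_iff_subsingleton_ker]
  exact e.toEquiv.subsingleton_congr

/-- The cokernel of a homomorphism of unitary modules. -/
noncomputable def UnitaryMod.coker {M N : UnitaryMod A} (f : M ⟶ N) : UnitaryMod A :=
  ⟨ModuleCat.of _ (N.obj ⧸ LinearMap.range f.hom.hom), isUnitary.of_exists fun n => by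
    obtain ⟨n, rfl⟩ := Submodule.mkQ_surjective _ n
    obtain ⟨e, -, he⟩ := N.property.exists_unit n
    exact ⟨e, by rw [← map_smul, he]⟩⟩

/-- Injectivity of `N ⊗ f` for an injective `f` follows from the vanishing of `Tor₁` of `N` and the
cokernel of `f`, which can be tested on the free cover of that cokernel. -/
theorem isFlatUnitary_iff (N : UnitaryMod Aᵐᵒᵖ) : IsFlatUnitary N ↔ ∀ M : UnitaryMod A,
    Function.Injective (BalTensor.lMap N.obj (kerι (freeCover M)).hom.hom) := by
  refine ⟨fun h M => h _ (kerι_injective _), fun h M M' f hf => ?_⟩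
  refine BalTensor.lMap_injective_of_rMap_injective (kerι_exact (freeCover N))
    (freeCover_surjective N) (LinearMap.exact_map_mkQ_range f.hom.hom)
    (Submodule.mkQ_surjective _) (isFlatUnitary_freeModule _ f hf) ?_
  exact (rMap_kerι_injective_iff (isFlatUnitary_freeModule _) (freeCover_surjective N)
    (coker f)).2 (h (coker f))

/-- A syzygy may be moved from one argument of `Tor` to the other. Both conditions are equivalent to
injectivity of the diagonal of the square from `ker f ⊗ syzygy M` to the tensor product of `F` with
the free cover of `M`, because the second map on either path is injective. -/
theorem lMap_kerι_injective_iff_ker {F N : UnitaryMod Aᵐᵒᵖ} (hF : IsFlatUnitary F) {f : F ⟶ N}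
    (hf : Function.Surjective f.hom) (M : UnitaryMod A) :
    Function.Injective (BalTensor.lMap (ker f).obj (kerι (freeCover M)).hom.hom) ↔
      Function.Injective (BalTensor.lMap N.obj (kerι (freeCover (syzygy M))).hom.hom) := by
  have h : Function.Injective (BalTensor.lMap F.obj (kerι (freeCover M)).hom.hom) :=
    hF _ (kerι_injective _)
  rw [← rMap_kerι_injective_iff hF hf, ← (rMap_freeModule_kerι_injective f M.obj).of_comp_iff]
  exact (iff_of_eq (congrArg _ (funext fun z => BalTensor.rMap_lMap _ _ z))).trans
    (h.of_comp_iff (BalTensor.rMap (ker (freeCover M)).obj (kerι f).hom.hom))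

theorem hasFlatResolution_zero_iff (N : UnitaryMod Aᵐᵒᵖ) :
    HasFlatResolution N 0 ↔ IsFlatUnitary N := by
  constructor
  · rintro ⟨F, d, ε, hF, h0, hε, hd, -⟩
    -- The kernel of `ε` is the image of `F 1`, which is zero in a resolution of length `0`; hence
    -- `F 0 ≅ N`.
    have hinj : Function.Injective ε.hom := (injective_iff_map_eq_zero ε.hom.hom).2 fun x hx => by
      obtain ⟨y, rfl⟩ := (hd x).1 hx
      have := h0 1 one_pos
      rw [Subsingleton.elim y 0]
      exact map_zero (d 0).hom.hom
    let e := LinearEquiv.ofBijective ε.hom.hom ⟨hinj, hε⟩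
    exact (hF 0).of_retract (ObjectProperty.homMk (ModuleCat.ofHom e.symm.toLinearMap)) ε
      (ObjectProperty.hom_ext _ (ModuleCat.hom_ext (LinearMap.ext e.apply_symm_apply)))
  · intro hN
    -- The free module on the empty set serves as the zero module, so its flatness is already known.
    have hs : Subsingleton (freeModule Aᵐᵒᵖ PEmpty.{u + 1}).obj :=
      inferInstanceAs (Subsingleton (PEmpty →₀ Aᵐᵒᵖ))
    refine ⟨fun i => Nat.casesOn i N fun _ => freeModule Aᵐᵒᵖ PEmpty, fun _ => 0, 𝟙 N, ?_, ?_,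
      fun x => ⟨x, rfl⟩, fun x => ⟨fun h => ⟨0, h.symm⟩, ?_⟩, fun i x => ⟨fun _ => ⟨0, ?_⟩, ?_⟩⟩
    · rintro (_ | i)
      · exact hN
      · exact isFlatUnitary_freeModule _
    · rintro (_ | i) hi
      · exact absurd hi (lt_irrefl 0)
      · exact hs
    · rintro ⟨y, rfl⟩
      rfl
    · exact hs.elim _ _
    · exact fun _ => rfl

theorem hasFlatResolution_succ {F N : UnitaryMod Aᵐᵒᵖ} (hF : IsFlatUnitary F) {f : F ⟶ N}
    (hf : Function.Surjective f.hom) {n : ℕ} (h : HasFlatResolution (ker f) n) :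
    HasFlatResolution N (n + 1) := by
  obtain ⟨P, d, ε, hP, h0, hε, hd, hd'⟩ := h
  let P' : ℕ → UnitaryMod Aᵐᵒᵖ := fun i => Nat.casesOn i F P
  let d' : ∀ i, P' (i + 1) ⟶ P' i := fun i => Nat.casesOn i (ε ≫ kerι f) d
  refine ⟨P', d', f, ?_, ?_, hf, fun x => ⟨fun hx => ?_, ?_⟩, ?_⟩
  · rintro (_ | i)
    · exact hF
    · exact hP i
  · rintro (_ | i) hi
    · exact absurd hi (Nat.not_lt_zero _)
    · exact h0 i (Nat.lt_of_succ_lt_succ hi)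
  · obtain ⟨y, hy⟩ := hε ⟨x, hx⟩
    exact ⟨y, congrArg Subtype.val hy⟩
  · rintro ⟨y, rfl⟩
    exact (ε.hom y).2
  · rintro (_ | i)
    · intro x
      rw [← hd x]
      exact ⟨fun h => Subtype.ext h, fun h => congrArg Subtype.val h⟩
    · exact hd' i

/-- A unitary module has a flat resolution of length `n` if and only if its `n`-th syzygies are
flat, expressed in terms of the syzygies of the other argument. -/
theorem hasFlatResolution_iff_injective (n : ℕ) : ∀ N : UnitaryMod Aᵐᵒᵖ, HasFlatResolution N n ↔
    ∀ M : UnitaryMod A, Function.Injective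
      (BalTensor.lMap N.obj (kerι (freeCover (iteratedSyzygy M n))).hom.hom) := by
  induction n with
  | zero => exact fun N => (hasFlatResolution_zero_iff N).trans (isFlatUnitary_iff N)
  | succ n ih =>
    intro N
    constructor
    · rintro ⟨F, d, ε, hF, h0, hε, hd, hd'⟩ M
      have h := (IsResolution.mk hε hd hd').shift
      -- The shifted resolution has length `n` and resolves `ker ε`. Passing back to `N` costs one
      -- more syzygy of `M`.
      refine (lMap_kerι_injective_iff_ker (hF 0) hε _).1 ((ih (ker ε)).1 ?_ M)
      exact ⟨_, _, _, fun i => hF (i + 1), fun i hi => h0 (i + 1) (Nat.succ_lt_succ hi),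
        h.surjective, h.exact_zero, h.exact_succ⟩
    · intro h
      have hF := isFlatUnitary_freeModule (A := A) N.obj
      exact hasFlatResolution_succ hF (freeCover_surjective N) ((ih _).2 fun M =>
        (lMap_kerι_injective_iff_ker hF (freeCover_surjective N) _).2 (h M))

theorem hasFlatResolution_iff_subsingleton_unitaryTor (n : ℕ) (N : UnitaryMod Aᵐᵒᵖ) :
    HasFlatResolution N n ↔ ∀ M : UnitaryMod A, Subsingleton (unitaryTor (n + 1) N M) := by
  simp only [hasFlatResolution_iff_injective, subsingleton_unitaryTor_succ_iff]

theorem HasFlatResolution.mono {N : UnitaryMod Aᵐᵒᵖ} {n m : ℕ} (h : HasFlatResolution N n)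
    (hnm : n ≤ m) : HasFlatResolution N m := by
  obtain ⟨F, d, ε, hF, h0, h⟩ := h
  exact ⟨F, d, ε, hF, fun i hi => h0 i (hnm.trans_lt hi), h⟩

/-- Vanishing of Tor in the single degree `n + 1` gives a flat resolution of length `n`; regarded as
a resolution of any greater length, it kills Tor in all higher degrees. Degree zero imposes no
condition, in accordance with the supremum of the empty set being `0`. -/
theorem sSup_nontrivial_unitaryTor_le_iff (N : UnitaryMod Aᵐᵒᵖ) (n : ℕ) :
    sSup {d : ℕ∞ | ∃ n : ℕ, d = n ∧ ∃ M : UnitaryMod A, Nontrivial (unitaryTor n N M)} ≤ n ↔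
      HasFlatResolution N n := by
  rw [sSup_le_iff]
  constructor
  · intro h
    rw [hasFlatResolution_iff_subsingleton_unitaryTor]
    refine fun M => not_nontrivial_iff_subsingleton.1 fun hM => ?_
    exact absurd (Nat.cast_le.1 (h _ ⟨n + 1, rfl, M, hM⟩)) (Nat.not_succ_le_self n)
  · rintro h _ ⟨m, rfl, M, hM⟩
    refine Nat.cast_le.2 (not_lt.1 fun hnm => ?_)
    obtain ⟨k, rfl⟩ := Nat.exists_eq_succ_of_ne_zero (Nat.ne_zero_of_lt hnm)
    have := (hasFlatResolution_iff_subsingleton_unitaryTor k N).1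
      (h.mono (Nat.le_of_lt_succ hnm)) M
    exact not_nontrivial _ hM

/-- The flat dimension is the supremum of the degrees in which Tor does not vanish. -/
theorem sSup_nontrivial_unitaryTor (N : UnitaryMod Aᵐᵒᵖ) :
    sSup {d : ℕ∞ | ∃ n : ℕ, d = n ∧ ∃ M : UnitaryMod A, Nontrivial (unitaryTor n N M)} =
      flatDimension N := by
  refine le_antisymm (le_sInf ?_) ?_
  · rintro _ ⟨n, rfl, hn⟩
    exact (sSup_nontrivial_unitaryTor_le_iff N n).2 hn
  -- An infinite supremum bounds everything, and a finite supremum `n` yields a resolution of length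
  -- `n`.
  · generalize hs : sSup {d : ℕ∞ | ∃ n : ℕ, d = n ∧ ∃ M : UnitaryMod A,
      Nontrivial (unitaryTor n N M)} = s
    induction s using ENat.recTopCoe with
    | top => exact le_top
    | coe n => exact sInf_le ⟨n, rfl, (sSup_nontrivial_unitaryTor_le_iff N n).1 hs.le⟩

end

/-! ### Characteristic functions of bisections -/

namespace AmpleGroupoid

variable {X G : Type u} [TopologicalSpace X] [LocallyCompactSpace X] [T2Space X]
  [TotallyDisconnectedSpace X] [TopologicalSpace G] {𝒢 : AmpleGroupoid X G}
  {R : Type v} [Ring R]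

theorem setMul_image_unit (V : Set G) (W : Set X) :
    𝒢.setMul V (𝒢.unit '' W) = V ∩ 𝒢.s ⁻¹' W := by
  have e (b c c' : G) (hc : c = c') (h : 𝒢.s b = 𝒢.r c) (h' : 𝒢.s b = 𝒢.r c') :
      𝒢.mul b c h = 𝒢.mul b c' h' := by subst hc; rfl
  ext g
  constructor
  · rintro ⟨b, hb, _, ⟨x, hx, rfl⟩, h, rfl⟩
    have hbx : 𝒢.s b = x := by rw [h, 𝒢.r_unit]
    rw [e b _ (𝒢.unit (𝒢.s b)) (by rw [hbx]) h (𝒢.r_unit _).symm, 𝒢.mul_unit]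
    exact ⟨hb, by rwa [Set.mem_preimage, hbx]⟩
  · exact fun hg => ⟨g, hg.1, _, ⟨𝒢.s g, hg.2, rfl⟩, (𝒢.r_unit _).symm, (𝒢.mul_unit g).symm⟩

theorem image_unit_setMul (V : Set G) (W : Set X) :
    𝒢.setMul (𝒢.unit '' W) V = V ∩ 𝒢.r ⁻¹' W := by
  have e (b b' c : G) (hb : b = b') (h : 𝒢.s b = 𝒢.r c) (h' : 𝒢.s b' = 𝒢.r c) :
      𝒢.mul b c h = 𝒢.mul b' c h' := by subst hb; rfl
  ext g
  constructor
  · rintro ⟨_, ⟨x, hx, rfl⟩, b, hb, h, rfl⟩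
    have hbx : 𝒢.r b = x := by rw [← h, 𝒢.s_unit]
    rw [e _ (𝒢.unit (𝒢.r b)) b (by rw [hbx]) h (𝒢.s_unit _), 𝒢.unit_mul]
    exact ⟨hb, by rwa [Set.mem_preimage, hbx]⟩
  · exact fun hg => ⟨_, ⟨𝒢.r g, hg.2, rfl⟩, g, hg.1, 𝒢.s_unit _, (𝒢.unit_mul g).symm⟩

/-- The set is the product of `U` with the units in `W`, hence a compact bisection although `G` need
not be Hausdorff. -/
theorem IsBisection.inter_preimage_s {U : Set G} (hU : 𝒢.IsBisection U) {W : Set X}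
    (h : IsOpen W) (h' : IsCompact W) : 𝒢.IsBisection (U ∩ 𝒢.s ⁻¹' W) :=
  setMul_image_unit (𝒢 := 𝒢) U W ▸ hU.setMul (isBisection_unit h h')

theorem IsBisection.isOpen_image_s {U : Set G} (hU : 𝒢.IsBisection U) : IsOpen (𝒢.s '' U) :=
  𝒢.isLocalHomeomorph_s.isOpenMap _ hU.isOpen

theorem IsBisection.isCompact_image_s {U : Set G} (hU : 𝒢.IsBisection U) : IsCompact (𝒢.s '' U) :=
  hU.isCompact.image 𝒢.continuous_s

theorem IsBisection.isOpen_image_r {U : Set G} (hU : 𝒢.IsBisection U) : IsOpen (𝒢.r '' U) :=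
  𝒢.isLocalHomeomorph_r.isOpenMap _ hU.isOpen

theorem IsBisection.isCompact_image_r {U : Set G} (hU : 𝒢.IsBisection U) : IsCompact (𝒢.r '' U) :=
  hU.isCompact.image 𝒢.continuous_r

/-- Compact open sets form a basis of the topology of the unit space. -/
theorem exists_isCompact_isOpen_subset (𝒢 : AmpleGroupoid X G) {O : Set X} (hO : IsOpen O) {x : X}
    (hx : x ∈ O) : ∃ V : Set X, IsOpen V ∧ IsCompact V ∧ x ∈ V ∧ V ⊆ O := by
  obtain ⟨B, hB, hxB, hBO⟩ := exists_isBisection (𝒢 := 𝒢) (hO.preimage 𝒢.continuous_s)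
    (g := 𝒢.unit x) (by rwa [Set.mem_preimage, 𝒢.s_unit])
  exact ⟨𝒢.s '' B, hB.isOpen_image_s, hB.isCompact_image_s, ⟨_, hxB, 𝒢.s_unit x⟩,
    Set.image_subset_iff.2 hBO⟩

/-! ### Characteristic functions of bisections as generators of the algebra -/

namespace ConvAlgebra

/-- The multiple by `c` of the characteristic function of a bisection. -/
noncomputable def single {U : Set G} (hU : 𝒢.IsBisection U) (c : R) : 𝒢.ConvAlgebra R :=
  ⟨U.indicator fun _ => c, indicator_mem hU c⟩

theorem single_congr {U V : Set G} (h : U = V) (hU : 𝒢.IsBisection U) (hV : 𝒢.IsBisection V)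
    (c : R) : single hU c = single hV c := by
  subst h
  rfl

theorem single_add {U : Set G} (hU : 𝒢.IsBisection U) (c d : R) :
    single hU (c + d) = single hU c + single hU d :=
  Subtype.ext (Set.indicator_add U (fun _ => c) fun _ => d)

theorem single_mul_single {U V : Set G} (hU : 𝒢.IsBisection U) (hV : 𝒢.IsBisection V) (c d : R) :
    single hU c * single hV d = single (hU.setMul hV) (c * d) :=
  Subtype.ext (conv_indicator hU c d)

@[elab_as_elim]
theorem induction {p : 𝒢.ConvAlgebra R → Prop}
    (single : ∀ (U : Set G) (hU : 𝒢.IsBisection U) (c : R), p (single hU c))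
    (add : ∀ f h, p f → p h → p (f + h)) (f : 𝒢.ConvAlgebra R) : p f := by
  obtain ⟨f, hf⟩ := f
  refine (span_induction (𝒢 := 𝒢)
    (p := fun f => ∃ hf : f ∈ compactOpenSpan R G, p ⟨f, hf⟩)
    (fun c U hU => ⟨_, single U hU c⟩) ?_ hf).2
  rintro f f' _ _ ⟨h, hp⟩ ⟨h', hp'⟩
  exact ⟨Submodule.add_mem _ h h', add _ _ hp hp'⟩

theorem ofUnits_eq_single {W : Set X} (h : IsOpen W) (h' : IsCompact W) :
    (ofUnits h h' : 𝒢.ConvAlgebra R) = single (isBisection_unit h h') 1 := rfl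

theorem single_mul_ofUnits {U : Set G} (hU : 𝒢.IsBisection U) (c : R) {W : Set X} (h : IsOpen W)
    (h' : IsCompact W) :
    single hU c * ofUnits h h' = single (hU.inter_preimage_s h h') c := by
  rw [ofUnits_eq_single, single_mul_single, mul_one]
  exact single_congr (setMul_image_unit U W) _ _ _

theorem single_mul_single_unit {U : Set G} (hU : 𝒢.IsBisection U) (c d : R) {W : Set X}
    (h : IsOpen W) (h' : IsCompact W) (hUW : 𝒢.s '' U ⊆ W) :
    single hU c * single (isBisection_unit h h') d = single hU (c * d) := by
  rw [single_mul_single]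
  exact single_congr ((setMul_image_unit U W).trans
    (Set.inter_eq_left.2 (Set.image_subset_iff.1 hUW))) _ _ _

theorem single_unit_mul_single {U : Set G} (hU : 𝒢.IsBisection U) (c d : R) {W : Set X}
    (h : IsOpen W) (h' : IsCompact W) (hUW : 𝒢.r '' U ⊆ W) :
    single (isBisection_unit h h') d * single hU c = single hU (d * c) := by
  rw [single_mul_single]
  exact single_congr ((image_unit_setMul U W).trans
    (Set.inter_eq_left.2 (Set.image_subset_iff.1 hUW))) _ _ _

theorem image_s_image_unit (W : Set X) : 𝒢.s '' (𝒢.unit '' W) = W := by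
  rw [Set.image_image]
  simp only [𝒢.s_unit, Set.image_id']

theorem image_r_image_unit (W : Set X) : 𝒢.r '' (𝒢.unit '' W) = W := by
  rw [Set.image_image]
  simp only [𝒢.r_unit, Set.image_id']

theorem ofUnits_mul_ofUnits_of_subset_right {W W' : Set X} (h : IsOpen W) (h' : IsCompact W)
    (k : IsOpen W') (k' : IsCompact W') (hW : W ⊆ W') :
    (ofUnits k k' * ofUnits h h' : 𝒢.ConvAlgebra R) = ofUnits h h' := by
  rw [ofUnits_eq_single k k', ofUnits_eq_single h h',
    single_unit_mul_single _ _ _ k k' (by rwa [image_r_image_unit]), mul_one]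

theorem ofInt_single {U : Set G} (hU : 𝒢.IsBisection U) (c : ℤ) :
    ofInt 𝒢 R (single hU c) = single hU (c : R) := by
  refine Subtype.ext (funext fun g => ?_)
  change ((U.indicator (fun _ => c) g : ℤ) : R) = U.indicator (fun _ => (c : R)) g
  by_cases hg : g ∈ U <;> simp only [hg, Set.indicator_of_mem, Set.indicator_of_notMem,
    not_false_eq_true, Int.cast_zero]

end ConvAlgebra

/-! ### Functions on the unit space and their extension by zero -/

namespace UnitFunctions

/-- The multiple by `c` of the characteristic function of a compact open set of units. -/
noncomputable def single (𝒢 : AmpleGroupoid X G) {W : Set X} (h : IsOpen W) (h' : IsCompact W)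
    (c : R) : 𝒢.UnitFunctions R :=
  ⟨W.indicator fun _ => c, indicator_unit_mem h h' c⟩

theorem single_congr {W W' : Set X} (e : W = W') (h : IsOpen W) (h' : IsCompact W)
    (k : IsOpen W') (k' : IsCompact W') (c : R) : single 𝒢 h h' c = single 𝒢 k k' c := by
  subst e
  rfl

@[elab_as_elim]
theorem induction {p : 𝒢.UnitFunctions R → Prop}
    (single : ∀ (W : Set X) (h : IsOpen W) (h' : IsCompact W) (c : R), p (single 𝒢 h h' c))
    (add : ∀ f h, p f → p h → p (f + h)) (f : 𝒢.UnitFunctions R) : p f := by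
  obtain ⟨f, hf⟩ := f
  refine (span_unit_induction
    (p := fun f => ∃ hf : f ∈ compactOpenSpan R X, p ⟨f, hf⟩)
    (fun c W h h' => ⟨_, single W h h' c⟩) ?_ hf).2
  rintro f f' _ _ ⟨h, hp⟩ ⟨h', hp'⟩
  exact ⟨Submodule.add_mem _ h h', add _ _ hp hp'⟩

theorem of_smul_single {V : Set G} (hV : 𝒢.IsBisection V) {W : Set X} (h : IsOpen W)
    (h' : IsCompact W) (c d : R) :
    (AdjoinOne.of (MulOpposite.op (ConvAlgebra.single hV d)) • single 𝒢 h h' c :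
      𝒢.UnitFunctions R) = single 𝒢 (hV.image_s h h').1 (hV.image_s h h').2 (c * d) :=
  Subtype.ext ((𝒢.of_smul_val R _ _).trans (act_indicator hV W c d))

variable (𝒢 R) in
/-- The canonical map `ℤG⁰ → RG⁰`. -/
noncomputable def ofInt : 𝒢.UnitFunctions ℤ →+ 𝒢.UnitFunctions R where
  toFun f := ⟨fun x => (f.1 x : R), by
    refine span_unit_induction (p := fun f : X → ℤ =>
      (fun x => (f x : R)) ∈ compactOpenSpan R X) (fun c W h h' => ?_) (fun f f' _ _ h h' => ?_) f.2
    · convert indicator_unit_mem h h' (c : R) using 1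
      ext x
      by_cases hx : x ∈ W <;> simp [hx]
    · convert Submodule.add_mem _ h h' using 1
      ext x
      simp⟩
  map_zero' := Subtype.ext (funext fun _ => Int.cast_zero)
  map_add' f h := Subtype.ext (funext fun _ => Int.cast_add _ _)

theorem ofInt_single {W : Set X} (h : IsOpen W) (h' : IsCompact W) (c : ℤ) :
    ofInt 𝒢 R (single 𝒢 h h' c) = single 𝒢 h h' (c : R) := by
  refine Subtype.ext (funext fun x => ?_)
  change ((W.indicator (fun _ => c) x : ℤ) : R) = W.indicator (fun _ => (c : R)) x
  by_cases hx : x ∈ W <;> simp only [hx, Set.indicator_of_mem, Set.indicator_of_notMem,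
    not_false_eq_true, Int.cast_zero]

theorem ofInt_of_smul (h : 𝒢.UnitFunctions ℤ) (f : 𝒢.ConvAlgebra ℤ) :
    ofInt 𝒢 R (AdjoinOne.of (MulOpposite.op f) • h) =
      AdjoinOne.of (MulOpposite.op (ConvAlgebra.ofInt 𝒢 R f)) • ofInt 𝒢 R h := by
  induction h using induction with
  | single W o o' c =>
    induction f using ConvAlgebra.induction with
    | single U hU d =>
      rw [of_smul_single, ofInt_single, ofInt_single, ConvAlgebra.ofInt_single, of_smul_single,
        Int.cast_mul]
    | add f f' h1 h2 =>
      simp only [MulOpposite.op_add, map_add, add_smul, h1, h2]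
  | add h h' h1 h2 => simp only [map_add, smul_add, h1, h2]

variable (𝒢 R) in
/-- The inclusion `RG⁰ → RG` that extends functions by zero. -/
noncomputable def toConvAlgebra : 𝒢.UnitFunctions R →+ 𝒢.ConvAlgebra R where
  toFun f := ⟨(Set.range 𝒢.unit).indicator fun g => f.1 (𝒢.s g), by
    refine span_unit_induction (p := fun f : X → R =>
      (Set.range 𝒢.unit).indicator (fun g => f (𝒢.s g)) ∈ compactOpenSpan R G)
      (fun c W h h' => ?_) (fun f f' _ _ h h' => ?_) f.2
    · convert indicator_mem (isBisection_unit (𝒢 := 𝒢) h h') c using 1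
      ext g
      by_cases hg : g ∈ Set.range 𝒢.unit
      · obtain ⟨x, rfl⟩ := hg
        have hi : Function.Injective 𝒢.unit := fun y z h => by
          rw [← 𝒢.s_unit y, h, 𝒢.s_unit]
        by_cases hx : x ∈ W <;> simp [hx, 𝒢.s_unit, hi.mem_set_image]
      · rw [Set.indicator_of_notMem hg, Set.indicator_of_notMem fun h =>
          hg (Set.image_subset_range _ _ h)]
    · convert Submodule.add_mem _ h h' using 1
      exact Set.indicator_add _ _ _⟩
  map_zero' := Subtype.ext (Set.indicator_zero _ _)
  map_add' f h := Subtype.ext (Set.indicator_add _ _ _)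

theorem toConvAlgebra_single {W : Set X} (h : IsOpen W) (h' : IsCompact W) (c : R) :
    toConvAlgebra 𝒢 R (single 𝒢 h h' c) = ConvAlgebra.single (isBisection_unit h h') c := by
  refine Subtype.ext (funext fun g => ?_)
  change (Set.range 𝒢.unit).indicator (fun g => W.indicator (fun _ => c) (𝒢.s g)) g =
    (𝒢.unit '' W).indicator (fun _ => c) g
  by_cases hg : g ∈ Set.range 𝒢.unit
  · obtain ⟨x, rfl⟩ := hg
    have hi : Function.Injective 𝒢.unit := fun y z h => by
      rw [← 𝒢.s_unit y, h, 𝒢.s_unit]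
    by_cases hx : x ∈ W <;> simp [hx, 𝒢.s_unit, hi.mem_set_image]
  · rw [Set.indicator_of_notMem hg, Set.indicator_of_notMem fun h =>
      hg (Set.image_subset_range _ _ h)]

end UnitFunctions

end AmpleGroupoid

/-! ### Tensor products with the trivial module -/

namespace AmpleGroupoid

variable {X G : Type u} [TopologicalSpace X] [LocallyCompactSpace X] [T2Space X]
  [TotallyDisconnectedSpace X] [TopologicalSpace G] {𝒢 : AmpleGroupoid X G}
  {R : Type u} [Ring R]

theorem of_smul_restrictInt (M : UnitaryMod (𝒢.ConvAlgebra R)) (f : 𝒢.ConvAlgebra ℤ) (m : M.obj) :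
    (AdjoinOne.of f • (show (𝒢.restrictInt M).obj from m)) =
      (show (𝒢.restrictInt M).obj from AdjoinOne.of (ConvAlgebra.ofInt 𝒢 R f) • m) := by
  refine (ModuleCat.restrictScalars.smul_def _ _ _).trans ?_
  rw [AdjoinOne.lift_of]
  rfl

/-- A homomorphism of `RG`-modules, regarded as a homomorphism of `ℤG`-modules. -/
noncomputable def restrictIntMap {M M' : UnitaryMod (𝒢.ConvAlgebra R)} (f : M ⟶ M') :
    𝒢.restrictInt M ⟶ 𝒢.restrictInt M' :=
  ObjectProperty.homMk ((ModuleCat.restrictScalars _).map f.hom)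

theorem exists_ofUnits_smul (M : UnitaryMod (𝒢.ConvAlgebra R)) (m : M.obj) :
    ∃ (W : Set X) (h : IsOpen W) (h' : IsCompact W),
      AdjoinOne.of (ConvAlgebra.ofUnits h h' : 𝒢.ConvAlgebra R) • m = m := by
  obtain ⟨t, ht⟩ := M.property.exists_finset m
  obtain ⟨W, h, h', H⟩ := ConvAlgebra.exists_ofUnits_finset t
  exact ⟨W, h, h', ht _ H⟩

section

variable (M : UnitaryMod (𝒢.ConvAlgebra R))

/-- The tensor product `ℤG⁰ ⊗ M` over `ℤG`. -/
abbrev IntTensor : Type u :=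
  BalTensor (𝒢.ConvAlgebra ℤ) (𝒢.UnitFunctions ℤ) (𝒢.restrictInt M).obj

variable {M}

/-- The element `h ⊗ m` of `ℤG⁰ ⊗ M`. -/
noncomputable def intTmul (h : 𝒢.UnitFunctions ℤ) (m : M.obj) : IntTensor M :=
  BalTensor.tmul (𝒢.ConvAlgebra ℤ) h (show (𝒢.restrictInt M).obj from m)

theorem intTmul_add_right (h : 𝒢.UnitFunctions ℤ) (m m' : M.obj) :
    intTmul h (m + m') = intTmul h m + intTmul h m' :=
  BalTensor.tmul_add_right (A := 𝒢.ConvAlgebra ℤ) (M := (𝒢.restrictInt M).obj) h m m'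

theorem intTmul_smul (h : 𝒢.UnitFunctions ℤ) (f : 𝒢.ConvAlgebra ℤ) (m : M.obj) :
    intTmul (AdjoinOne.of (MulOpposite.op f) • h) m =
      intTmul h (AdjoinOne.of (ConvAlgebra.ofInt 𝒢 R f) • m) := by
  refine (BalTensor.smul_tmul h f _).trans ?_
  rw [of_smul_restrictInt]
  rfl

/-- Move `1_W` across the tensor sign: `c 1_{W'} ⊗ m = c 1_{W'} ⊗ 1_W m = c 1_{W'} 1_W ⊗ m = c 1_W ⊗
m`. So `1_W ⊗ m` does not depend on the set `W` with `1_W m = m`, which makes `toIntTensor`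
additive. -/
theorem intTmul_single_of_subset {m : M.obj} {W W' : Set X} {h : IsOpen W} {h' : IsCompact W}
    (H : AdjoinOne.of (ConvAlgebra.ofUnits h h' : 𝒢.ConvAlgebra R) • m = m) (k : IsOpen W')
    (k' : IsCompact W') (hW : W ⊆ W') (c : ℤ) :
    intTmul (UnitFunctions.single 𝒢 k k' c) m = intTmul (UnitFunctions.single 𝒢 h h' c) m := by
  conv_lhs => rw [← H, ← ConvAlgebra.ofInt_ofUnits, ← intTmul_smul,
    ConvAlgebra.ofUnits_eq_single, UnitFunctions.of_smul_single, mul_one]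
  congr 1
  refine UnitFunctions.single_congr ?_ _ _ _ _ _
  rw [Set.inter_eq_left.2]
  · exact ConvAlgebra.image_s_image_unit W
  · exact Set.image_subset_iff.1 ((ConvAlgebra.image_r_image_unit W).trans_subset hW)

variable (M)

/-- The homomorphism `M → ℤG⁰ ⊗ M` that maps `m` to `1_W ⊗ m` for all large compact open sets `W` of
units. -/
noncomputable def toIntTensor : M.obj →+ IntTensor M :=
  AddMonoidHom.mk' (fun m => intTmul (UnitFunctions.single 𝒢
    (exists_ofUnits_smul M m).choose_spec.choose
    (exists_ofUnits_smul M m).choose_spec.choose_spec.choose 1) m) fun m m' => by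
      have H := (exists_ofUnits_smul M m).choose_spec.choose_spec.choose_spec
      have H' := (exists_ofUnits_smul M m').choose_spec.choose_spec.choose_spec
      have H'' := (exists_ofUnits_smul M (m + m')).choose_spec.choose_spec.choose_spec
      have o := (exists_ofUnits_smul M m).choose_spec.choose
      have o' := (exists_ofUnits_smul M m').choose_spec.choose
      have o'' := (exists_ofUnits_smul M (m + m')).choose_spec.choose
      have c := (exists_ofUnits_smul M m).choose_spec.choose_spec.choose
      have c' := (exists_ofUnits_smul M m').choose_spec.choose_spec.choose
      have c'' := (exists_ofUnits_smul M (m + m')).choose_spec.choose_spec.choose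
      -- The sets chosen for `m`, `m'` and `m + m'` may all be replaced by their union, where
      -- additivity is that of the tensor product.
      have hu := (o.union o').union o''
      have cu := (c.union c').union c''
      change intTmul _ (m + m') = intTmul _ m + intTmul _ m'
      rw [← intTmul_single_of_subset H hu cu
          (Set.subset_union_left.trans Set.subset_union_left),
        ← intTmul_single_of_subset H' hu cu
          (Set.subset_union_right.trans Set.subset_union_left),
        ← intTmul_single_of_subset H'' hu cu Set.subset_union_right, intTmul_add_right]

variable {M}

theorem toIntTensor_apply {m : M.obj} {W : Set X} {h : IsOpen W} {h' : IsCompact W}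
    (H : AdjoinOne.of (ConvAlgebra.ofUnits h h' : 𝒢.ConvAlgebra R) • m = m) :
    toIntTensor M m = intTmul (UnitFunctions.single 𝒢 h h' 1) m := by
  have H' := (exists_ofUnits_smul M m).choose_spec.choose_spec.choose_spec
  have o' := (exists_ofUnits_smul M m).choose_spec.choose
  have c' := (exists_ofUnits_smul M m).choose_spec.choose_spec.choose
  change intTmul _ m = _
  rw [← intTmul_single_of_subset H (h.union o') (h'.union c') Set.subset_union_left,
    ← intTmul_single_of_subset H' (h.union o') (h'.union c') Set.subset_union_right]

/-- The image of `1_U m` is `1_{r(U)} ⊗ 1_U m = 1_{r(U)} 1_U ⊗ m = 1_{s(U)} ⊗ m`. The coefficient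
must be `1` for `1_U` to come from `ℤG` and move across the tensor sign. -/
theorem toIntTensor_single_smul {U : Set G} (hU : 𝒢.IsBisection U) (m : M.obj) :
    toIntTensor M (AdjoinOne.of (ConvAlgebra.single hU (1 : R)) • m) =
      toIntTensor M (AdjoinOne.of
        (ConvAlgebra.ofUnits hU.isOpen_image_s hU.isCompact_image_s : 𝒢.ConvAlgebra R) • m) := by
  rw [toIntTensor_apply (h := hU.isOpen_image_r) (h' := hU.isCompact_image_r),
    toIntTensor_apply (h := hU.isOpen_image_s) (h' := hU.isCompact_image_s)]
  · have e : (ConvAlgebra.single hU (1 : R)) = ConvAlgebra.ofInt 𝒢 R (ConvAlgebra.single hU 1) := by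
      rw [ConvAlgebra.ofInt_single, Int.cast_one]
    have e' : (ConvAlgebra.ofUnits hU.isOpen_image_s hU.isCompact_image_s : 𝒢.ConvAlgebra R) =
      ConvAlgebra.ofInt 𝒢 R (ConvAlgebra.ofUnits _ _) := (ConvAlgebra.ofInt_ofUnits _ _ _ _).symm
    rw [e, e', ← intTmul_smul, ← intTmul_smul, ConvAlgebra.ofUnits_eq_single,
      UnitFunctions.of_smul_single, UnitFunctions.of_smul_single]
    congr 1
    refine UnitFunctions.single_congr ?_ _ _ _ _ _
    rw [Set.inter_eq_left.2 (Set.image_subset_iff.1 subset_rfl), Set.inter_eq_left.2,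
      ConvAlgebra.image_s_image_unit]
    exact Set.image_subset_iff.1 (ConvAlgebra.image_r_image_unit (𝒢 := 𝒢) _).subset
  · rw [← mul_smul, ← map_mul, ConvAlgebra.ofUnits_mul_self]
  · rw [← mul_smul, ← map_mul, ConvAlgebra.ofUnits_eq_single,
      ConvAlgebra.single_unit_mul_single _ _ _ hU.isOpen_image_r hU.isCompact_image_r subset_rfl,
      mul_one]

/-- Since `c 1_U = 1_U · c 1_{s(U)}`, the coefficient `c` can be left on the units and the case of
coefficient `1` applies to `c 1_{s(U)} m`. -/
theorem toIntTensor_single_smul' {U : Set G} (hU : 𝒢.IsBisection U) (c : R) (m : M.obj) :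
    toIntTensor M (AdjoinOne.of (ConvAlgebra.single hU c) • m) = toIntTensor M (AdjoinOne.of
      (ConvAlgebra.single
        (isBisection_unit (𝒢 := 𝒢) hU.isOpen_image_s hU.isCompact_image_s) c) • m) := by
  have e : ConvAlgebra.single hU c = ConvAlgebra.single hU 1 * ConvAlgebra.single
      (isBisection_unit hU.isOpen_image_s hU.isCompact_image_s) c := by
    rw [ConvAlgebra.single_mul_single_unit _ _ _ hU.isOpen_image_s hU.isCompact_image_s subset_rfl,
      one_mul]
  rw [e, map_mul, mul_smul, toIntTensor_single_smul, ← mul_smul, ← map_mul,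
    ConvAlgebra.ofUnits_eq_single, ConvAlgebra.single_mul_single_unit _ _ _ hU.isOpen_image_s
      hU.isCompact_image_s, one_mul]
  exact (ConvAlgebra.image_s_image_unit (𝒢 := 𝒢) _).subset

variable (M)

/-- The canonical homomorphism `ℤG⁰ ⊗_{ℤG} M → RG⁰ ⊗_{RG} M`. -/
noncomputable def intTensorHom :
    IntTensor M →+ BalTensor (𝒢.ConvAlgebra R) (𝒢.UnitFunctions R) M.obj :=
  BalTensor.lift (M := (𝒢.restrictInt M).obj) (AddMonoidHom.mk' (fun h => AddMonoidHom.mk'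
      (fun m => BalTensor.tmul (M := M.obj) (𝒢.ConvAlgebra R) (UnitFunctions.ofInt 𝒢 R h) m)
        fun m m' => BalTensor.tmul_add_right (M := M.obj) _ m m') fun h h' =>
          AddMonoidHom.ext fun m =>
            (congrArg (fun x => BalTensor.tmul (M := M.obj) (𝒢.ConvAlgebra R) x m)
              (map_add _ h h')).trans (BalTensor.tmul_add_left (M := M.obj) _ _ m)) fun h f m =>
    (congrArg (fun x => BalTensor.tmul (M := M.obj) (𝒢.ConvAlgebra R) x m)
      (UnitFunctions.ofInt_of_smul h f)).trans ((BalTensor.smul_tmul (M := M.obj) _ _ m).trans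
        (congrArg (fun x => BalTensor.tmul (M := M.obj) (𝒢.ConvAlgebra R)
          (UnitFunctions.ofInt 𝒢 R h) x) (of_smul_restrictInt M f m).symm))

variable {M}

theorem intTensorHom_tmul (h : 𝒢.UnitFunctions ℤ) (m : M.obj) :
    intTensorHom M (intTmul h m) =
      BalTensor.tmul (𝒢.ConvAlgebra R) (UnitFunctions.ofInt 𝒢 R h) m := rfl

variable (M)

/-- The inverse of `ℤG⁰ ⊗_{ℤG} M → RG⁰ ⊗_{RG} M`. -/
noncomputable def intTensorInv :
    BalTensor (𝒢.ConvAlgebra R) (𝒢.UnitFunctions R) M.obj →+ IntTensor M :=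
  BalTensor.lift (AddMonoidHom.mk' (fun h => (toIntTensor M).comp
      (smulAddHom (AdjoinOne (𝒢.ConvAlgebra R)) M.obj
        (AdjoinOne.of (UnitFunctions.toConvAlgebra 𝒢 R h)))) fun h h' => by
        rw [map_add, map_add, map_add, AddMonoidHom.comp_add]) fun h f m => by
    change toIntTensor M (AdjoinOne.of (UnitFunctions.toConvAlgebra 𝒢 R _) • m) =
      toIntTensor M (AdjoinOne.of (UnitFunctions.toConvAlgebra 𝒢 R h) • AdjoinOne.of f • m)
    induction h using UnitFunctions.induction with
    | single W o o' c =>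
      induction f using ConvAlgebra.induction with
      | single V hV d =>
        rw [UnitFunctions.of_smul_single, UnitFunctions.toConvAlgebra_single,
          UnitFunctions.toConvAlgebra_single, ← mul_smul, ← map_mul, ConvAlgebra.single_mul_single]
        -- On generators, `c 1_W * d 1_V` is `c d` times the characteristic function of `V ∩
        -- r⁻¹(W)`, while `c 1_W` acted on by `d 1_V` is `c d` times that of the set of sources.
        -- These give the same value by invariance.
        refine Eq.trans ?_ (toIntTensor_single_smul' _ _ _).symm
        congr 3
        refine ConvAlgebra.single_congr ?_ _ _ _
        rw [image_unit_setMul]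
      | add f f' h1 h2 => simp only [MulOpposite.op_add, map_add, add_smul, smul_add, h1, h2]
    | add h h' h1 h2 => simp only [map_add, smul_add, add_smul, h1, h2]

variable {M}

theorem intTensorInv_tmul (h : 𝒢.UnitFunctions R) (m : M.obj) :
    intTensorInv M (BalTensor.tmul (𝒢.ConvAlgebra R) h m) =
      toIntTensor M (AdjoinOne.of (UnitFunctions.toConvAlgebra 𝒢 R h) • m) := rfl

theorem intTensorInv_intTensorHom (z : IntTensor M) : intTensorInv M (intTensorHom M z) = z := by
  induction z using BalTensor.induction with
  | tmul h m =>
    change intTensorInv M (intTensorHom M (intTmul h (show M.obj from m))) =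
      intTmul h (show M.obj from m)
    rw [intTensorHom_tmul, intTensorInv_tmul]
    induction h using UnitFunctions.induction with
    | single W o o' c =>
      have e : ConvAlgebra.single (isBisection_unit (𝒢 := 𝒢) o o') (c : R) =
          ConvAlgebra.ofInt 𝒢 R (ConvAlgebra.single (isBisection_unit o o') c) :=
        (ConvAlgebra.ofInt_single _ _).symm
      rw [UnitFunctions.ofInt_single, UnitFunctions.toConvAlgebra_single,
        toIntTensor_apply (h := o) (h' := o'), e, ← intTmul_smul, UnitFunctions.of_smul_single,
        one_mul]
      · congr 1
        refine UnitFunctions.single_congr ?_ _ _ _ _ _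
        rw [Set.inter_eq_left.2, ConvAlgebra.image_s_image_unit]
        exact Set.image_subset_iff.1 (ConvAlgebra.image_r_image_unit (𝒢 := 𝒢) _).subset
      · rw [← mul_smul, ← map_mul, ConvAlgebra.ofUnits_eq_single,
          ConvAlgebra.single_unit_mul_single _ _ _ o o', one_mul]
        exact (ConvAlgebra.image_r_image_unit (𝒢 := 𝒢) _).subset
    | add h h' h1 h2 =>
      rw [map_add, map_add, map_add, add_smul, map_add, h1, h2]
      exact (BalTensor.tmul_add_left h h' _).symm
  | add x y hx hy => rw [map_add, map_add, hx, hy]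

/-- On generators, `c 1_W ⊗ m` goes to `1_W ⊗ c 1_W m`, and over `RG` the factor `c 1_W` moves back
to the left. -/
theorem intTensorHom_intTensorInv
    (z : BalTensor (𝒢.ConvAlgebra R) (𝒢.UnitFunctions R) M.obj) :
    intTensorHom M (intTensorInv M z) = z := by
  induction z using BalTensor.induction with
  | tmul h m =>
    rw [intTensorInv_tmul]
    induction h using UnitFunctions.induction with
    | single W o o' c =>
      rw [UnitFunctions.toConvAlgebra_single, toIntTensor_apply (h := o) (h' := o'),
        intTensorHom_tmul, ← BalTensor.smul_tmul, UnitFunctions.ofInt_single,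
        UnitFunctions.of_smul_single, Int.cast_one, one_mul]
      · congr 1
        refine UnitFunctions.single_congr ?_ _ _ _ _ _
        rw [Set.inter_eq_left.2, ConvAlgebra.image_s_image_unit]
        exact Set.image_subset_iff.1 (ConvAlgebra.image_r_image_unit (𝒢 := 𝒢) _).subset
      · rw [← mul_smul, ← map_mul, ConvAlgebra.ofUnits_eq_single,
          ConvAlgebra.single_unit_mul_single _ _ _ o o', one_mul]
        exact (ConvAlgebra.image_r_image_unit (𝒢 := 𝒢) _).subset
    | add h h' h1 h2 =>
      rw [map_add, map_add, add_smul, map_add, map_add, h1, h2, BalTensor.tmul_add_left]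
  | add x y hx hy => rw [map_add, map_add, hx, hy]

variable (M)

/-- The isomorphism `ℤG⁰ ⊗_{ℤG} M ≃ RG⁰ ⊗_{RG} M`. -/
noncomputable def intTensorEquiv :
    IntTensor M ≃+ BalTensor (𝒢.ConvAlgebra R) (𝒢.UnitFunctions R) M.obj :=
  { intTensorHom M with
    invFun := intTensorInv M
    left_inv := intTensorInv_intTensorHom
    right_inv := intTensorHom_intTensorInv }

variable {M}

theorem intTensorEquiv_lMap {M' : UnitaryMod (𝒢.ConvAlgebra R)} (f : M ⟶ M') (z : IntTensor M) :
    intTensorEquiv M' (BalTensor.lMap _ (restrictIntMap f).hom.hom z) =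
      BalTensor.lMap _ f.hom.hom (intTensorEquiv M z) := by
  induction z using BalTensor.induction with
  | tmul h m => rfl
  | add x y hx hy => rw [map_add, map_add, map_add, map_add, hx, hy]

end

end AmpleGroupoid

/-! ### The groupoid algebra as a tensor product -/

namespace AmpleGroupoid

variable {X G : Type u} [TopologicalSpace X] [LocallyCompactSpace X] [T2Space X]
  [TotallyDisconnectedSpace X] [TopologicalSpace G] {𝒢 : AmpleGroupoid X G}
  {R : Type v} [Ring R]

namespace ConvAlgebra

/-- The elements of `RG` as functions. -/
def toFun : 𝒢.ConvAlgebra R →+ (G → R) where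
  toFun := Subtype.val
  map_zero' := rfl
  map_add' _ _ := rfl

theorem toFun_single {U : Set G} (hU : 𝒢.IsBisection U) (c : R) :
    toFun (single hU c) = U.indicator fun _ => c := rfl

theorem single_eq_zsmul {U : Set G} (hU : 𝒢.IsBisection U) (k : ℤ) :
    single hU k = k • single hU (1 : ℤ) := by
  refine Subtype.ext ((?_ : _ = k • toFun (𝒢 := 𝒢) (single hU (1 : ℤ))).trans
    (map_zsmul (toFun (𝒢 := 𝒢) (R := ℤ)) k _).symm)
  ext g
  rw [toFun_single, Pi.smul_apply]
  by_cases hg : g ∈ U <;> simp [hg, single]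

variable (𝒢 R) in
/-- The canonical map `ℤG ⊗ R → RG`. -/
noncomputable def tensorHom : 𝒢.ConvAlgebra ℤ ⊗[ℤ] R →+ 𝒢.ConvAlgebra R :=
  TensorProduct.liftAddHom (AddMonoidHom.mk' (fun f => AddMonoidHom.mk' (fun c =>
      ⟨fun g => (f.1 g : R) * c, by
        refine span_induction (𝒢 := 𝒢) (p := fun f : G → ℤ =>
          (fun g => (f g : R) * c) ∈ compactOpenSpan R G) (fun k U hU => ?_)
          (fun f f' _ _ h h' => ?_) f.2
        · convert indicator_mem hU ((k : R) * c) using 1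
          ext g
          by_cases hg : g ∈ U <;> simp [hg]
        · convert Submodule.add_mem _ h h' using 1
          ext g
          simp [add_mul]⟩) fun c c' => Subtype.ext (funext fun g => mul_add _ _ _)) fun f f' =>
            AddMonoidHom.ext fun c => Subtype.ext (funext fun g => by
              change ((f.1 g + f'.1 g : ℤ) : R) * c = (f.1 g : R) * c + (f'.1 g : R) * c
              rw [Int.cast_add, add_mul])) fun k f c => Subtype.ext (funext fun g => by
          change (((k • f).1 g : ℤ) : R) * c = (f.1 g : R) * (k • c)
          have : (k • f).1 g = k * f.1 g := congrFun (map_zsmul (toFun (𝒢 := 𝒢) (R := ℤ)) k f) g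
          rw [this, Int.cast_mul, zsmul_eq_mul, _root_.mul_assoc, ← _root_.mul_assoc (f.1 g : R),
            (Int.cast_commute (f.1 g) (k : R)).eq, _root_.mul_assoc])

theorem tensorHom_single_tmul {U : Set G} (hU : 𝒢.IsBisection U) (k : ℤ) (c : R) :
    tensorHom 𝒢 R (single hU k ⊗ₜ c) = single hU ((k : R) * c) := by
  refine Subtype.ext (funext fun g => ?_)
  change ((U.indicator (fun _ => k) g : ℤ) : R) * c = U.indicator (fun _ => (k : R) * c) g
  by_cases hg : g ∈ U <;> simp [hg]

theorem tensorHom_surjective : Function.Surjective (tensorHom 𝒢 R) := fun f => by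
  induction f using induction with
  | single U hU c =>
    exact ⟨single hU 1 ⊗ₜ c, by rw [tensorHom_single_tmul, Int.cast_one, one_mul]⟩
  | add f h hf hh =>
    obtain ⟨w, rfl⟩ := hf
    obtain ⟨w', rfl⟩ := hh
    exact ⟨w + w', map_add _ _ _⟩

/-- Integer coefficients are moved into `R`, leaving bisections with weights in `R`. The index type,
rather than a set of bisections, allows repetitions, so sums are concatenated by disjoint union. -/
theorem exists_eq_sum_single_tmul (w : 𝒢.ConvAlgebra ℤ ⊗[ℤ] R) :
    ∃ (ι : Type) (_ : Fintype ι) (U : ι → Set G) (hU : ∀ i, 𝒢.IsBisection (U i)) (c : ι → R),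
      w = ∑ i, single (hU i) (1 : ℤ) ⊗ₜ[ℤ] c i := by
  have add (w w' : 𝒢.ConvAlgebra ℤ ⊗[ℤ] R)
      (h : ∃ (ι : Type) (_ : Fintype ι) (U : ι → Set G) (hU : ∀ i, 𝒢.IsBisection (U i))
        (c : ι → R), w = ∑ i, single (hU i) (1 : ℤ) ⊗ₜ[ℤ] c i)
      (h' : ∃ (ι : Type) (_ : Fintype ι) (U : ι → Set G) (hU : ∀ i, 𝒢.IsBisection (U i))
        (c : ι → R), w' = ∑ i, single (hU i) (1 : ℤ) ⊗ₜ[ℤ] c i) :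
      ∃ (ι : Type) (_ : Fintype ι) (U : ι → Set G) (hU : ∀ i, 𝒢.IsBisection (U i))
        (c : ι → R), w + w' = ∑ i, single (hU i) (1 : ℤ) ⊗ₜ[ℤ] c i := by
    obtain ⟨ι, _, U, hU, c, rfl⟩ := h
    obtain ⟨ι', _, U', hU', c', rfl⟩ := h'
    exact ⟨ι ⊕ ι', inferInstance, Sum.elim U U', Sum.rec hU hU', Sum.elim c c',
      by rw [Fintype.sum_sum_type]; rfl⟩
  induction w with
  | zero => exact ⟨Empty, inferInstance, Empty.elim, fun i => i.elim, Empty.elim, rfl⟩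
  | tmul f c =>
    induction f using induction with
    | single U hU k =>
      refine ⟨Unit, inferInstance, fun _ => U, fun _ => hU, fun _ => k • c, ?_⟩
      rw [Fintype.sum_unique, ← TensorProduct.smul_tmul, ← single_eq_zsmul]
    | add f h hf hh =>
      rw [TensorProduct.add_tmul]
      exact add _ _ hf hh
  | add w w' h h' => exact add w w' h h'

/-- Right multiplication by an element of `ℤG` on `ℤG ⊗ R`. -/
noncomputable def tensorMulRight (R : Type v) [Ring R] (e : 𝒢.ConvAlgebra ℤ) :
    𝒢.ConvAlgebra ℤ ⊗[ℤ] R →ₗ[ℤ] 𝒢.ConvAlgebra ℤ ⊗[ℤ] R :=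
  LinearMap.rTensor R (AddMonoidHom.mulRight e).toIntLinearMap

theorem tensorMulRight_tmul (e f : 𝒢.ConvAlgebra ℤ) (c : R) :
    tensorMulRight R e (f ⊗ₜ c) = (f * e) ⊗ₜ c := rfl

theorem tensorMulRight_tensorMulRight (e e' : 𝒢.ConvAlgebra ℤ) (w : 𝒢.ConvAlgebra ℤ ⊗[ℤ] R) :
    tensorMulRight R e' (tensorMulRight R e w) = tensorMulRight R (e * e') w := by
  induction w with
  | zero => simp only [map_zero]
  | tmul f c => rw [tensorMulRight_tmul, tensorMulRight_tmul, tensorMulRight_tmul, _root_.mul_assoc]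
  | add w w' h h' => simp only [map_add, h, h']

theorem tensorMulRight_add (e e' : 𝒢.ConvAlgebra ℤ) (w : 𝒢.ConvAlgebra ℤ ⊗[ℤ] R) :
    tensorMulRight R (e + e') w = tensorMulRight R e w + tensorMulRight R e' w := by
  induction w with
  | zero => simp only [map_zero, add_zero]
  | tmul f c =>
    rw [tensorMulRight_tmul, tensorMulRight_tmul, tensorMulRight_tmul, mul_add,
      TensorProduct.add_tmul]
  | add w w' h h' => simp only [map_add, h, h']; abel

/-- Multiplying by `1_V` on the right cuts each bisection down to its arrows with source in `V`. For
small `V` around `x`, two truncated bisections coincide as soon as they share the arrow over `x`,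
and those without an arrow over `x` are empty. The total weight of the bisections through an arrow
`g` is the value of `tensorHom 𝒢 R w` at `g`, so the terms cancel already in the tensor product. -/
theorem exists_tensorMulRight_ofUnits_eq_zero {w : 𝒢.ConvAlgebra ℤ ⊗[ℤ] R}
    (hw : tensorHom 𝒢 R w = 0) (x : X) : ∃ (V : Set X) (h : IsOpen V) (h' : IsCompact V),
      x ∈ V ∧ tensorMulRight R (ofUnits h h') w = 0 := by
  classical
  obtain ⟨ι, _, U, hU, c, rfl⟩ := exists_eq_sum_single_tmul w
  have hc (g : G) : ∑ i with g ∈ U i, c i = 0 := by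
    rw [map_sum] at hw
    have := congrFun (congrArg toFun hw) g
    rw [map_sum, Finset.sum_apply, map_zero] at this
    rw [Finset.sum_filter]
    refine Eq.trans (Finset.sum_congr rfl fun i _ => ?_) this
    rw [tensorHom_single_tmul, toFun_single, Int.cast_one, one_mul, Set.indicator_apply]
  -- `O₁ i` discards the sources of `U i` if `U i` has no arrow over `x`; it is open because `s(U
  -- i)` is compact in the Hausdorff space `X`. Over `O₂ i j`, the bisections `U i` and `U j` agree
  -- if they share an arrow over `x`.
  let O₁ (i : ι) : Set X := if x ∈ 𝒢.s '' U i then Set.univ else (𝒢.s '' U i)ᶜ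
  let O₂ (i j : ι) : Set X := if x ∈ 𝒢.s '' (U i ∩ U j) then 𝒢.s '' (U i ∩ U j) else Set.univ
  have hO₁ (i : ι) : IsOpen (O₁ i) ∧ x ∈ O₁ i := by
    by_cases h : x ∈ 𝒢.s '' U i
    · simp only [O₁, if_pos h]
      exact ⟨isOpen_univ, trivial⟩
    · simp only [O₁, if_neg h]
      exact ⟨(hU i).isCompact_image_s.isClosed.isOpen_compl, h⟩
  have hO₂ (i j : ι) : IsOpen (O₂ i j) ∧ x ∈ O₂ i j := by
    by_cases h : x ∈ 𝒢.s '' (U i ∩ U j)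
    · simp only [O₂, if_pos h]
      exact ⟨𝒢.isLocalHomeomorph_s.isOpenMap _ ((hU i).isOpen.inter (hU j).isOpen), h⟩
    · simp only [O₂, if_neg h]
      exact ⟨isOpen_univ, trivial⟩
  obtain ⟨V, h, h', hxV, hVO⟩ := 𝒢.exists_isCompact_isOpen_subset
    (O := (⋂ i, O₁ i) ∩ ⋂ i, ⋂ j, O₂ i j) (x := x)
    ((isOpen_iInter_of_finite fun i => (hO₁ i).1).inter
      (isOpen_iInter_of_finite fun i => isOpen_iInter_of_finite fun j => (hO₂ i j).1))
    ⟨Set.mem_iInter.2 fun i => (hO₁ i).2,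
      Set.mem_iInter.2 fun i => Set.mem_iInter.2 fun j => (hO₂ i j).2⟩
  refine ⟨V, h, h', hxV, ?_⟩
  let S (i : ι) : Set G := U i ∩ 𝒢.s ⁻¹' V
  have hS (i : ι) : 𝒢.IsBisection (S i) := (hU i).inter_preimage_s h h'
  -- Defined on all sets, with value `0` off bisections, so that terms with equal truncations `S i`
  -- can be collected by rewriting.
  let χ (T : Set G) : 𝒢.ConvAlgebra ℤ := if hT : 𝒢.IsBisection T then single hT 1 else 0
  have hsum : tensorMulRight R (ofUnits h h') (∑ i, single (hU i) (1 : ℤ) ⊗ₜ[ℤ] c i) =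
      ∑ i, χ (S i) ⊗ₜ[ℤ] c i := by
    rw [map_sum]
    refine Finset.sum_congr rfl fun i _ => ?_
    rw [tensorMulRight_tmul, single_mul_ofUnits]
    simp only [χ, dif_pos (hS i)]
  rw [hsum, ← Finset.sum_fiberwise_of_maps_to (t := Finset.univ.image S) (g := S)
    fun i hi => Finset.mem_image_of_mem S hi]
  refine Finset.sum_eq_zero fun T hT => ?_
  obtain ⟨j, -, rfl⟩ := Finset.mem_image.1 hT
  have hj : ∑ i with S i = S j, χ (S i) ⊗ₜ[ℤ] c i = χ (S j) ⊗ₜ[ℤ] ∑ i with S i = S j, c i := by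
    rw [TensorProduct.tmul_sum]
    exact Finset.sum_congr rfl fun i hi => by rw [(Finset.mem_filter.1 hi).2]
  rw [hj]
  by_cases hSj : x ∈ 𝒢.s '' U j
  · obtain ⟨g, hg, rfl⟩ := hSj
    -- The terms whose truncation equals `S j` are exactly those through the arrow `g` over the
    -- point, and their weights sum to zero by `hc`.
    have hiff (i : ι) : S i = S j ↔ g ∈ U i := by
      constructor
      · intro e
        have : g ∈ S j := ⟨hg, hxV⟩
        rw [← e] at this
        exact this.1
      · intro hgi
        have hV : V ⊆ 𝒢.s '' (U i ∩ U j) := fun y hy => by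
          have := Set.mem_iInter.1 (Set.mem_iInter.1 (hVO hy).2 i) j
          rwa [show O₂ i j = _ from if_pos ⟨g, ⟨hgi, hg⟩, rfl⟩] at this
        ext a
        constructor
        · rintro ⟨ha, haV⟩
          obtain ⟨b, hb, hba⟩ := hV haV
          obtain rfl := (hU i).injOn_s hb.1 ha hba
          exact ⟨hb.2, haV⟩
        · rintro ⟨ha, haV⟩
          obtain ⟨b, hb, hba⟩ := hV haV
          obtain rfl := (hU j).injOn_s hb.2 ha hba
          exact ⟨hb.1, haV⟩
    simp only [hiff, hc, TensorProduct.tmul_zero]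
  · have hempty : S j = ∅ := by
      refine Set.eq_empty_of_forall_notMem fun a ha => ?_
      have := Set.mem_iInter.1 (hVO ha.2).1 j
      rw [show O₁ j = _ from if_neg hSj] at this
      exact this ⟨a, ha.1, rfl⟩
    have h0 : χ (S j) = 0 := by
      simp only [χ, dif_pos (hS j)]
      refine Subtype.ext ?_
      change (S j).indicator _ = 0
      rw [hempty, Set.indicator_empty]
      rfl
    rw [h0, TensorProduct.zero_tmul]

/-- If `w` maps to zero, it is killed by `1_V` for small `V` around every unit. Finitely many such
`V` cover a compact open `W` with `w 1_W = w`, and their union still kills `w`, whence `w = 0`. -/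
theorem tensorHom_injective : Function.Injective (tensorHom 𝒢 R) := by
  classical
  refine (injective_iff_map_eq_zero _).2 fun w hw => ?_
  have hW : ∃ (W : Set X) (h : IsOpen W) (h' : IsCompact W),
      tensorMulRight R (ofUnits h h') w = w := by
    obtain ⟨ι, _, U, hU, c, rfl⟩ := exists_eq_sum_single_tmul w
    obtain ⟨W, h, h', H⟩ := exists_ofUnits_finset
      (Finset.univ.image fun i => single (hU i) (1 : ℤ))
    refine ⟨W, h, h', ?_⟩
    rw [map_sum]
    refine Finset.sum_congr rfl fun i _ => ?_
    rw [tensorMulRight_tmul, (H _ (Finset.mem_image_of_mem _ (Finset.mem_univ i))).2]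
  obtain ⟨W, oW, cW, hW⟩ := hW
  have key : ∃ (V : Set X) (h : IsOpen V) (h' : IsCompact V), W ⊆ V ∧
      tensorMulRight R (ofUnits h h') w = 0 := by
    refine cW.induction_on (p := fun K => ∃ (V : Set X) (h : IsOpen V) (h' : IsCompact V), K ⊆ V ∧
      tensorMulRight R (ofUnits h h') w = 0) ?_ ?_ ?_ ?_
    · refine ⟨∅, isOpen_empty, isCompact_empty, subset_rfl, ?_⟩
      have h0 : (ofUnits isOpen_empty isCompact_empty : 𝒢.ConvAlgebra ℤ) = 0 := by
        refine Subtype.ext ?_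
        change (𝒢.unit '' ∅).indicator _ = 0
        rw [Set.image_empty, Set.indicator_empty]
        rfl
      rw [h0]
      have h2 := tensorMulRight_add (R := R) (0 : 𝒢.ConvAlgebra ℤ) 0 w
      rw [add_zero] at h2
      exact left_eq_add.1 h2
    · rintro s t hst ⟨V, h, h', hV, H⟩
      exact ⟨V, h, h', hst.trans hV, H⟩
    · rintro s t ⟨V₁, o₁, c₁, h₁, H₁⟩ ⟨V₂, o₂, c₂, h₂, H₂⟩
      -- The union is made disjoint, so that its characteristic function is a sum; the part `V₂ \
      -- V₁` still kills `w` because its characteristic function is a multiple of `1_{V₂}`.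
      have o : IsOpen (V₂ \ V₁) := o₂.sdiff c₁.isClosed
      have c : IsCompact (V₂ \ V₁) := c₂.diff o₁
      refine ⟨V₁ ∪ V₂, o₁.union o₂, c₁.union c₂, Set.union_subset_union h₁ h₂, ?_⟩
      have e : (ofUnits (o₁.union o₂) (c₁.union c₂) : 𝒢.ConvAlgebra ℤ) =
          ofUnits o₁ c₁ + ofUnits o c := by
        refine Subtype.ext ?_
        change (𝒢.unit '' (V₁ ∪ V₂)).indicator _ =
          (𝒢.unit '' V₁).indicator _ + (𝒢.unit '' (V₂ \ V₁)).indicator _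
        have hi : Function.Injective 𝒢.unit := fun y z h => by
          rw [← 𝒢.s_unit y, h, 𝒢.s_unit]
        rw [← Set.union_sdiff_self, Set.image_union, Set.indicator_union_of_disjoint]
        · rfl
        · exact (Set.disjoint_image_iff hi).2 Set.disjoint_sdiff_right
      rw [e, tensorMulRight_add, H₁, zero_add,
        ← ofUnits_mul_ofUnits_of_subset_right o c o₂ c₂ Set.sdiff_subset,
        ← tensorMulRight_tensorMulRight, H₂, map_zero]
    · intro x _
      obtain ⟨V, h, h', hx, H⟩ := exists_tensorMulRight_ofUnits_eq_zero hw x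
      exact ⟨V, mem_nhdsWithin_of_mem_nhds (h.mem_nhds hx), V, h, h', subset_rfl, H⟩
  obtain ⟨V, h, h', hWV, H⟩ := key
  rw [← hW, ← ofUnits_mul_ofUnits_of_subset_right oW cW h h' hWV,
    ← tensorMulRight_tensorMulRight, H, map_zero]

variable (𝒢 R) in
/-- The isomorphism `ℤG ⊗ R ≃ RG`. -/
noncomputable def tensorEquiv : 𝒢.ConvAlgebra ℤ ⊗[ℤ] R ≃+ 𝒢.ConvAlgebra R :=
  AddEquiv.ofBijective (tensorHom 𝒢 R) ⟨tensorHom_injective, tensorHom_surjective⟩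

theorem tensorEquiv_symm_single {U : Set G} (hU : 𝒢.IsBisection U) (c : R) :
    (tensorEquiv 𝒢 R).symm (single hU c) = single hU 1 ⊗ₜ c := by
  rw [AddEquiv.symm_apply_eq]
  refine Eq.symm ((tensorHom_single_tmul hU 1 c).trans ?_)
  rw [Int.cast_one, one_mul]

end ConvAlgebra

end AmpleGroupoid

/-! ### Change of rings for the homology of ample groupoids -/

theorem AddMonoidHom.nonempty_ker_addEquiv_of_comm {B C B' C' : Type*} [AddCommGroup B]
    [AddCommGroup C] [AddCommGroup B'] [AddCommGroup C'] {f : B →+ C} {f' : B' →+ C'} (e : B ≃+ B')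
    (e' : C ≃+ C') (h : ∀ x, e' (f x) = f' (e x)) : Nonempty (f.ker ≃+ f'.ker) := by
  have hk : f.ker.map e.toAddMonoidHom = f'.ker := by
    ext z
    rw [AddSubgroup.mem_map_equiv, AddMonoidHom.mem_ker, AddMonoidHom.mem_ker]
    obtain ⟨z, rfl⟩ := e.surjective z
    rw [e.symm_apply_apply, ← h, map_eq_zero_iff e' e'.injective]
  exact ⟨(e.addSubgroupMap _).trans (AddEquiv.addSubgroupCongr hk)⟩

theorem BalTensor.rMap_injective_of_linearEquiv {A : Type u} [NonUnitalRing A]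
    {N N' M M' : Type u} [AddCommGroup N] [Module (AdjoinOne Aᵐᵒᵖ) N]
    [AddCommGroup N'] [Module (AdjoinOne Aᵐᵒᵖ) N'] [AddCommGroup M] [Module (AdjoinOne A) M]
    [AddCommGroup M'] [Module (AdjoinOne A) M'] (e : M ≃ₗ[AdjoinOne A] M')
    {g : N →ₗ[AdjoinOne Aᵐᵒᵖ] N'} (h : Function.Injective (rMap M' g)) :
    Function.Injective (rMap M g) := by
  refine (injective_iff_map_eq_zero _).2 fun z hz => ?_
  have h1 : lMap N e.toLinearMap z = 0 := h (by rw [rMap_lMap, hz, map_zero, map_zero])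
  have h2 : lMap N e.symm.toLinearMap (lMap N e.toLinearMap z) = z := by
    rw [lMap_lMap, LinearEquiv.symm_comp]
    exact rMap_id z
  rw [← h2, h1, map_zero]

namespace AmpleGroupoid

variable {X G : Type u} [TopologicalSpace X] [LocallyCompactSpace X] [T2Space X]
  [TotallyDisconnectedSpace X] [TopologicalSpace G] {𝒢 : AmpleGroupoid X G}
  {R : Type u} [Ring R]

variable (𝒢 R) in
/-- The algebra `RG` as a left `ℤG`-module. -/
@[reducible]
noncomputable def ConvAlgebra.intModule :
    Module (AdjoinOne (𝒢.ConvAlgebra ℤ)) (𝒢.ConvAlgebra R) :=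
  Module.compHom _ (AdjoinOne.lift (AdjoinOne.of.comp (ConvAlgebra.ofInt 𝒢 R)))

attribute [local instance] ConvAlgebra.intModule

theorem of_smul_convAlgebra (f : 𝒢.ConvAlgebra ℤ) (h : 𝒢.ConvAlgebra R) :
    AdjoinOne.of f • h = ConvAlgebra.ofInt 𝒢 R f * h := by
  refine Eq.trans ?_ (AdjoinOne.of_smul (ConvAlgebra.ofInt 𝒢 R f) h)
  change AdjoinOne.lift (AdjoinOne.of.comp (ConvAlgebra.ofInt 𝒢 R)) (AdjoinOne.of f) • h = _
  rw [AdjoinOne.lift_of]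
  rfl

/-! ### Tensor products with `RG` over `ℤG` inside tensor products with `R` over `ℤ` -/

section

variable {N N' : Type u} [AddCommGroup N] [Module (AdjoinOne (𝒢.ConvAlgebra ℤ)ᵐᵒᵖ) N]
  [AddCommGroup N'] [Module (AdjoinOne (𝒢.ConvAlgebra ℤ)ᵐᵒᵖ) N']

/-- The homomorphism `ℤG ⊗ R → N ⊗ R` given by an element of a right `ℤG`-module `N`. -/
noncomputable def orbitTensor (R : Type u) [Ring R] (n : N) :
    𝒢.ConvAlgebra ℤ ⊗[ℤ] R →ₗ[ℤ] N ⊗[ℤ] R :=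
  LinearMap.rTensor R ((AdjoinOne.toModule n).toAddMonoidHom.comp
    (MulOpposite.opAddEquiv : 𝒢.ConvAlgebra ℤ ≃+ _).toAddMonoidHom).toIntLinearMap

theorem orbitTensor_tmul (n : N) (f : 𝒢.ConvAlgebra ℤ) (c : R) :
    orbitTensor R n (f ⊗ₜ c) = (AdjoinOne.of (MulOpposite.op f) • n) ⊗ₜ c := rfl

theorem orbitTensor_add (n n' : N) (w : 𝒢.ConvAlgebra ℤ ⊗[ℤ] R) :
    orbitTensor R (n + n') w = orbitTensor R n w + orbitTensor R n' w := by
  induction w with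
  | zero => simp only [map_zero, add_zero]
  | tmul f c =>
    rw [orbitTensor_tmul, orbitTensor_tmul, orbitTensor_tmul, smul_add, TensorProduct.add_tmul]
  | add w w' h h' => simp only [map_add, h, h']; abel

variable (N R) in
/-- The homomorphism `N ⊗_{ℤG} RG → N ⊗ R`. -/
noncomputable def toTensor : BalTensor (𝒢.ConvAlgebra ℤ) N (𝒢.ConvAlgebra R) →+ N ⊗[ℤ] R :=
  BalTensor.lift (AddMonoidHom.mk' (fun n => (orbitTensor R n).toAddMonoidHom.comp
      (ConvAlgebra.tensorEquiv 𝒢 R).symm.toAddMonoidHom) fun n n' =>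
        AddMonoidHom.ext fun f => orbitTensor_add n n' _) fun n f h => by
    change orbitTensor R _ ((ConvAlgebra.tensorEquiv 𝒢 R).symm h) =
      orbitTensor R n ((ConvAlgebra.tensorEquiv 𝒢 R).symm (AdjoinOne.of f • h))
    rw [of_smul_convAlgebra]
    -- For `f = k 1_V` and `h = c 1_U` both sides are `n 1_V 1_U ⊗ k c`; only the integer `k` has to
    -- be moved between the factors.
    induction h using ConvAlgebra.induction with
    | single U hU c =>
      induction f using ConvAlgebra.induction with
      | single V hV k =>
        have e : ConvAlgebra.single (hV.setMul hU) ((k : R) * c) =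
            ConvAlgebra.single (hV.setMul hU) (k • c) := by rw [zsmul_eq_mul]
        rw [ConvAlgebra.ofInt_single, ConvAlgebra.single_mul_single, e,
          ConvAlgebra.tensorEquiv_symm_single, ConvAlgebra.tensorEquiv_symm_single,
          orbitTensor_tmul, orbitTensor_tmul, ← mul_smul, ← map_mul, ← MulOpposite.op_mul,
          ConvAlgebra.single_mul_single, ← TensorProduct.smul_tmul, mul_one,
          ConvAlgebra.single_eq_zsmul _ k, MulOpposite.op_smul, map_zsmul, smul_assoc]
      | add f f' h1 h2 =>
        rw [MulOpposite.op_add, map_add, add_smul, orbitTensor_add, h1, h2, map_add, add_mul,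
          map_add, map_add]
    | add h h' h1 h2 => rw [map_add, map_add, h1, h2, mul_add, map_add, map_add]

theorem toTensor_tmul_single (n : N) {U : Set G} (hU : 𝒢.IsBisection U) (c : R) :
    toTensor R N (BalTensor.tmul (𝒢.ConvAlgebra ℤ) n (ConvAlgebra.single hU c)) =
      (AdjoinOne.of (MulOpposite.op (ConvAlgebra.single hU (1 : ℤ))) • n) ⊗ₜ c :=
  congrArg (orbitTensor R n) (ConvAlgebra.tensorEquiv_symm_single hU c)

theorem toTensor_rMap (g : N →ₗ[AdjoinOne (𝒢.ConvAlgebra ℤ)ᵐᵒᵖ] N')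
    (z : BalTensor (𝒢.ConvAlgebra ℤ) N (𝒢.ConvAlgebra R)) :
    toTensor R N' (BalTensor.rMap _ g z) =
      LinearMap.rTensor R g.toAddMonoidHom.toIntLinearMap (toTensor R N z) := by
  induction z using BalTensor.induction with
  | tmul n f =>
    rw [BalTensor.map_tmul]
    induction f using ConvAlgebra.induction with
    | single U hU c =>
      rw [LinearMap.id_apply, toTensor_tmul_single, toTensor_tmul_single, LinearMap.rTensor_tmul,
        ← map_smul]
      rfl
    | add f f' h h' =>
      rw [map_add, BalTensor.tmul_add_right, BalTensor.tmul_add_right, map_add, map_add, map_add,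
        h, h']
  | add x y hx hy => rw [map_add, map_add, map_add, map_add, hx, hy]

variable (N) in
/-- The homomorphism `N ⊗ R → N ⊗_{ℤG} RG` given by a compact open set of units. -/
noncomputable def ofTensor (R : Type u) [Ring R] {W : Set X} (h : IsOpen W) (h' : IsCompact W) :
    N ⊗[ℤ] R →+ BalTensor (𝒢.ConvAlgebra ℤ) N (𝒢.ConvAlgebra R) :=
  TensorProduct.liftAddHom (AddMonoidHom.mk' (fun n => AddMonoidHom.mk' (fun c =>
      BalTensor.tmul _ n (ConvAlgebra.single (isBisection_unit h h') c)) fun c c' => by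
        rw [ConvAlgebra.single_add, BalTensor.tmul_add_right]) fun n n' =>
          AddMonoidHom.ext fun c => BalTensor.tmul_add_left n n' _) fun k n c => by
    rw [map_zsmul, map_zsmul]
    rfl

theorem ofTensor_tmul {W : Set X} (h : IsOpen W) (h' : IsCompact W) (n : N) (c : R) :
    ofTensor N R h h' (n ⊗ₜ c) = BalTensor.tmul (𝒢.ConvAlgebra ℤ) n
      (ConvAlgebra.single (isBisection_unit h h') c) := rfl

/-- If `W` contains `s(U)`, then `n 1_U ⊗ c` goes back to `n 1_U ⊗ c 1_W = n ⊗ c 1_U`. No single `W`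
works for all `z`, but a left inverse depending on `z` is enough for injectivity of `toTensor`, and
`N` need not be unitary. -/
theorem exists_ofTensor_toTensor (z : BalTensor (𝒢.ConvAlgebra ℤ) N (𝒢.ConvAlgebra R)) :
    ∃ W : Set X, IsOpen W ∧ IsCompact W ∧ ∀ (W' : Set X) (h : IsOpen W') (h' : IsCompact W'),
      W ⊆ W' → ofTensor N R h h' (toTensor R N z) = z := by
  have add (x y : BalTensor (𝒢.ConvAlgebra ℤ) N (𝒢.ConvAlgebra R))
      (hx : ∃ W : Set X, IsOpen W ∧ IsCompact W ∧ ∀ (W' : Set X) (h : IsOpen W')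
        (h' : IsCompact W'), W ⊆ W' → ofTensor N R h h' (toTensor R N x) = x)
      (hy : ∃ W : Set X, IsOpen W ∧ IsCompact W ∧ ∀ (W' : Set X) (h : IsOpen W')
        (h' : IsCompact W'), W ⊆ W' → ofTensor N R h h' (toTensor R N y) = y) :
      ∃ W : Set X, IsOpen W ∧ IsCompact W ∧ ∀ (W' : Set X) (h : IsOpen W') (h' : IsCompact W'),
        W ⊆ W' → ofTensor N R h h' (toTensor R N (x + y)) = x + y := by
    obtain ⟨W₁, o₁, c₁, h₁⟩ := hx
    obtain ⟨W₂, o₂, c₂, h₂⟩ := hy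
    refine ⟨W₁ ∪ W₂, o₁.union o₂, c₁.union c₂, fun W' o c hW => ?_⟩
    rw [map_add, map_add, h₁ W' o c (Set.union_subset_iff.1 hW).1,
      h₂ W' o c (Set.union_subset_iff.1 hW).2]
  induction z using BalTensor.induction with
  | tmul n f =>
    induction f using ConvAlgebra.induction with
    | single U hU c =>
      refine ⟨𝒢.s '' U, hU.isOpen_image_s, hU.isCompact_image_s, fun W h h' hW => ?_⟩
      rw [toTensor_tmul_single, ofTensor_tmul, BalTensor.smul_tmul, of_smul_convAlgebra,
        ConvAlgebra.ofInt_single, ConvAlgebra.single_mul_single_unit _ _ _ h h' hW, Int.cast_one,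
        one_mul]
    | add f f' h h' =>
      rw [BalTensor.tmul_add_right]
      exact add _ _ h h'
  | add x y hx hy => exact add x y hx hy

theorem toTensor_injective : Function.Injective
    (toTensor R N : BalTensor (𝒢.ConvAlgebra ℤ) N (𝒢.ConvAlgebra R) →+ N ⊗[ℤ] R) := by
  refine (injective_iff_map_eq_zero _).2 fun z hz => ?_
  obtain ⟨W, h, h', H⟩ := exists_ofTensor_toTensor z
  rw [← H W h h' subset_rfl, hz, map_zero]

end

/-- If `N` is a torsion-free abelian group, then `ker f ⊗ RG → F ⊗ RG` is injective for every
surjective homomorphism `f : F → N` of right `ℤG`-modules. -/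
theorem rMap_kerι_convAlgebra_injective {F N : UnitaryMod (𝒢.ConvAlgebra ℤ)ᵐᵒᵖ}
    {f : F ⟶ N} (hf : Function.Surjective f.hom) [Module.IsTorsionFree ℤ N.obj] :
    Function.Injective (BalTensor.rMap (𝒢.ConvAlgebra R) (UnitaryMod.kerι f).hom.hom) := by
  refine (injective_iff_map_eq_zero _).2 fun z hz => toTensor_injective ?_
  -- A torsion-free abelian group is flat over `ℤ`, so the exact sequence ending in `N` keeps its
  -- injection after tensoring with the arbitrary group `R`.
  have h := LinearMap.lTensor_injective_of_exact_of_flat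
    f.hom.hom.toAddMonoidHom.toIntLinearMap hf
    (UnitaryMod.kerι f).hom.hom.toAddMonoidHom.toIntLinearMap (UnitaryMod.kerι_injective f)
    (UnitaryMod.kerι_exact f) R
  rw [LinearMap.lTensor_inj_iff_rTensor_inj] at h
  refine h ?_
  rw [← toTensor_rMap, hz]
  simp only [map_zero]

/-- The free `RG`-module as a finitary power of the `ℤG`-module `RG`. -/
noncomputable def restrictIntFreeModuleEquiv (I : Type u) :
    (𝒢.restrictInt (UnitaryMod.freeModule (𝒢.ConvAlgebra R) I)).obj ≃ₗ[AdjoinOne (𝒢.ConvAlgebra ℤ)]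
      (I →₀ 𝒢.ConvAlgebra R) :=
  { AdjoinOne.linearMapOfMapSMul (A := 𝒢.ConvAlgebra ℤ)
      (M := (𝒢.restrictInt (UnitaryMod.freeModule (𝒢.ConvAlgebra R) I)).obj)
      (M' := I →₀ 𝒢.ConvAlgebra R) (AddMonoidHom.id (I →₀ 𝒢.ConvAlgebra R)) fun f m => by
        refine Finsupp.ext fun i => ?_
        refine Eq.trans ?_ (of_smul_convAlgebra f _).symm
        refine Eq.trans ?_ (AdjoinOne.of_smul _ _)
        exact DFunLike.congr_fun (F := I →₀ 𝒢.ConvAlgebra R)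
          (of_smul_restrictInt (UnitaryMod.freeModule _ I) f m) i with
    invFun := id
    left_inv := fun _ => rfl
    right_inv := fun _ => rfl }

/-- The canonical free resolution of an `RG`-module, regarded as a sequence of `ℤG`-modules. -/
noncomputable def restrictIntSyzygySequence (M : UnitaryMod (𝒢.ConvAlgebra R)) :
    UnitaryMod.SyzygySequence (𝒢.ConvAlgebra ℤ) where
  L j := 𝒢.restrictInt (M.freeSyzygySequence.L j)
  Q j := 𝒢.restrictInt (M.freeSyzygySequence.Q j)
  ι j := restrictIntMap (M.freeSyzygySequence.ι j)
  π j := restrictIntMap (M.freeSyzygySequence.π j)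
  injective := M.freeSyzygySequence.injective
  exact := M.freeSyzygySequence.exact
  surjective := M.freeSyzygySequence.surjective

/-! ### Torsion-free right modules and the comparison of Tor -/

theorem isTorsionFree_of_injective {M M' : Type*} [AddCommGroup M] [AddCommGroup M']
    (f : M →+ M') (hf : Function.Injective f) (h : Module.IsTorsionFree ℤ M') :
    Module.IsTorsionFree ℤ M :=
  hf.moduleIsTorsionFree f fun k m => map_zsmul f k m

theorem ConvAlgebra.isTorsionFree : Module.IsTorsionFree ℤ (𝒢.ConvAlgebra ℤ) :=
  isTorsionFree_of_injective (ConvAlgebra.toFun : _ →+ (G → ℤ)) Subtype.val_injective inferInstance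

theorem UnitFunctions.isTorsionFree : Module.IsTorsionFree ℤ (𝒢.UnitFunctions ℤ) :=
  isTorsionFree_of_injective
    ({ toFun := Subtype.val, map_zero' := rfl, map_add' := fun _ _ => rfl } : _ →+ (X → ℤ))
    Subtype.val_injective inferInstance

/-- A projective module embeds in a free one, and hence in a power of the torsion-free group `ℤG`.
-/
theorem isTorsionFree_of_projective (P : UnitaryMod (𝒢.ConvAlgebra ℤ)ᵐᵒᵖ) [Projective P] :
    Module.IsTorsionFree ℤ P.obj := by
  obtain ⟨s, hs⟩ := P.exists_section_freeCover
  have hs' : Function.Injective s.hom := Function.LeftInverse.injective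
    (g := (UnitaryMod.freeCover P).hom) fun x => congrArg (fun f => f.hom x) hs
  let φ : (P.obj →₀ (𝒢.ConvAlgebra ℤ)ᵐᵒᵖ) →+ (P.obj → 𝒢.ConvAlgebra ℤ) :=
    { toFun := fun f i => (f i).unop, map_zero' := rfl, map_add' := fun _ _ => rfl }
  have hφ : Function.Injective φ := fun f g h =>
    Finsupp.ext fun i => MulOpposite.unop_injective (congrFun h i)
  have := ConvAlgebra.isTorsionFree (𝒢 := 𝒢)
  exact isTorsionFree_of_injective (φ.comp s.hom.hom.toAddMonoidHom) (hφ.comp hs') inferInstance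

/-- The homology of `G` with coefficients in an `RG`-module is `Tor` over `RG`. -/
theorem nonempty_homology_iso_unitaryTor (M : UnitaryMod (𝒢.ConvAlgebra R)) (n : ℕ) :
    Nonempty (𝒢.homology n (𝒢.restrictInt M) ≅ unitaryTor n (𝒢.trivialModule R) M) := by
  suffices h : Nonempty (𝒢.homology n (𝒢.restrictInt M) ≃+ unitaryTor n (𝒢.trivialModule R) M) from
    h.map AddEquiv.toAddCommGrpIso
  cases n with
  | zero =>
    obtain ⟨e⟩ := UnitaryMod.nonempty_unitaryTor_zero_addEquiv (𝒢.trivialModule ℤ) (𝒢.restrictInt M)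
    obtain ⟨e'⟩ := UnitaryMod.nonempty_unitaryTor_zero_addEquiv (𝒢.trivialModule R) M
    exact ⟨e.trans ((intTensorEquiv M).trans e'.symm)⟩
  | succ n =>
    -- Over `ℤG` the class `T` consists of the torsion-free modules. For these, direct sums of
    -- copies of `RG` are acyclic, so the resolution over `RG` computes Tor over `ℤG`.
    obtain ⟨e⟩ := UnitaryMod.nonempty_unitaryTor_succ_addEquiv_ker (restrictIntSyzygySequence M)
      (fun N => Module.IsTorsionFree ℤ N.obj)
      (fun f h => isTorsionFree_of_injective (UnitaryMod.kerι f).hom.hom.toAddMonoidHom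
        (UnitaryMod.kerι_injective f) h)
      (fun P _ => isTorsionFree_of_projective P)
      (fun f hf _ j => BalTensor.rMap_injective_of_linearEquiv (restrictIntFreeModuleEquiv _)
        (BalTensor.rMap_finsupp_injective (rMap_kerι_convAlgebra_injective hf) _)) n
      (N := 𝒢.trivialModule ℤ) UnitFunctions.isTorsionFree
    -- Over `RG` the same resolution consists of flat modules and no restriction on `T` is needed.
    -- Naturality of `intTensorEquiv` then matches the two kernels.
    obtain ⟨e'⟩ := UnitaryMod.nonempty_unitaryTor_succ_addEquiv_ker M.freeSyzygySequence
      (fun _ => True) (fun _ _ => trivial) (fun _ _ => trivial)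
      (fun f _ _ _ => rMap_freeModule_kerι_injective f _) n (N := 𝒢.trivialModule R) trivial
    obtain ⟨E⟩ := AddMonoidHom.nonempty_ker_addEquiv_of_comm
      (intTensorEquiv (M.freeSyzygySequence.L (n + 1))) (intTensorEquiv (M.freeSyzygySequence.Q n))
      (intTensorEquiv_lMap (M.freeSyzygySequence.ι n))
    exact ⟨e.trans (E.trans e'.symm)⟩

end AmpleGroupoid

theorem corollaryc (R : Type u) [Ring R] {X G : Type u} [TopologicalSpace X] [LocallyCompactSpace X]
    [T2Space X] [TotallyDisconnectedSpace X] [TopologicalSpace G] (𝒢 : AmpleGroupoid X G) :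
    (∀ (M : UnitaryMod (𝒢.ConvAlgebra R)) (n : ℕ),
      Nonempty (𝒢.homology n (𝒢.restrictInt M) ≅ unitaryTor n (𝒢.trivialModule R) M)) ∧
    𝒢.homologicalDimension R = flatDimension (𝒢.trivialModule R) ∧
    (𝒢.homologicalDimension R = 0 ↔ IsFlatUnitary (𝒢.trivialModule R)) := by
  -- By part 1 the homological dimension depends only on Tor over `RG`, where the general result on
  -- flat dimension applies.
  have hd : 𝒢.homologicalDimension R = sSup {d : ℕ∞ | ∃ n : ℕ, d = n ∧
      ∃ M : UnitaryMod (𝒢.ConvAlgebra R), Nontrivial (unitaryTor n (𝒢.trivialModule R) M)} := by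
    refine congrArg sSup (Set.ext fun d => exists_congr fun n => and_congr_right fun _ =>
      exists_congr fun M => ?_)
    obtain ⟨e⟩ := AmpleGroupoid.nonempty_homology_iso_unitaryTor M n
    exact e.addCommGroupIsoToAddEquiv.toEquiv.nontrivial_congr
  refine ⟨AmpleGroupoid.nonempty_homology_iso_unitaryTor, ?_, ?_⟩
  · rw [hd, sSup_nontrivial_unitaryTor]
  -- Flatness is the existence of a flat resolution of length `0`, that is, dimension at most `0`.
  · rw [hd, ← hasFlatResolution_zero_iff, ← sSup_nontrivial_unitaryTor_le_iff, Nat.cast_zero,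
      nonpos_iff_eq_zero]
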